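/- **Setting.** Let $Q$ be a finite quiver with vertex set $\mathcal I$, edge set $\mathcal E$, head and tail maps $h,t:\mathcal E\to\mathcal I$, no edge loops, and a distinguished vertex $\infty$. Let $\tilde Q$ be the doubled quiver with edges $\mathcal E\cup\bar{\mathcal E}$, where $\bar a$ is $a$ reversed. For $v\in\mathbb Z_{\ge0}^{\mathcal I}$ with $v_\infty=1$ put $V_i=\mathbb C^{v_i}$ with its standard Hermitian structure, $\mathrm{Rep}(\tilde Q,v)=\bigoplus_{a}\mathrm{Hom}(V_{t(a)},V_{h(a)})$, $G_v=\prod_i GL(V_i)$, and let $\mu_I(A,B)=\frac1{2i}\sum_{a\in\mathcal E}\big([A_a,A_a^*]+[B_{\bar a},B_{\bar a}^*]\big)$, $\mu_{\mathbb C}(A,B)=\sum_{a\in\mathcal E}[A_a,B_{\bar a}]$. Let $\alpha(Q,v)$ be the stability parameter $\alpha_\infty=-\sum_{j\ne\infty}v_j$, $\alpha_i=1$ for $i\neq\infty$ (also regarded as the central element $(i\alpha_j\,\mathrm{id}_{V_j})_j$). Let $\mathcal M(Q,v)=\mu_{\mathbb C}^{-1}(0)^{\alpha\text{-st}}/G_v$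 be the quotient of the $\alpha(Q,v)$-stable points (GIT stability for the lift of the action to $\mathrm{Rep}(\tilde Q,v)\times\mathbb C$ by the character $\prod_i\det(g_i)^{\alpha_i}$), with the quotient topology. For a vertex $k\ne\infty$ and $r\ge0$, let $\mathcal M_{k;r}(Q,v)\subset\mathcal M(Q,v)$ be the set of classes $[x]$ such that $\sum_{h(a)=k}\mathrm{im}\,x_a$ (sum over the edges of $\tilde Q$) has codimension $r$ in $V_k$. *Nakajima's projection* $p:\mathcal M_{k;r}(Q,v)\to\mathcal M_{k;0}(Q,v-re_k)$ is defined as follows: fix $V_k'\subset V_k$ of codimension $r$, choose a representative $x$ of the class with $\sum_{h(a)=k}\mathrm{im}\,x_a\subset V_k'$, and let $p([x])$ be the class of the restriction of $x$ to the spaces $V_k'$ and $V_i$ $(i\ne k)$. *Approximate flow lines.* Let $v_1\le v$ with $(v_1)_\infty=1$, and fix the standard inclusions $\mathbb C^{(v_1)_i}\subset\mathbb C^{v_i}$. Write $(x_1,0)$ for the extension by zero of $x_1\in\mathrm{Rep}(\tilde Q,v_1)$. For a critical point $x\in\mu_{\mathbb C}^{-1}(0)$ of $f=\|\mu_I-\alpha(Q,v)\|^2$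 on $\mathrm{Rep}(\tilde Q,v)$ let $S_x^-$ be the set of those $\delta x$ in the sum of the negative eigenspaces of the Hessian of $f$ at $x$ that are orthogonal to the tangent space of the orbit $G_v\cdot x$ and satisfy $\mu_{\mathbb C}(x+\delta x)=0$. Then $\mathcal{MF}(Q,v_1,v)\subset\mathcal M(Q,v_1)\times\mathcal M(Q,v)$ is the set of pairs of classes that have representatives $x_1$, $x_2$ such that $(x_1,0)$ and $x_2$ are critical points of $f$ and $(x_1,0)+\delta x\in G_v\cdot x_2$ for some $\delta x\in S_{(x_1,0)}^-$. **Proposition.** The map $p:\mathcal M_{k;r}(Q,v)\to\mathcal M_{k;0}(Q,v-re_k)$ is well defined. For every $[x]\in\mathcal M_{k;r}(Q,v)$ there is a unique $[x_0]\in\mathcal M_{k;0}(Q,v-re_k)$ such that $([x_0],[x])\in\mathcal{MF}(Q,v-re_k,v)$, and $[x_0]=p([x])$. Consequently the restriction of the flow-line projection recovers Nakajima's projection $p$ (the bundle map of Nakajima's Grassmann bundle): the second projection maps $$\big(\mathcal M_{k;0}(Q,v-re_k)\times\mathcal M_{k;r}(Q,v)\big)\cap\mathcal{MF}(Q,v-re_k,v)$$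 homeomorphically onto $\mathcal M_{k;r}(Q,v)$, and under this homeomorphism the first projection becomes $p$. -/

import Mathlib

open scoped Matrix

noncomputable section

namespace NakajimaFlow

universe u w

/-! ### Quivers and their representations -/

/-- A quiver with vertices `I`, edges `E` and head/tail maps. -/
structure Quiv (I : Type u) (E : Type w) where
  head : E → I
  tail : E → I

/-- The quiver `Q̃` with the same vertices and with edges `E ∪ Ē`: the edge `inl a` is `a`,
and the edge `inr a` is `a` with the opposite orientation. -/
def Quiv.double {I : Type u} {E : Type w} (Q : Quiv I E) : Quiv I (E ⊕ E) where
  head := Sum.elim Q.head Q.tail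
  tail := Sum.elim Q.tail Q.head

/-- The space `Rep(Q, v)`, with `V_i = ℂ^{v_i}` carrying its standard Hermitian structure. -/
abbrev Rep {I : Type u} {E : Type w} (Q : Quiv I E) (v : I → ℕ) : Type w :=
  ∀ a : E, Matrix (Fin (v (Q.head a))) (Fin (v (Q.tail a))) ℂ

/-- The group `G_v = ∏ GL(V_i)`. -/
abbrev Gauge {I : Type u} (v : I → ℕ) : Type u := ∀ i, GL (Fin (v i)) ℂ

/-- The Lie algebra `𝔤_v = ⨁ End(V_i)`. -/
abbrev GaugeLie {I : Type u} (v : I → ℕ) : Type u := ∀ i, Matrix (Fin (v i)) (Fin (v i)) ℂ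

section General

variable {I : Type u} {E : Type w} {Q : Quiv I E} {v : I → ℕ}

/-- The action `(g · A)_a = g_{h(a)} A_a g_{t(a)}⁻¹` of `G_v` on `Rep(Q, v)`. -/
def act (g : Gauge v) (A : Rep Q v) : Rep Q v := fun a =>
  (g (Q.head a) : Matrix (Fin (v (Q.head a))) (Fin (v (Q.head a))) ℂ) * A a *
    (((g (Q.tail a))⁻¹ : GL (Fin (v (Q.tail a))) ℂ) :
      Matrix (Fin (v (Q.tail a))) (Fin (v (Q.tail a))) ℂ)

theorem act_one (A : Rep Q v) : act 1 A = A := by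
  funext a; simp [act]

theorem act_mul (g h : Gauge v) (A : Rep Q v) : act (g * h) A = act g (act h A) := by
  funext a; simp [act, mul_inv_rev, Matrix.mul_assoc]

/-- Isomorphism of representations: being in the same `G_v`-orbit. -/
def orbitSetoid (Q : Quiv I E) (v : I → ℕ) : Setoid (Rep Q v) where
  r A B := ∃ g : Gauge v, act g A = B
  iseqv :=
    { refl := fun A => ⟨1, act_one A⟩
      symm := by
        rintro A B ⟨g, rfl⟩
        exact ⟨g⁻¹, by rw [← act_mul, inv_mul_cancel, act_one]⟩
      trans := by
        rintro A B C ⟨g, rfl⟩ ⟨h, rfl⟩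
        exact ⟨h * g, act_mul h g A⟩ }

/-- The space of `G_v`-orbits in `Rep(Q, v)`, with the quotient topology. -/
abbrev Orbits (Q : Quiv I E) (v : I → ℕ) : Type w := Quotient (orbitSetoid Q v)

/-- The orbit `[A]`. -/
def toOrbit (A : Rep Q v) : Orbits Q v := Quotient.mk (orbitSetoid Q v) A

/-- The infinitesimal action `ρ_A(u) = (u_{h(a)} A_a - A_a u_{t(a)})_a` of `𝔤_v`. -/
def infAct (A : Rep Q v) (u : GaugeLie v) : Rep Q v := fun a =>
  u (Q.head a) * A a - A a * u (Q.tail a)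

/-! ### Stability (geometric invariant theory) -/

/-- The character `χ_α(g) = ∏ (det g_i)^{α_i}` of `G_v`. -/
def character [Fintype I] (α : I → ℤ) (g : Gauge v) : ℂ :=
  ∏ i, (g i : Matrix (Fin (v i)) (Fin (v i)) ℂ).det ^ α i

/-- The orbit of `(A, ξ)` in the trivial line bundle `Rep(Q, v) × ℂ` for the action lifted
by `χ_α`. -/
def liftedOrbit [Fintype I] (α : I → ℤ) (A : Rep Q v) (ξ : ℂ) : Set (Rep Q v × ℂ) :=
  Set.range fun g : Gauge v => (act g A, character α g * ξ)

def IsSemistable [Fintype I] (α : I → ℤ) (A : Rep Q v) : Prop :=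
  ∀ ξ : ℂ, ξ ≠ 0 → closure (liftedOrbit α A ξ) ∩ {p | p.2 = 0} = ∅

def IsPolystable [Fintype I] (α : I → ℤ) (A : Rep Q v) : Prop :=
  IsSemistable α A ∧ ∀ ξ : ℂ, ξ ≠ 0 → IsClosed (liftedOrbit α A ξ)

/-- `A` is stable if it is polystable and its isotropy group consists of scalars. -/
def IsStable [Fintype I] (α : I → ℤ) (A : Rep Q v) : Prop :=
  IsPolystable α A ∧
    ∀ g : Gauge v, act g A = A →
      ∃ c : ℂ, ∀ i, (g i : Matrix (Fin (v i)) (Fin (v i)) ℂ) = c • 1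

/-- The canonical stability parameter: `-∑_{j ≠ ∞} v_j` at the vertex `∞ = o`, and `1` at all
other vertices. -/
def canonicalParam [Fintype I] [DecidableEq I] (o : I) (v : I → ℕ) : I → ℤ := fun i =>
  if i = o then -∑ j ∈ Finset.univ.erase o, (v j : ℤ) else 1

/-! ### Moment maps -/

/-- Index set of the standard basis of `Vect(Q, v) = ⨁ V_i`. -/
abbrev VectIdx {I : Type u} (v : I → ℕ) : Type u := Σ i, Fin (v i)

/-- A homomorphism `V_j → V_i`, considered as an endomorphism of `Vect(Q, v)`. -/
def toEnd [DecidableEq I] {i j : I} (M : Matrix (Fin (v i)) (Fin (v j)) ℂ) :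
    Matrix (VectIdx v) (VectIdx v) ℂ := fun p q =>
  if h : p.1 = i ∧ q.1 = j then
    M (Fin.cast (congrArg v h.1) p.2) (Fin.cast (congrArg v h.2) q.2) else 0

/-- The commutator of endomorphisms of `Vect(Q, v)`. -/
def comm [Fintype I] (M N : Matrix (VectIdx v) (VectIdx v) ℂ) :
    Matrix (VectIdx v) (VectIdx v) ℂ := M * N - N * M

/-- The moment map `μ(A) = (1 / 2i) ∑_a [A_a, A_a^*]` for the action of `K_v = ∏ U(V_i)`.
On the doubled quiver this is the moment map `μ_I(A, B)`. -/
def momentMap [Fintype I] [DecidableEq I] [Fintype E] (A : Rep Q v) :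
    Matrix (VectIdx v) (VectIdx v) ℂ :=
  (1 / (2 * Complex.I)) • ∑ a, comm (toEnd (A a)) (toEnd (A a))ᴴ

/-- The central element `(i α_j · id_{V_j})_j` determined by a stability parameter. -/
def centralElement [DecidableEq I] (v : I → ℕ) (α : I → ℤ) :
    Matrix (VectIdx v) (VectIdx v) ℂ :=
  Matrix.diagonal fun p => Complex.I * (α p.1 : ℂ)

/-- The complex moment map `μ_ℂ(A, B) = ∑_a [A_a, B_ā]` on `Rep(Q̃, v) = T^* Rep(Q, v)`. -/
def complexMomentMap [Fintype I] [DecidableEq I] [Fintype E] (x : Rep Q.double v) :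
    Matrix (VectIdx v) (VectIdx v) ℂ :=
  ∑ a : E, comm (toEnd (i := Q.head a) (j := Q.tail a) (x (Sum.inl a)))
    (toEnd (i := Q.tail a) (j := Q.head a) (x (Sum.inr a)))

/-- The metric `g(X, Y) = ∑_a Re Tr(X_a Y_a^*)`. -/
def metric [Fintype E] (X Y : Rep Q v) : ℝ := ∑ a, ((X a * (Y a)ᴴ).trace).re

/-- The function `‖μ - α‖²`. -/
def energy [Fintype I] [DecidableEq I] [Fintype E] (α : I → ℤ) (A : Rep Q v) : ℝ :=
  ∑ p, ∑ q, ‖(momentMap A - centralElement v α) p q‖ ^ 2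

/-- `A` is a critical point of `‖μ - α‖²`: all directional derivatives vanish (the function
is a real polynomial on a finite-dimensional space). -/
def IsCritical [Fintype I] [DecidableEq I] [Fintype E] (α : I → ℤ) (A : Rep Q v) : Prop :=
  ∀ X : Rep Q v, HasDerivAt (fun t : ℝ => energy α (A + t • X)) 0 0

/-- The Hessian of `‖μ - α‖²` at `A`, as a bilinear form. -/
def hessian [Fintype I] [DecidableEq I] [Fintype E] (α : I → ℤ) (A X Y : Rep Q v) : ℝ :=
  deriv (fun s : ℝ => deriv (fun t : ℝ => energy α (A + s • X + t • Y)) 0) 0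

/-- The negative eigenspace `⨁_{l < 0} V_l` of the Hessian; here `V_l` consists of the `X`
with `H X = l X`, where `H` is the operator that represents the Hessian in the metric. -/
def negSpace [Fintype I] [DecidableEq I] [Fintype E] (α : I → ℤ) (A : Rep Q v) :
    Submodule ℝ (Rep Q v) :=
  ⨆ l : Set.Iio (0 : ℝ), Submodule.span ℝ
    {X : Rep Q v | ∀ Y, hessian α A X Y = (l : ℝ) * metric X Y}

/-! ### Sub-dimension-vectors -/

/-- The representation `(x₁, 0)` of dimension `v`, obtained from `x₁` of dimension `v₁ ≤ v`
through the inclusions `ℂ^{v₁ i} ⊆ ℂ^{v i}` of the first coordinates. -/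
def extend {v₁ v : I → ℕ} (x₁ : Rep Q v₁) : Rep Q v := fun a p q =>
  if h : (p : ℕ) < v₁ (Q.head a) ∧ (q : ℕ) < v₁ (Q.tail a) then
    x₁ a ⟨p, h.1⟩ ⟨q, h.2⟩ else 0

/-- The restriction of a representation of dimension `v` to `⨁ ℂ^{v₁ i} ⊆ ⨁ ℂ^{v i}` (where
this subspace is invariant; in general, the compression to it). -/
def restrict {v₁ v : I → ℕ} (h : v₁ ≤ v) (x : Rep Q v) : Rep Q v₁ := fun a =>
  (x a).submatrix (Fin.castLE (h (Q.head a))) (Fin.castLE (h (Q.tail a)))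

/-- The subspace `∑_{h(a) = k} im x_a` of `V_k`. -/
def imageAt (k : I) (x : Rep Q v) : Submodule ℂ (Fin (v k) → ℂ) :=
  ⨆ (a : E) (h : Q.head a = k),
    (LinearMap.range (x a).mulVecLin).map
      (LinearMap.funLeft ℂ ℂ (Fin.cast (congrArg v h.symm)))

end General

/-! ### Nakajima quiver varieties and approximate flow lines -/

section Nakajima

variable {I : Type u} {E : Type w} [Fintype I] [DecidableEq I] [Fintype E]

/-- The quiver variety `𝓜(Q, v) = μ_ℂ⁻¹(0)^{α-st} / G_v` for the canonical stability parameter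
`α = α(Q, v)`, as a subspace of the orbit space of `Rep(Q̃, v)`. -/
def quiverVariety (Q : Quiv I E) (o : I) (v : I → ℕ) : Set (Orbits Q.double v) :=
  {c | ∃ x : Rep Q.double v, toOrbit x = c ∧ complexMomentMap x = 0 ∧
    IsStable (canonicalParam o v) x}

/-- The subset `𝓜_{k;r}(Q, v)` of the classes `[x]` such that `∑_{h(a) = k} im x_a` has
codimension `r` in `V_k`; the edges `a` are those of the doubled quiver. -/
def quiverStratum (Q : Quiv I E) (o : I) (v : I → ℕ) (k : I) (r : ℕ) :
    Set (Orbits Q.double v) :=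
  {c | c ∈ quiverVariety Q o v ∧ ∃ x : Rep Q.double v, toOrbit x = c ∧
    Module.finrank ℂ ((Fin (v k) → ℂ) ⧸ imageAt k x) = r}

/-- The set `C_{v₁}^0` of critical points `(x₁, 0)` of `‖μ_I - α(Q, v)‖²` on `μ_ℂ⁻¹(0)` in
`Rep(Q̃, v)` whose stable summand containing the vertex `∞` is `x₁`, of dimension `v₁`. (The
stability parameter induced by `α(Q, v)` on dimension `v₁` is a positive multiple of
`α(Q, v₁)`.) -/
def criticalSet (Q : Quiv I E) (o : I) (v₁ v : I → ℕ) : Set (Rep Q.double v) :=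
  {x | complexMomentMap x = 0 ∧ IsCritical (canonicalParam o v) x ∧
    ∃ x₁ : Rep Q.double v₁, x = extend x₁ ∧ IsStable (canonicalParam o v₁) x₁}

/-- The slice `S_x`: the `δx` in `ker (ρ_x^ℂ)^* = (im ρ_x^ℂ)^⊥` with `x + δx ∈ μ_ℂ⁻¹(0)`. -/
def slice {Q : Quiv I E} {v : I → ℕ} (x : Rep Q.double v) : Set (Rep Q.double v) :=
  {δ | (∀ u : GaugeLie v, metric (infAct x u) δ = 0) ∧ complexMomentMap (x + δ) = 0}

/-- The negative slice `S_x^-`, for the stability parameter `α(Q, v)`. -/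
def negSlice {Q : Quiv I E} (o : I) {v : I → ℕ} (x : Rep Q.double v) : Set (Rep Q.double v) :=
  {δ | δ ∈ negSpace (canonicalParam o v) x} ∩ slice x

/-- The space `𝓒(Q, v₁, v₂, v)` of pairs of critical points in `C_{v₁}^0 × C_{v₂}^0` that are
connected by an approximate flow line, for `v₁ ≤ v₂ ≤ v`. -/
def approxFlowPairs (Q : Quiv I E) (o : I) (v₁ v₂ v : I → ℕ) :
    Set (Rep Q.double v × Rep Q.double v) :=
  {z | z.1 ∈ criticalSet Q o v₁ v ∧ z.2 ∈ criticalSet Q o v₂ v ∧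
    ∃ δ ∈ negSlice o z.1, toOrbit (z.1 + δ) = toOrbit z.2}

/-- The space `𝓜𝓕(Q, v₁, v₂) ⊆ 𝓜(Q, v₁) × 𝓜(Q, v₂)` of pairs of classes connected by an
approximate flow line. -/
def flowModuli (Q : Quiv I E) (o : I) (v₁ v₂ : I → ℕ) :
    Set (Orbits Q.double v₁ × Orbits Q.double v₂) :=
  {c | c.1 ∈ quiverVariety Q o v₁ ∧ c.2 ∈ quiverVariety Q o v₂ ∧
    ∃ (x₁ : Rep Q.double v₁) (x₂ : Rep Q.double v₂), toOrbit x₁ = c.1 ∧ toOrbit x₂ = c.2 ∧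
      (extend x₁, x₂) ∈ approxFlowPairs Q o v₁ v₂ v₂}

/-! ### Nakajima's projection -/

/-- The dimension vector `v - r e_k`. -/
def lower {I : Type u} [DecidableEq I] (v : I → ℕ) (k : I) (r : ℕ) : I → ℕ := v - Pi.single k r

theorem lower_le {I : Type u} [DecidableEq I] (v : I → ℕ) (k : I) (r : ℕ) : lower v k r ≤ v := tsub_le_self

/-- `∑_{h(a) = k} im x_a ⊆ V_k'`, where `V_k' ⊆ V_k` is the span of the first `v_k - r`
coordinate vectors. -/
def IsAdapted {Q : Quiv I E} {v : I → ℕ} (k : I) (r : ℕ) (x : Rep Q.double v) : Prop :=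
  ∀ y ∈ imageAt k x, ∀ j : Fin (v k), v k - r ≤ (j : ℕ) → y j = 0

open Classical in
/-- Nakajima's projection `p : 𝓜_{k;r}(Q, v) → 𝓜_{k;0}(Q, v - r e_k)`: choose a representative
`x` of the class with `∑_{h(a) = k} im x_a ⊆ V_k'` and restrict it to dimension `v - r e_k`.
(The value at a class without such a representative is of no importance.) -/
def nakajimaProj {Q : Quiv I E} {v : I → ℕ} (k : I) (r : ℕ) (c : Orbits Q.double v) :
    Orbits Q.double (lower v k r) :=
  if h : ∃ x : Rep Q.double v, toOrbit x = c ∧ IsAdapted k r x then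
    toOrbit (restrict (lower_le v k r) h.choose)
  else toOrbit 0

/-- The part of `𝓜𝓕(Q, v - r e_k, v)` that lies in `𝓜_{k;0}(Q, v - r e_k) × 𝓜_{k;r}(Q, v)`. -/
def restrictedFlow (Q : Quiv I E) (o : I) (v : I → ℕ) (k : I) (r : ℕ) :
    Set (Orbits Q.double (lower v k r) × Orbits Q.double v) :=
  (quiverStratum Q o (lower v k r) k 0 ×ˢ quiverStratum Q o v k r) ∩
    flowModuli Q o (lower v k r) v

end Nakajima

end NakajimaFlow

end

/-! Since `v o = 1`, scalars can be used to normalise every gauge transformation to be the identity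
at `o`. Stability for the canonical parameter then becomes a linear condition
(`isStable_iff_costable`): no nonzero subrepresentation vanishes at `o`. This condition passes to
subrepresentations. It also makes a homomorphism `y → x` that is the identity at `o` a polynomially
bounded function of `y` (`Costable.exists_reconstruction`). That function shows that lifted orbits
are closed, and that the Kempf–Ness function on an orbit is proper. A minimum therefore exists, and
it solves the real moment map equation up to any prescribed positive factor
(`Costable.exists_crossMoment_eq`).

A point is critical exactly when the Hermitian defect `-i(μ - α)` annihilates it infinitesimally. At
a critical point `(x₁, 0)` with `x₁` costable, Schur's lemma makes the defect a scalar `c ≥ 0` on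
`V₁`, and it is `-1` on the complement `V₂`. Orthogonally to the orbit the Hessian is `-2` times the
infinitesimal action of the defect. On `Hom(V₂, V₁)` it is thus `-2(1 + c)`, on `Hom(V₁, V₂)` it is
`2(1 + c)`, and on the other two blocks it is zero. So the negative slice consists of elements of
`Hom(V₂, V₁)`, and `(x₁, 0) + δx` has all its images in `V₁` and restricts to `x₁` there. This is
the recipe for Nakajima's projection, which gives uniqueness (`exists_isAdapted_of_mem_flowModuli`).

Conversely, let `x` be a representative with images in `V₁`. Its restriction is costable, so it can
be moved to a solution of the scaled moment map equation, and `(x₁, 0)` is then critical. A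
unipotent element of `1 + Hom(V₂, V₁)` makes the remaining part of `x` orthogonal to the orbit,
hence an element of the negative slice (`mem_flowModuli_of_isAdapted`).

The flow space over the stratum is therefore the graph of `p`, and the homeomorphism amounts to
continuity of `p`. Near a point, a continuous frame of `∑ im x_a` yields adapted representatives
that vary continuously, and orbit maps are open (`continuousOn_nakajimaProj`). -/

noncomputable section

namespace NakajimaFlow

universe u w

/-! ### Endomorphisms of `Vect(Q, v)` -/

section Total

variable {I : Type u} [Fintype I] [DecidableEq I] {v v' : I → ℕ}

/-- The inclusion `V_i → Vect(Q, v)`. -/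
def emb (v : I → ℕ) (i : I) : Matrix (VectIdx v) (Fin (v i)) ℂ :=
  (1 : Matrix (VectIdx v) (VectIdx v) ℂ).submatrix id fun p => ⟨i, p⟩

theorem emb_conjTranspose (v : I → ℕ) (i : I) :
    (emb v i)ᴴ = (1 : Matrix (VectIdx v) (VectIdx v) ℂ).submatrix (fun p => ⟨i, p⟩) id := by
  rw [emb, Matrix.conjTranspose_submatrix, Matrix.conjTranspose_one]

theorem mul_emb {l : Type*} (N : Matrix l (VectIdx v) ℂ) (i : I) :
    N * emb v i = N.submatrix id fun p => ⟨i, p⟩ := by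
  ext p q
  simp [emb, Matrix.mul_apply, Matrix.one_apply]

theorem emb_mul {l : Type*} (N : Matrix (VectIdx v) l ℂ) (i : I) :
    (emb v i)ᴴ * N = N.submatrix (fun p => ⟨i, p⟩) id := by
  ext p q
  simp [emb_conjTranspose, Matrix.mul_apply, Matrix.one_apply]

theorem emb_mul_emb_self (v : I → ℕ) (i : I) : (emb v i)ᴴ * emb v i = 1 := by
  ext p q
  simp [mul_emb, emb_conjTranspose, Matrix.one_apply]

theorem emb_mul_apply {l : Type*} (i : I) (M : Matrix (Fin (v i)) l ℂ) (j : I) (p : Fin (v j))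
    (q : l) : (emb v i * M) ⟨j, p⟩ q = if h : j = i then M (h ▸ p) q else 0 := by
  rw [Matrix.mul_apply]
  split_ifs with h
  · subst h
    simp [emb, Matrix.one_apply]
  · refine Finset.sum_eq_zero fun x _ => ?_
    simp [emb, h]

/-- This factorisation replaces the casts in `toEnd` by matrix products; every later identity in
`Vect(Q, v)` goes through it. -/
theorem toEnd_eq {i j : I} (M : Matrix (Fin (v i)) (Fin (v j)) ℂ) :
    toEnd M = emb v i * M * (emb v j)ᴴ := by
  ext ⟨i', p⟩ ⟨j', q⟩
  have h1 : (emb v i * M * (emb v j)ᴴ) = (emb v j * (emb v i * M)ᴴ)ᴴ := by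
    rw [Matrix.conjTranspose_mul, Matrix.conjTranspose_conjTranspose]
  rw [h1, Matrix.conjTranspose_apply, emb_mul_apply]
  by_cases hj : j' = j
  · subst hj
    rw [dif_pos rfl, Matrix.conjTranspose_apply, star_star, emb_mul_apply]
    by_cases hi : i' = i
    · subst hi
      simp [toEnd]
    · simp [toEnd, hi]
  · simp [toEnd, hj]

theorem blockDiagonal'_mul_emb (A : ∀ i, Matrix (Fin (v i)) (Fin (v' i)) ℂ) (i : I) :
    Matrix.blockDiagonal' A * emb v' i = emb v i * A i := by
  ext ⟨j, p⟩ q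
  rw [mul_emb, emb_mul_apply]
  by_cases h : j = i
  · subst h
    simp
  · simp [h, Matrix.blockDiagonal'_apply_ne]

theorem emb_mul_blockDiagonal' (A : ∀ i, Matrix (Fin (v i)) (Fin (v' i)) ℂ) (i : I) :
    (emb v i)ᴴ * Matrix.blockDiagonal' A = A i * (emb v' i)ᴴ := by
  have := congrArg Matrix.conjTranspose (blockDiagonal'_mul_emb (fun i => (A i)ᴴ) i)
  simpa [Matrix.conjTranspose_mul, Matrix.blockDiagonal'_conjTranspose] using this

theorem toEnd_mul_mul (A : ∀ i, Matrix (Fin (v i)) (Fin (v' i)) ℂ)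
    (B : ∀ i, Matrix (Fin (v' i)) (Fin (v i)) ℂ) {i j : I} (M : Matrix (Fin (v' i)) (Fin (v' j)) ℂ) :
    toEnd (A i * M * B j) = Matrix.blockDiagonal' A * toEnd M * Matrix.blockDiagonal' B := by
  rw [toEnd_eq, toEnd_eq]
  simp only [Matrix.mul_assoc, emb_mul_blockDiagonal']
  rw [← Matrix.mul_assoc _ (emb v' i), blockDiagonal'_mul_emb]
  simp only [Matrix.mul_assoc]

theorem toEnd_mul_left (A : ∀ i, Matrix (Fin (v i)) (Fin (v i)) ℂ) {i j : I}
    (M : Matrix (Fin (v i)) (Fin (v j)) ℂ) :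
    toEnd (A i * M) = Matrix.blockDiagonal' A * toEnd M := by
  have := toEnd_mul_mul A (fun _ => 1) M
  have h1 : Matrix.blockDiagonal' (fun i => (1 : Matrix (Fin (v i)) (Fin (v i)) ℂ)) = 1 :=
    Matrix.blockDiagonal'_one
  simpa [h1] using this

theorem toEnd_mul_right (B : ∀ i, Matrix (Fin (v i)) (Fin (v i)) ℂ) {i j : I}
    (M : Matrix (Fin (v i)) (Fin (v j)) ℂ) :
    toEnd (M * B j) = toEnd M * Matrix.blockDiagonal' B := by
  have := toEnd_mul_mul (fun _ => 1) B M
  have h1 : Matrix.blockDiagonal' (fun i => (1 : Matrix (Fin (v i)) (Fin (v i)) ℂ)) = 1 :=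
    Matrix.blockDiagonal'_one
  simpa [h1] using this

theorem toEnd_add {i j : I} (M N : Matrix (Fin (v i)) (Fin (v j)) ℂ) :
    toEnd (M + N) = toEnd M + toEnd N := by
  simp [toEnd_eq, Matrix.mul_add, Matrix.add_mul]

theorem toEnd_sub {i j : I} (M N : Matrix (Fin (v i)) (Fin (v j)) ℂ) :
    toEnd (M - N) = toEnd M - toEnd N := by
  simp [toEnd_eq, Matrix.mul_sub, Matrix.sub_mul]

theorem toEnd_smul {R : Type*} [SMul R ℂ] [IsScalarTower R ℂ ℂ] [SMulCommClass R ℂ ℂ] {i j : I}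
    (t : R) (M : Matrix (Fin (v i)) (Fin (v j)) ℂ) : toEnd (t • M) = t • toEnd M := by
  ext p q
  by_cases h : p.1 = i ∧ q.1 = j
  · simp [toEnd, h]
  · simp only [toEnd, dif_neg h, Matrix.smul_apply]
    rw [← smul_one_smul ℂ t (0 : ℂ), smul_zero]

theorem trace_toEnd_mul {i j : I} (M N : Matrix (Fin (v i)) (Fin (v j)) ℂ) :
    (toEnd M * (toEnd N)ᴴ).trace = (M * Nᴴ).trace := by
  rw [toEnd_eq, toEnd_eq, Matrix.conjTranspose_mul, Matrix.conjTranspose_mul,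
    Matrix.conjTranspose_conjTranspose]
  have : emb v i * M * (emb v j)ᴴ * (emb v j * (Nᴴ * (emb v i)ᴴ)) =
      emb v i * (M * ((emb v j)ᴴ * emb v j) * Nᴴ * (emb v i)ᴴ) := by
    simp only [Matrix.mul_assoc]
  rw [this, Matrix.trace_mul_comm, emb_mul_emb_self, Matrix.mul_one, Matrix.mul_assoc _ _ (emb v i),
    emb_mul_emb_self, Matrix.mul_one]

theorem blockDiagonal'_blockDiag' (N : Matrix (VectIdx v) (VectIdx v) ℂ)
    (h : ∀ p q, p.1 ≠ q.1 → N p q = 0) : Matrix.blockDiagonal' N.blockDiag' = N := by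
  funext p q
  obtain ⟨i, p⟩ := p
  obtain ⟨j, q⟩ := q
  by_cases hij : i = j
  · subst hij
    exact Matrix.blockDiagonal'_apply_eq _ _ _ _
  · rw [Matrix.blockDiagonal'_apply_ne _ _ _ hij, h _ _ hij]

theorem toEnd_mul_toEnd_apply_ne {i j : I} (M : Matrix (Fin (v i)) (Fin (v j)) ℂ)
    (N : Matrix (Fin (v j)) (Fin (v i)) ℂ) (p q : VectIdx v) (h : p.1 ≠ q.1) :
    (toEnd M * toEnd N) p q = 0 := by
  rw [Matrix.mul_apply]
  refine Finset.sum_eq_zero fun r _ => ?_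
  by_cases hp : p.1 = i
  · have hq : q.1 ≠ i := fun hq => h (hp.trans hq.symm)
    simp [toEnd, hq]
  · simp [toEnd, hp]

theorem toEnd_conjTranspose {i j : I} (M : Matrix (Fin (v i)) (Fin (v j)) ℂ) :
    (toEnd M)ᴴ = toEnd Mᴴ := by
  simp [toEnd_eq, Matrix.conjTranspose_mul, Matrix.mul_assoc]

theorem comm_toEnd_apply_ne {i j : I} (M : Matrix (Fin (v i)) (Fin (v j)) ℂ)
    (N : Matrix (Fin (v j)) (Fin (v i)) ℂ) (p q : VectIdx v) (h : p.1 ≠ q.1) :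
    comm (toEnd M) (toEnd N) p q = 0 := by
  rw [comm, Matrix.sub_apply, toEnd_mul_toEnd_apply_ne _ _ _ _ h,
    toEnd_mul_toEnd_apply_ne _ _ _ _ h, sub_zero]

end Total

/-! ### Functions of moderate growth on the representation space -/

theorem re_trace_mul_conjTranspose_self {m n : Type*} [Fintype m] [Fintype n] (X : Matrix m n ℂ) :
    ((X * Xᴴ).trace).re = ∑ p, ∑ q, ‖X p q‖ ^ 2 := by
  simp only [Matrix.trace, Matrix.diag, Matrix.mul_apply, Matrix.conjTranspose_apply,
    Complex.re_sum]
  refine Finset.sum_congr rfl fun p _ => Finset.sum_congr rfl fun q _ => ?_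
  rw [← Complex.normSq_eq_norm_sq, Complex.normSq_apply, Complex.star_def, Complex.mul_re,
    Complex.conj_re, Complex.conj_im]
  ring

section Tame

variable {I : Type u} {E : Type w} [Fintype E] {Q : Quiv I E} {v : I → ℕ}

theorem metric_self (y : Rep Q v) : metric y y = ∑ a, ∑ p, ∑ q, ‖y a p q‖ ^ 2 :=
  Finset.sum_congr rfl fun a _ => re_trace_mul_conjTranspose_self (y a)

theorem metric_self_nonneg (y : Rep Q v) : 0 ≤ metric y y := by
  rw [metric_self]; positivity

theorem sq_norm_apply_le_metric_self (y : Rep Q v) (a : E) (p : Fin (v (Q.head a)))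
    (q : Fin (v (Q.tail a))) : ‖y a p q‖ ^ 2 ≤ metric y y := by
  rw [metric_self]
  refine le_trans ?_ (Finset.single_le_sum
    (f := fun a => ∑ p, ∑ q, ‖y a p q‖ ^ 2) (fun _ _ => by positivity) (Finset.mem_univ a))
  refine le_trans ?_ (Finset.single_le_sum
    (f := fun p => ∑ q, ‖y a p q‖ ^ 2) (fun _ _ => by positivity) (Finset.mem_univ p))
  exact Finset.single_le_sum
    (f := fun q => ‖y a p q‖ ^ 2) (fun _ _ => by positivity) (Finset.mem_univ q)

theorem metric_self_eq_zero {y : Rep Q v} (h : metric y y = 0) : y = 0 := by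
  funext a
  ext p q
  have := sq_norm_apply_le_metric_self y a p q
  rw [h] at this
  simpa using (pow_eq_zero_iff two_ne_zero).1 (le_antisymm this (by positivity))

theorem continuous_metric_self : Continuous fun y : Rep Q v => metric y y := by
  simp only [metric_self]
  fun_prop

/-- Continuous functions on `Rep(Q, v)` of at most polynomial growth. -/
def Tame (f : Rep Q v → ℂ) : Prop :=
  Continuous f ∧ ∃ (C : ℝ) (N : ℕ), 0 ≤ C ∧ ∀ y, ‖f y‖ ≤ C * (1 + metric y y) ^ N

theorem Tame.const (c : ℂ) : Tame fun _ : Rep Q v => c :=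
  ⟨continuous_const, ‖c‖, 0, norm_nonneg c, fun y => by simp⟩

theorem Tame.add {f g : Rep Q v → ℂ} (hf : Tame f) (hg : Tame g) : Tame fun y => f y + g y := by
  obtain ⟨hfc, C, N, hC, hf⟩ := hf
  obtain ⟨hgc, D, M, hD, hg⟩ := hg
  refine ⟨hfc.add hgc, C + D, N + M, add_nonneg hC hD, fun y => ?_⟩
  have h1 : 1 ≤ 1 + metric y y := by linarith [metric_self_nonneg y]
  calc ‖f y + g y‖ ≤ ‖f y‖ + ‖g y‖ := norm_add_le _ _
    _ ≤ C * (1 + metric y y) ^ N + D * (1 + metric y y) ^ M := add_le_add (hf y) (hg y)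
    _ ≤ C * (1 + metric y y) ^ (N + M) + D * (1 + metric y y) ^ (N + M) := by
      gcongr <;> first | exact h1 | omega
    _ = _ := by ring

theorem Tame.mul {f g : Rep Q v → ℂ} (hf : Tame f) (hg : Tame g) : Tame fun y => f y * g y := by
  obtain ⟨hfc, C, N, hC, hf⟩ := hf
  obtain ⟨hgc, D, M, hD, hg⟩ := hg
  refine ⟨hfc.mul hgc, C * D, N + M, mul_nonneg hC hD, fun y => ?_⟩
  calc ‖f y * g y‖ = ‖f y‖ * ‖g y‖ := norm_mul _ _
    _ ≤ (C * (1 + metric y y) ^ N) * (D * (1 + metric y y) ^ M) :=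
      mul_le_mul (hf y) (hg y) (norm_nonneg _) ((norm_nonneg _).trans (hf y))
    _ = _ := by ring

theorem Tame.sum {ι : Type*} (s : Finset ι) {f : ι → Rep Q v → ℂ} (hf : ∀ i, Tame (f i)) :
    Tame fun y => ∑ i ∈ s, f i y := by
  classical
  induction s using Finset.induction_on with
  | empty => simpa using Tame.const 0
  | insert i s hi ih => simpa [Finset.sum_insert hi] using (hf i).add ih

theorem Tame.prod {ι : Type*} (s : Finset ι) {f : ι → Rep Q v → ℂ} (hf : ∀ i, Tame (f i)) :
    Tame fun y => ∏ i ∈ s, f i y := by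
  classical
  induction s using Finset.induction_on with
  | empty => simpa using Tame.const 1
  | insert i s hi ih => simpa [Finset.prod_insert hi] using (hf i).mul ih

theorem Tame.apply (a : E) (p : Fin (v (Q.head a))) (q : Fin (v (Q.tail a))) :
    Tame fun y : Rep Q v => y a p q := by
  refine ⟨by fun_prop, 1, 1, zero_le_one, fun y => ?_⟩
  have := sq_norm_apply_le_metric_self y a p q
  nlinarith [sq_nonneg (‖y a p q‖ - 1)]

theorem Tame.det {n : ℕ} {M : Rep Q v → Matrix (Fin n) (Fin n) ℂ}
    (hM : ∀ p q, Tame fun y => M y p q) : Tame fun y => (M y).det := by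
  simp only [Matrix.det_apply']
  exact Tame.sum _ fun σ => (Tame.const _).mul (Tame.prod _ fun p => hM _ _)

end Tame

/-! ### Stability in terms of subrepresentations -/

section Costable

variable {I : Type u} {E : Type w} {Q : Quiv I E} {v : I → ℕ}

/-- A representation is costable if it has no nonzero subrepresentation that vanishes at `o`. -/
def Costable (o : I) (x : Rep Q v) : Prop :=
  ∀ W : ∀ i, Submodule ℂ (Fin (v i) → ℂ),
    (∀ a, ∀ w ∈ W (Q.tail a), x a *ᵥ w ∈ W (Q.head a)) → W o = ⊥ → ∀ i, W i = ⊥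

/-- `h` is a homomorphism of representations from `y` to `x`. -/
def Intertwines (h : GaugeLie v) (y x : Rep Q v) : Prop :=
  ∀ a, h (Q.head a) * y a = x a * h (Q.tail a)

/-- The image of a homomorphism into `x` is a subrepresentation of `x`, and here it vanishes at `o`.
-/
theorem Intertwines.eq_zero {o : I} {x : Rep Q v} (hx : Costable o x) {h : GaugeLie v}
    {y : Rep Q v} (hh : Intertwines h y x) (ho : h o = 0) : h = 0 := by
  have key := hx (fun i => LinearMap.range (h i).mulVecLin) ?_ ?_
  · funext i
    have := key i
    rw [LinearMap.range_eq_bot] at this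
    exact (LinearEquiv.map_eq_zero_iff Matrix.toLin').1 this
  · rintro a _ ⟨w, rfl⟩
    refine ⟨y a *ᵥ w, ?_⟩
    simp only [Matrix.mulVecLin_apply, Matrix.mulVec_mulVec, hh a]
  · simp [ho]

/-- The inverse `g⁻¹` is a homomorphism from `g · x` to `x`. -/
theorem intertwines_inv_act (g : Gauge v) (x : Rep Q v) :
    Intertwines (fun i => ((g⁻¹ i : GL (Fin (v i)) ℂ) : Matrix (Fin (v i)) (Fin (v i)) ℂ))
      (act g x) x := by
  intro a
  simp only [act, Pi.inv_apply]
  rw [← Matrix.mul_assoc, ← Matrix.mul_assoc, ← Units.val_mul, inv_mul_cancel]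
  simp

theorem act_eq_of_intertwines (g : Gauge v) {x y : Rep Q v}
    (h : Intertwines (fun i => ((g⁻¹ i : GL (Fin (v i)) ℂ) : Matrix (Fin (v i)) (Fin (v i)) ℂ))
      y x) : act g x = y := by
  funext a
  have := h a
  simp only [Pi.inv_apply] at this
  simp only [act]
  rw [Matrix.mul_assoc, ← this, ← Matrix.mul_assoc, ← Units.val_mul, mul_inv_cancel]
  simp

theorem Costable.gauge {o : I} {x : Rep Q v} (hx : Costable o x) (g : Gauge v) :
    Costable o (act g x) := by
  intro W hW ho i
  have key := hx (fun i => (W i).comap (g i : Matrix (Fin (v i)) (Fin (v i)) ℂ).mulVecLin)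
    (fun a w hw => ?_) ?_ i
  · rw [eq_bot_iff]
    intro w hw
    have h2 : (((g i)⁻¹ : GL (Fin (v i)) ℂ) : Matrix (Fin (v i)) (Fin (v i)) ℂ) *ᵥ w ∈
        (W i).comap (g i : Matrix (Fin (v i)) (Fin (v i)) ℂ).mulVecLin := by
      simpa [Matrix.mulVec_mulVec, ← Units.val_mul] using hw
    rw [key, Submodule.mem_bot] at h2
    have h3 := congrArg (fun z => (g i : Matrix (Fin (v i)) (Fin (v i)) ℂ) *ᵥ z) h2
    simpa [Matrix.mulVec_mulVec, ← Units.val_mul] using h3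
  · have h2 := hW a _ hw
    simp only [act, Matrix.mulVecLin_apply, Matrix.mulVec_mulVec, Matrix.mul_assoc,
      ← Units.val_mul, inv_mul_cancel] at h2
    simpa [Matrix.mulVec_mulVec] using h2
  · simp only [ho]
    rw [eq_bot_iff]
    intro w hw
    have h3 := congrArg (fun z => (((g o)⁻¹ : GL (Fin (v o)) ℂ) : Matrix (Fin (v o)) (Fin (v o)) ℂ)
      *ᵥ z) ((Submodule.mem_bot ℂ).1 hw)
    simpa [Matrix.mulVec_mulVec, ← Units.val_mul] using h3

variable [Fintype E]

/-- A homomorphism `h : y → x` to a costable representation that is the identity at `o` is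
determined by `y`, and is a function of `y` of moderate growth. -/
theorem Costable.exists_reconstruction {o : I} {x : Rep Q v} (hx : Costable o x) :
    ∃ F : Rep Q v → GaugeLie v, (∀ i p q, Tame fun y => F y i p q) ∧
      ∀ h y, h o = 1 → Intertwines h y x → h = F y := by
  let P : ∀ i, (Fin (v i) → ℂ) → (Rep Q v → Fin (v i) → ℂ) → Prop := fun i φ F =>
    (∀ q, Tame fun y => F y q) ∧ ∀ (h : GaugeLie v) y, h o = 1 → Intertwines h y x →
      φ ᵥ* h i = F y
  let U : ∀ i, Submodule ℂ (Fin (v i) → ℂ) := fun i =>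
    { carrier := {φ | ∃ F, P i φ F}
      add_mem' := by
        rintro φ ψ ⟨F, hF, hF'⟩ ⟨G, hG, hG'⟩
        exact ⟨fun y => F y + G y, fun q => (hF q).add (hG q), fun h y ho hh => by
          rw [Matrix.add_vecMul, hF' h y ho hh, hG' h y ho hh]⟩
      zero_mem' := ⟨fun _ => 0, fun q => Tame.const 0, fun h y _ _ => Matrix.zero_vecMul _⟩
      smul_mem' := by
        rintro c φ ⟨F, hF, hF'⟩
        exact ⟨fun y => c • F y, fun q => (Tame.const c).mul (hF q), fun h y ho hh => by
          rw [Matrix.smul_vecMul, hF' h y ho hh]⟩ }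
  -- Intertwining moves an arrow across `h`: `φ x_a h = φ h y_a`, which is `F y` times `y_a`.
  have hUa : ∀ a, ∀ φ ∈ U (Q.head a), φ ᵥ* x a ∈ U (Q.tail a) := by
    rintro a φ ⟨F, hF, hF'⟩
    refine ⟨fun y => F y ᵥ* y a, fun q => ?_, fun h y ho hh => ?_⟩
    · simp only [Matrix.vecMul, dotProduct]
      exact Tame.sum _ fun p => (hF p).mul (Tame.apply a p q)
    · rw [Matrix.vecMul_vecMul, ← hh a, ← Matrix.vecMul_vecMul, hF' h y ho hh]
  have hUo : ∀ φ, φ ∈ U o := fun φ =>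
    ⟨fun _ => φ, fun q => Tame.const _, fun h y ho _ => by rw [ho, Matrix.vecMul_one]⟩
  -- By `hUa` and `hUo`, the common kernels of the functionals in `U` form a subrepresentation
  -- vanishing at `o`. Costability makes it zero, so `U` contains every functional, in particular
  -- the coordinates.
  have hW := hx (fun i => ((U i).map (dotProductEquiv ℂ (Fin (v i))).toLinearMap).dualCoannihilator)
    ?_ ?_
  · have htop : ∀ i φ, φ ∈ U i := by
      intro i φ
      have h1 := congrArg Submodule.dualAnnihilator (hW i)
      rw [Subspace.dualCoannihilator_dualAnnihilator_eq, Submodule.dualAnnihilator_bot] at h1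
      have h2 : dotProductEquiv ℂ (Fin (v i)) φ ∈
          (U i).map (dotProductEquiv ℂ (Fin (v i))).toLinearMap := h1 ▸ Submodule.mem_top
      obtain ⟨ψ, hψ, h3⟩ := h2
      rwa [← (dotProductEquiv ℂ (Fin (v i))).injective h3]
    choose F hF using fun i (p : Fin (v i)) => htop i (Pi.single p 1)
    refine ⟨fun y i p q => F i p y q, fun i p q => (hF i p).1 q, fun h y ho hh => ?_⟩
    funext i p q
    have := congrFun ((hF i p).2 h y ho hh) q
    simpa using this
  · intro a w hw
    rw [Submodule.mem_dualCoannihilator] at hw ⊢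
    rintro _ ⟨φ, hφ, rfl⟩
    have := hw _ ⟨_, hUa a φ hφ, rfl⟩
    simpa [dotProductEquiv, Matrix.dotProduct_mulVec] using this
  · rw [eq_bot_iff]
    intro w hw
    rw [Submodule.mem_dualCoannihilator] at hw
    have : ∀ p, w p = 0 := fun p => by
      simpa [dotProductEquiv] using hw _ ⟨Pi.single p 1, hUo _, rfl⟩
    exact funext this

end Costable

/-! ### Equivalence of stability and costability when `v o = 1` -/

section StableIff

variable {I : Type u} {E : Type w} {Q : Quiv I E} {v : I → ℕ}

theorem eq_det_smul_one {n : ℕ} (hn : n = 1) (M : Matrix (Fin n) (Fin n) ℂ) : M = M.det • 1 := by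
  subst hn
  ext p q
  obtain rfl := Subsingleton.elim p 0
  obtain rfl := Subsingleton.elim q 0
  simp

theorem exists_projection {n : ℕ} (W : Submodule ℂ (Fin n → ℂ)) :
    ∃ P : Matrix (Fin n) (Fin n) ℂ, (∀ w, P *ᵥ w ∈ W) ∧ (∀ w ∈ W, P *ᵥ w = w) := by
  obtain ⟨W', h⟩ := W.exists_isCompl
  refine ⟨LinearMap.toMatrix' (W.subtype ∘ₗ W.projectionOnto W' h), fun w => ?_,
    fun w hw => ?_⟩
  · rw [LinearMap.toMatrix'_mulVec]
    exact (W.projectionOnto W' h w).2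
  · rw [LinearMap.toMatrix'_mulVec]
    have := Submodule.projectionOnto_apply_left h ⟨w, hw⟩
    simp only [LinearMap.comp_apply, this, Submodule.subtype_apply]

/-- The scalar `c` as an element of `G_v`. -/
def scalarGauge (v : I → ℕ) (c : ℂˣ) : Gauge v := fun i =>
  Units.map (algebraMap ℂ (Matrix (Fin (v i)) (Fin (v i)) ℂ)).toMonoidHom c

theorem coe_scalarGauge (c : ℂˣ) (i : I) :
    (scalarGauge v c i : Matrix (Fin (v i)) (Fin (v i)) ℂ) = (c : ℂ) • 1 := by
  simp [scalarGauge, Algebra.algebraMap_eq_smul_one]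

theorem coe_scalarGauge_inv (c : ℂˣ) (i : I) :
    (((scalarGauge v c i)⁻¹ : GL (Fin (v i)) ℂ) : Matrix (Fin (v i)) (Fin (v i)) ℂ) =
      (c : ℂ)⁻¹ • 1 := by
  have : (scalarGauge v c i)⁻¹ = scalarGauge v c⁻¹ i := by simp [scalarGauge]
  rw [this, coe_scalarGauge, Units.val_inv_eq_inv_val]

theorem act_scalarGauge (c : ℂˣ) (x : Rep Q v) : act (scalarGauge v c) x = x := by
  funext a
  rw [act, coe_scalarGauge, coe_scalarGauge_inv]
  simp [smul_smul]

variable [Fintype I]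

theorem character_mul (α : I → ℤ) (g h : Gauge v) :
    character α (g * h) = character α g * character α h := by
  simp only [character, Pi.mul_apply, Units.val_mul, Matrix.det_mul, mul_zpow,
    Finset.prod_mul_distrib]

theorem character_scalarGauge (α : I → ℤ) (hα : ∑ i, α i * (v i : ℤ) = 0) (c : ℂˣ) :
    character α (scalarGauge v c) = 1 := by
  have : ∀ i, (scalarGauge v c i : Matrix (Fin (v i)) (Fin (v i)) ℂ).det ^ α i =
      (c : ℂ) ^ (α i * (v i : ℤ)) := by
    intro i
    rw [coe_scalarGauge, Matrix.det_smul, Matrix.det_one, mul_one, Fintype.card_fin,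
      mul_comm (α i), zpow_mul, zpow_natCast]
  have h2 : ∀ s : Finset I, ∏ i ∈ s, (c : ℂ) ^ (α i * (v i : ℤ)) =
      (c : ℂ) ^ ∑ i ∈ s, α i * (v i : ℤ) := by
    classical
    intro s
    induction s using Finset.induction_on with
    | empty => simp
    | insert i s hi ih => rw [Finset.prod_insert hi, Finset.sum_insert hi, ih, zpow_add₀ c.ne_zero]
  rw [character, Finset.prod_congr rfl fun i _ => this i, h2, hα, zpow_zero]

variable [DecidableEq I]

/-- This is the reason why the character is trivial on scalars, so that normalising at `o` does not
change the lifted orbit. -/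
theorem sum_canonicalParam_mul {o : I} (hv : v o = 1) :
    ∑ i, canonicalParam o v i * (v i : ℤ) = 0 := by
  rw [← Finset.add_sum_erase _ _ (Finset.mem_univ o)]
  have : ∀ i ∈ Finset.univ.erase o, canonicalParam o v i * (v i : ℤ) = v i := by
    intro i hi
    simp [canonicalParam, Finset.ne_of_mem_erase hi]
  rw [Finset.sum_congr rfl this]
  simp [canonicalParam, hv]

theorem character_canonicalParam {o : I} {g : Gauge v} (hg : g o = 1) :
    character (canonicalParam o v) g =
      ∏ i, (g i : Matrix (Fin (v i)) (Fin (v i)) ℂ).det := by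
  refine Finset.prod_congr rfl fun i _ => ?_
  by_cases hi : i = o
  · subst hi; simp [hg]
  · simp [canonicalParam, hi]

/-- Multiplying by a scalar, we may assume that an element of `G_v` is the identity at `o`. -/
theorem exists_normalize {o : I} (hv : v o = 1) (g : Gauge v) :
    ∃ (c : ℂˣ) (g' : Gauge v), g = scalarGauge v c * g' ∧ g' o = 1 := by
  have hdet : (g o : Matrix (Fin (v o)) (Fin (v o)) ℂ).det ≠ 0 :=
    ((Matrix.isUnit_iff_isUnit_det _).1 (g o).isUnit).ne_zero
  refine ⟨Units.mk0 _ hdet, (scalarGauge v (Units.mk0 _ hdet))⁻¹ * g, by simp, ?_⟩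
  have : g o = scalarGauge v (Units.mk0 _ hdet) o := by
    ext1
    rw [coe_scalarGauge]
    exact eq_det_smul_one hv _
  rw [Pi.mul_apply, Pi.inv_apply, ← this, inv_mul_cancel]

theorem act_character_normalize {o : I} (hv : v o = 1) (g : Gauge v) (x : Rep Q v) :
    ∃ g' : Gauge v, g' o = 1 ∧ act g' x = act g x ∧
      character (canonicalParam o v) g' = character (canonicalParam o v) g := by
  obtain ⟨c, g', rfl, h⟩ := exists_normalize hv g
  refine ⟨g', h, ?_, ?_⟩
  · rw [act_mul, act_scalarGauge]
  · rw [character_mul, character_scalarGauge _ (sum_canonicalParam_mul hv), one_mul]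

/-- Hilbert–Mumford: given a subrepresentation `W` with `W o = 0`, let `t` act on `W` and `1` on a
complement. As `t → 0` the representation converges, while the character `t ^ dim W` tends to `0` if
`W` is nonzero. -/
theorem IsSemistable.costable {o : I} {x : Rep Q v}
    (hx : IsSemistable (canonicalParam o v) x) : Costable o x := by
  intro W hW ho
  choose P hPW hP using fun i => exists_projection (W i)
  by_contra! hne
  obtain ⟨i₀, hi₀⟩ := hne
  have hPP : ∀ i, P i * P i = P i := fun i => by
    refine Matrix.toLin'.injective (LinearMap.ext fun w => ?_)
    simpa [Matrix.mulVec_mulVec] using hP i _ (hPW i w)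
  have hPo : P o = 0 := by
    refine Matrix.toLin'.injective (LinearMap.ext fun w => ?_)
    have := hPW o w
    rw [ho, Submodule.mem_bot] at this
    simpa using this
  have hinv : ∀ a, P (Q.head a) * x a * P (Q.tail a) = x a * P (Q.tail a) := fun a => by
    refine Matrix.toLin'.injective (LinearMap.ext fun w => ?_)
    simpa [Matrix.mulVec_mulVec, Matrix.mul_assoc] using hP _ _ (hW a _ (hPW _ w))
  have hmul : ∀ i (s t : ℂ), (1 - P i + s • P i) * (1 - P i + t • P i) = 1 - P i + (s * t) • P i := by
    intro i s t
    simp only [Matrix.mul_add, Matrix.add_mul, Matrix.mul_sub, Matrix.sub_mul, Matrix.one_mul,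
      Matrix.mul_one, Matrix.mul_smul, Matrix.smul_mul, hPP, smul_smul, smul_add, smul_sub,
      mul_comm t s]
    abel
  let G : ℂ → GaugeLie v := fun t i => 1 - P i + t • P i
  -- The curve is written as a polynomial in `t`, so that it makes sense and is continuous at `t =
  -- 0`. The block that would carry `t⁻¹` is absent because `W` is invariant.
  let gam : ℂ → Rep Q v × ℂ := fun t =>
    (fun a => (1 - P (Q.head a)) * x a * (1 - P (Q.tail a)) +
      t • (P (Q.head a) * x a * (1 - P (Q.tail a))) + P (Q.head a) * x a * P (Q.tail a),
      ∏ i, (G t i).det)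
  have hcont : Continuous gam := by
    refine Continuous.prodMk (continuous_pi fun a => ?_) ?_
    · fun_prop
    · refine continuous_finsetProd _ fun i _ => Continuous.matrix_det ?_
      fun_prop
  have hmaps : Set.MapsTo gam {0}ᶜ (liftedOrbit (canonicalParam o v) x 1) := by
    intro t ht
    have ht' : t ≠ 0 := ht
    let g : Gauge v := fun i => ⟨1 - P i + t • P i, 1 - P i + t⁻¹ • P i,
      by rw [hmul, mul_inv_cancel₀ ht']; simp, by rw [hmul, inv_mul_cancel₀ ht']; simp⟩
    refine ⟨g, Prod.ext ?_ ?_⟩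
    · funext a
      change (1 - P (Q.head a) + t • P (Q.head a)) * x a *
        (1 - P (Q.tail a) + t⁻¹ • P (Q.tail a)) =
        (1 - P (Q.head a)) * x a * (1 - P (Q.tail a)) +
          t • (P (Q.head a) * x a * (1 - P (Q.tail a))) + P (Q.head a) * x a * P (Q.tail a)
      have h1 : (1 - P (Q.head a)) * (x a * P (Q.tail a)) = 0 := by
        rw [Matrix.sub_mul, Matrix.one_mul, ← Matrix.mul_assoc, hinv, sub_self]
      simp only [Matrix.mul_add, Matrix.add_mul, Matrix.mul_smul, Matrix.smul_mul, smul_smul,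
        smul_add, Matrix.mul_assoc, h1, smul_zero, one_smul,
        inv_mul_cancel₀ ht']
      abel
    · change character (canonicalParam o v) g * 1 = ∏ i, (G t i).det
      rw [mul_one, character_canonicalParam]
      ext1
      change 1 - P o + t • P o = 1
      simp [hPo]
  have h0 : gam 0 ∈ closure (liftedOrbit (canonicalParam o v) x 1) :=
    map_mem_closure hcont (by rw [closure_compl_singleton]; trivial) hmaps
  have h1 : (gam 0).2 = 0 := by
    refine Finset.prod_eq_zero (Finset.mem_univ i₀) ?_
    obtain ⟨w, hw, hw0⟩ := Submodule.exists_mem_ne_zero_of_ne_bot hi₀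
    refine Matrix.exists_mulVec_eq_zero_iff.1 ⟨w, hw0, ?_⟩
    simp [G, Matrix.sub_mulVec, hP _ _ hw]
  have h2 : gam 0 ∈ closure (liftedOrbit (canonicalParam o v) x 1) ∩ {p | p.2 = 0} := ⟨h0, h1⟩
  rw [hx 1 one_ne_zero] at h2
  exact h2

variable [Fintype E]

/-- After normalisation at `o`, a point `y = g · x` determines `g⁻¹ = F y`. The lifted orbit is
therefore cut out by equations continuous in `y`, hence closed, and it misses the zero section. -/
theorem Costable.isStable {o : I} (hv : v o = 1) {x : Rep Q v} (hx : Costable o x) :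
    IsStable (canonicalParam o v) x := by
  obtain ⟨F, hF, hFx⟩ := hx.exists_reconstruction
  have hFc : ∀ i, Continuous fun y => F y i := fun i =>
    continuous_pi fun p => continuous_pi fun q => (hF i p q).1
  have horbit : ∀ ξ : ℂ, ξ ≠ 0 → liftedOrbit (canonicalParam o v) x ξ =
      {z | z.2 * ∏ i, (F z.1 i).det = ξ ∧ F z.1 o = 1 ∧
        ∀ a, F z.1 (Q.head a) * z.1 a = x a * F z.1 (Q.tail a)} := by
    intro ξ hξ
    ext ⟨y, η⟩
    constructor
    · rintro ⟨g, hg⟩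
      obtain ⟨g', ho, hact, hchar⟩ := act_character_normalize hv g x
      simp only [Prod.mk.injEq] at hg
      obtain ⟨rfl, rfl⟩ := hg
      rw [← hact, ← hchar]
      have hF1 := hFx _ _ (by simp [ho]) (intertwines_inv_act g' x)
      simp only [Set.mem_ofPred_eq, ← hF1]
      refine ⟨?_, by simp [ho], intertwines_inv_act g' x⟩
      rw [character_canonicalParam ho, mul_right_comm, ← Finset.prod_mul_distrib]
      rw [Finset.prod_eq_one, one_mul]
      intro i _
      rw [← Matrix.det_mul, ← Units.val_mul, Pi.inv_apply, mul_inv_cancel]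
      simp
    · rintro ⟨h1, h2, h3⟩
      simp only at h1 h2 h3
      have hdet : ∀ i, (F y i).det ≠ 0 := by
        intro i hi
        rw [Finset.prod_eq_zero (Finset.mem_univ i) hi, mul_zero] at h1
        exact hξ h1.symm
      let g : Gauge v := fun i => (Matrix.GeneralLinearGroup.mkOfDetNeZero _ (hdet i))⁻¹
      have hgi : ∀ i, (((g i)⁻¹ : GL (Fin (v i)) ℂ) : Matrix (Fin (v i)) (Fin (v i)) ℂ) = F y i :=
        fun i => by simp only [g, inv_inv]; rfl
      have hgo : g o = 1 := by
        rw [← inv_eq_one]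
        ext1
        rw [hgi, h2]
        rfl
      refine ⟨g, Prod.ext (act_eq_of_intertwines g fun a => ?_) ?_⟩
      · change (((g (Q.head a))⁻¹ : GL (Fin (v (Q.head a))) ℂ) : Matrix _ _ ℂ) * y a =
          x a * (((g (Q.tail a))⁻¹ : GL (Fin (v (Q.tail a))) ℂ) : Matrix _ _ ℂ)
        rw [hgi, hgi]
        exact h3 a
      · change character (canonicalParam o v) g * ξ = η
        rw [character_canonicalParam hgo, ← h1, mul_left_comm, ← Finset.prod_mul_distrib,
          Finset.prod_eq_one, mul_one]
        intro i _
        rw [← hgi i, ← Matrix.det_mul, ← Units.val_mul, mul_inv_cancel]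
        simp
  have hclosed : ∀ ξ : ℂ, ξ ≠ 0 → IsClosed (liftedOrbit (canonicalParam o v) x ξ) := by
    intro ξ hξ
    rw [horbit ξ hξ]
    have hFc' : ∀ i, Continuous fun z : Rep Q v × ℂ => F z.1 i := fun i =>
      (hFc i).comp continuous_fst
    have h1 : IsClosed {z : Rep Q v × ℂ | z.2 * ∏ i, (F z.1 i).det = ξ} := isClosed_eq
      (continuous_snd.mul (continuous_finsetProd _ fun i _ => (hFc' i).matrix_det)) continuous_const
    have h2 : IsClosed {z : Rep Q v × ℂ | F z.1 o = 1} := isClosed_eq (hFc' o) continuous_const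
    have h3 : IsClosed {z : Rep Q v × ℂ |
        ∀ a, F z.1 (Q.head a) * z.1 a = x a * F z.1 (Q.tail a)} := by
      have h := isClosed_iInter fun a : E => isClosed_eq
        ((hFc' (Q.head a)).matrix_mul ((continuous_apply a).comp continuous_fst))
        ((continuous_const (y := x a)).matrix_mul (hFc' (Q.tail a)))
      convert! h using 1
      ext z
      simp only [Set.mem_iInter]
      rfl
    exact h1.inter (h2.inter h3)
  refine ⟨⟨fun ξ hξ => ?_, hclosed⟩, fun g hg => ?_⟩
  · rw [(hclosed ξ hξ).closure_eq, horbit ξ hξ, Set.eq_empty_iff_forall_notMem]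
    rintro ⟨y, η⟩ ⟨⟨h1, -⟩, h2⟩
    simp only [Set.mem_ofPred_eq] at h1 h2
    exact hξ (by rw [← h1, h2, zero_mul])
  · obtain ⟨c, g', rfl, ho⟩ := exists_normalize hv g
    rw [act_mul, act_scalarGauge] at hg
    -- Both the inverse of `g'` and `1` are endomorphisms of `x` that are the identity at `o`, so
    -- both equal `F x`.
    have h1 := hFx _ _ (by simp [ho]) (hg ▸ intertwines_inv_act g' x)
    have h2 := hFx 1 x rfl fun a => by simp
    have h3 : g' = 1 := by
      rw [← inv_eq_one]
      funext i
      ext1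
      exact congrFun (h1.trans h2.symm) i
    refine ⟨c, fun i => ?_⟩
    rw [h3, mul_one, coe_scalarGauge]

theorem isStable_iff_costable {o : I} (hv : v o = 1) {x : Rep Q v} :
    IsStable (canonicalParam o v) x ↔ Costable o x :=
  ⟨fun h => h.1.1.costable, fun h => h.isStable hv⟩

end StableIff

/-! ### The Hermitian moment map -/

theorem eq_zero_of_re_trace_mul_conjTranspose_self {m n : Type*} [Fintype m] [Fintype n]
    {X : Matrix m n ℂ} (h : ((X * Xᴴ).trace).re = 0) : X = 0 := by
  rw [re_trace_mul_conjTranspose_self, Finset.sum_eq_zero_iff_of_nonneg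
    fun _ _ => by positivity] at h
  ext p q
  have h1 := h p (Finset.mem_univ p)
  rw [Finset.sum_eq_zero_iff_of_nonneg fun _ _ => by positivity] at h1
  simpa using h1 q (Finset.mem_univ q)

section MomentMap

variable {I : Type u} {E : Type w} [Fintype E] {Q : Quiv I E} {v : I → ℕ}

theorem metric_comm (X Y : Rep Q v) : metric X Y = metric Y X := by
  refine Finset.sum_congr rfl fun a _ => ?_
  rw [← Complex.conj_re, ← Complex.star_def, ← Matrix.trace_conjTranspose,
    Matrix.conjTranspose_mul, Matrix.conjTranspose_conjTranspose]

theorem metric_add_left (X Y Z : Rep Q v) : metric (X + Y) Z = metric X Z + metric Y Z := by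
  simp [metric, Matrix.add_mul, Finset.sum_add_distrib]

theorem metric_smul_left (t : ℝ) (X Y : Rep Q v) : metric (t • X) Y = t * metric X Y := by
  simp [metric, Finset.mul_sum]

theorem metric_zero_left (Y : Rep Q v) : metric (0 : Rep Q v) Y = 0 := by
  simp [metric]

theorem metric_eq_sum_inner (X Y : Rep Q v) :
    metric X Y = ∑ a, ∑ p, ∑ q, inner ℝ (X a p q) (Y a p q) := by
  simp only [metric, Matrix.trace, Matrix.diag, Matrix.mul_apply, Matrix.conjTranspose_apply,
    Complex.re_sum]
  refine Finset.sum_congr rfl fun a _ => Finset.sum_congr rfl fun p _ =>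
    Finset.sum_congr rfl fun q _ => ?_
  rw [Complex.inner, Complex.star_def, Complex.mul_re, Complex.mul_re, Complex.conj_re,
    Complex.conj_im, Complex.conj_re, Complex.conj_im]
  ring

variable [Fintype I] [DecidableEq I]

/-- The sum `∑_a [A_a, B_a^*]`. -/
def crossMoment (A B : Rep Q v) : Matrix (VectIdx v) (VectIdx v) ℂ :=
  ∑ a, comm (toEnd (A a)) (toEnd (B a))ᴴ

theorem momentMap_eq (A : Rep Q v) : momentMap A = (1 / (2 * Complex.I)) • crossMoment A A := rfl

theorem crossMoment_apply_ne (A B : Rep Q v) (p q : VectIdx v) (h : p.1 ≠ q.1) :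
    crossMoment A B p q = 0 := by
  rw [crossMoment, Matrix.sum_apply]
  refine Finset.sum_eq_zero fun a _ => ?_
  rw [toEnd_conjTranspose, comm_toEnd_apply_ne _ _ _ _ h]

theorem crossMoment_conjTranspose (A B : Rep Q v) : (crossMoment A B)ᴴ = crossMoment B A := by
  simp [crossMoment, comm, Matrix.conjTranspose_sum, Matrix.conjTranspose_sub,
    Matrix.conjTranspose_mul]

theorem trace_crossMoment (A B : Rep Q v) : (crossMoment A B).trace = 0 := by
  rw [crossMoment, Matrix.trace_sum]
  refine Finset.sum_eq_zero fun a _ => ?_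
  rw [comm, Matrix.trace_sub, Matrix.trace_mul_comm, sub_self]

theorem crossMoment_add_left (A A' B : Rep Q v) :
    crossMoment (A + A') B = crossMoment A B + crossMoment A' B := by
  simp only [crossMoment, ← Finset.sum_add_distrib]
  refine Finset.sum_congr rfl fun a _ => ?_
  simp only [comm, Pi.add_apply, toEnd_add, Matrix.add_mul, Matrix.mul_add]
  abel

theorem crossMoment_smul_left (t : ℝ) (A B : Rep Q v) :
    crossMoment (t • A) B = t • crossMoment A B := by
  simp only [crossMoment, Finset.smul_sum]
  refine Finset.sum_congr rfl fun a _ => ?_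
  simp only [comm, Pi.smul_apply, toEnd_smul, smul_sub, Matrix.smul_mul, Matrix.mul_smul]

theorem crossMoment_add_right (A B B' : Rep Q v) :
    crossMoment A (B + B') = crossMoment A B + crossMoment A B' := by
  rw [← crossMoment_conjTranspose, crossMoment_add_left, Matrix.conjTranspose_add,
    crossMoment_conjTranspose, crossMoment_conjTranspose]

theorem crossMoment_smul_right (t : ℝ) (A B : Rep Q v) :
    crossMoment A (t • B) = t • crossMoment A B := by
  rw [← crossMoment_conjTranspose, crossMoment_smul_left, Matrix.conjTranspose_smul,
    crossMoment_conjTranspose, star_trivial]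

theorem toEnd_infAct (A : Rep Q v) (u : GaugeLie v) (a : E) :
    toEnd (infAct A u a) = comm (Matrix.blockDiagonal' u) (toEnd (A a)) := by
  rw [infAct, toEnd_sub, toEnd_mul_left, toEnd_mul_right]
  rfl

/-- Cyclicity of the trace. Thus `crossMoment` computes the adjoint of the infinitesimal action,
which links orbit directions with moment maps. -/
theorem metric_infAct_left (A B : Rep Q v) (u : GaugeLie v) :
    metric (infAct A u) B = ((Matrix.blockDiagonal' u * crossMoment A B).trace).re := by
  rw [metric, crossMoment, Finset.mul_sum, Matrix.trace_sum, Complex.re_sum]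
  refine Finset.sum_congr rfl fun a _ => ?_
  rw [← trace_toEnd_mul, toEnd_infAct, comm, comm, Matrix.sub_mul, Matrix.mul_sub,
    Matrix.trace_sub, Matrix.trace_sub, Matrix.mul_assoc, Matrix.mul_assoc,
    Matrix.trace_mul_comm (toEnd (A a)), Matrix.mul_assoc]

theorem blockDiag'_mul_trace (u : GaugeLie v) (N : Matrix (VectIdx v) (VectIdx v) ℂ) :
    (Matrix.blockDiagonal' u * N).trace = ∑ i, (u i * N.blockDiag' i).trace := by
  simp only [Matrix.trace, Fintype.sum_sigma, Matrix.diag, Matrix.mul_apply]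
  refine Finset.sum_congr rfl fun i _ => Finset.sum_congr rfl fun p _ => ?_
  rw [Finset.sum_eq_single i]
  · exact Finset.sum_congr rfl fun q _ => by rw [Matrix.blockDiagonal'_apply_eq]; rfl
  · intro j _ hj
    exact Finset.sum_eq_zero fun q _ => by rw [Matrix.blockDiagonal'_apply_ne _ _ _ hj.symm, zero_mul]
  · simp

end MomentMap

/-! ### The Kempf–Ness theorem for costable representations -/

section KempfNess

/-- Only continuity of `f` is needed, so derivatives of inverses and determinants at `0` can be read
off from a first-order remainder formula. -/
theorem hasDerivAt_ofReal_mul {f : ℝ → ℂ} (hf : ContinuousAt f 0) :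
    HasDerivAt (fun t : ℝ => (t : ℂ) * f t) (f 0) 0 := by
  rw [hasDerivAt_iff_tendsto_slope_zero]
  refine (hf.tendsto.mono_left nhdsWithin_le_nhds).congr' ?_
  filter_upwards [self_mem_nhdsWithin] with t ht
  have : (t : ℂ) ≠ 0 := by exact_mod_cast ht
  simp [this]

theorem continuousAt_matrix_inv {X : Type*} [TopologicalSpace X] {n : ℕ}
    {M : X → Matrix (Fin n) (Fin n) ℂ} {x : X} (hM : ContinuousAt M x) (hx : (M x).det ≠ 0) :
    ContinuousAt (fun y => (M y)⁻¹) x := by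
  simp only [Matrix.inv_def, Ring.inverse_eq_inv']
  have h1 : ContinuousAt (fun y => (M y).det) x :=
    (continuous_id.matrix_det (n := Fin n)).continuousAt.comp hM
  have h2 : ContinuousAt (fun y => (M y).adjugate) x :=
    (continuous_id.matrix_adjugate (n := Fin n)).continuousAt.comp hM
  exact (h1.inv₀ hx).smul h2

theorem hasDerivAt_mul_apply {l m n : Type*} [Fintype m] {A : ℝ → Matrix l m ℂ}
    {B : ℝ → Matrix m n ℂ} {A' : Matrix l m ℂ} {B' : Matrix m n ℂ} {t : ℝ}
    (hA : ∀ p q, HasDerivAt (fun s => A s p q) (A' p q) t)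
    (hB : ∀ p q, HasDerivAt (fun s => B s p q) (B' p q) t) (p : l) (q : n) :
    HasDerivAt (fun s => (A s * B s) p q) ((A' * B t + A t * B') p q) t := by
  simp only [Matrix.mul_apply, Matrix.add_apply, ← Finset.sum_add_distrib]
  exact HasDerivAt.fun_sum fun r _ => (hA p r).mul (hB r q)

theorem eventually_det_ne_zero {n : ℕ} (u : Matrix (Fin n) (Fin n) ℂ) :
    ∀ᶠ t : ℝ in nhds 0, (1 + (t : ℂ) • u).det ≠ 0 := by
  have hc : Continuous fun t : ℝ => (1 + (t : ℂ) • u).det :=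
    Continuous.matrix_det (by fun_prop)
  exact hc.continuousAt.eventually_ne (by simp)

theorem hasDerivAt_one_add_smul (n : ℕ) (u : Matrix (Fin n) (Fin n) ℂ) (p q : Fin n) :
    HasDerivAt (fun t : ℝ => (1 + (t : ℂ) • u) p q) (u p q) 0 := by
  have := (hasDerivAt_ofReal_mul (f := fun _ => u p q) continuousAt_const).const_add
    ((1 : Matrix (Fin n) (Fin n) ℂ) p q)
  simpa using this

theorem hasDerivAt_one_add_smul_inv {n : ℕ} (u : Matrix (Fin n) (Fin n) ℂ) (p q : Fin n) :
    HasDerivAt (fun t : ℝ => ((1 + (t : ℂ) • u)⁻¹) p q) ((-u) p q) 0 := by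
  have hcont : ContinuousAt (fun t : ℝ => (1 + (t : ℂ) • u)⁻¹) 0 :=
    continuousAt_matrix_inv (by fun_prop) (by simp)
  have hcont2 : ContinuousAt (fun t : ℝ => (-(u * (1 + (t : ℂ) • u)⁻¹)) p q) 0 := by
    have h1 : Continuous fun N : Matrix (Fin n) (Fin n) ℂ => (-(u * N)) p q := by fun_prop
    exact h1.continuousAt.comp hcont
  -- The remainder formula is `(1 + tu)⁻¹ = 1 - t u (1 + tu)⁻¹`, valid for small `t`.
  have := (hasDerivAt_ofReal_mul hcont2).const_add ((1 : Matrix (Fin n) (Fin n) ℂ) p q)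
  have hval : (-(u * (1 + ((0 : ℝ) : ℂ) • u)⁻¹)) p q = (-u) p q := by simp
  rw [hval] at this
  refine this.congr_of_eventuallyEq ?_
  filter_upwards [eventually_det_ne_zero u] with t ht
  have h1 : (1 + (t : ℂ) • u) * (1 + (t : ℂ) • u)⁻¹ = 1 :=
    Matrix.mul_nonsing_inv _ (isUnit_iff_ne_zero.2 ht)
  rw [Matrix.add_mul, Matrix.one_mul] at h1
  have h1' := eq_sub_of_add_eq h1
  have h2 := congrFun (congrFun h1' p) q
  refine h2.trans ?_
  simp only [Matrix.sub_apply, Matrix.smul_mul, Matrix.smul_apply, Matrix.neg_apply, smul_eq_mul]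
  ring

theorem hasDerivAt_log_det {n : ℕ} (u : Matrix (Fin n) (Fin n) ℂ) :
    HasDerivAt (fun t : ℝ => Real.log (‖(1 + (t : ℂ) • u).det‖ ^ 2)) (2 * u.trace.re) 0 := by
  have h1 : HasDerivAt (fun t : ℝ => (1 + (t : ℂ) • u).det) u.trace 0 := by
    let f : ℝ → ℂ := fun t => u.trace + Polynomial.eval (t : ℂ)
      (1 + (Polynomial.X : Polynomial ℂ) • u.map Polynomial.C).det.divX.divX * (t : ℂ)
    have hf : ContinuousAt f 0 := by
      refine Continuous.continuousAt ?_
      refine continuous_const.add (Continuous.mul ?_ Complex.continuous_ofReal)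
      exact (Polynomial.continuous _).comp Complex.continuous_ofReal
    have := (hasDerivAt_ofReal_mul hf).const_add (1 : ℂ)
    convert! this using 1
    · funext t
      rw [Matrix.det_one_add_smul]
      simp only [f]
      ring
    · simp [f]
  have h2 := h1.norm_sq.log (by simp)
  convert! h2 using 1
  simp [Complex.inner]

end KempfNess

/-! ### Properness of the Kempf–Ness function and its critical points -/

section KempfNess

variable {I : Type u} {E : Type w} [Fintype E] {Q : Quiv I E} {v : I → ℕ}

theorem isCompact_entries_le (R : ℝ) : IsCompact {y : Rep Q v | ∀ a p q, ‖y a p q‖ ≤ R} := by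
  have h : IsCompact (Set.univ.pi fun a : E => Set.univ.pi fun p : Fin (v (Q.head a)) =>
      Set.univ.pi fun q : Fin (v (Q.tail a)) => Metric.closedBall (0 : ℂ) R) :=
    isCompact_univ_pi fun a => isCompact_univ_pi fun p => isCompact_univ_pi fun q =>
      isCompact_closedBall _ _
  convert! h using 1
  ext y
  exact ⟨fun hy a _ p _ q _ => by simpa using hy a p q,
    fun hy a p q => by simpa using hy a trivial p trivial q trivial⟩

theorem hasDerivAt_metric_self {y : ℝ → Rep Q v} {y' : Rep Q v} {t : ℝ}
    (hy : ∀ a p q, HasDerivAt (fun s => y s a p q) (y' a p q) t) :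
    HasDerivAt (fun s => metric (y s) (y s)) (2 * metric (y t) y') t := by
  simp only [metric_self, metric_eq_sum_inner, Finset.mul_sum]
  exact HasDerivAt.fun_sum fun a _ => HasDerivAt.fun_sum fun p _ => HasDerivAt.fun_sum fun q _ =>
    (hy a p q).norm_sq

/-- A coercivity estimate: `n - σ log (C (1 + n)^N)` is bounded below and proper. -/
theorem exists_bound_of_sub_log_le {σ C c : ℝ} (hσ : 0 ≤ σ) (hC : 0 < C) (N : ℕ) :
    ∃ R, ∀ n : ℝ, 0 ≤ n → n - σ * Real.log (C * (1 + n) ^ N) ≤ c → n ≤ R := by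
  -- Applying `log s ≤ s - 1` to `s = (1 + n) / K` bounds the logarithmic term by `(1 + n) / 2` plus
  -- a constant, so half of `n` survives.
  let K : ℝ := 2 * (σ * N) + 1
  have hK : 0 < K := by positivity
  refine ⟨2 * (c + σ * Real.log C + σ * N * Real.log K + 1 / 2), fun n hn h => ?_⟩
  have h1 : 0 < 1 + n := by linarith
  rw [Real.log_mul hC.ne' (by positivity), Real.log_pow] at h
  have h2 := Real.log_le_sub_one_of_pos (div_pos h1 hK)
  rw [Real.log_div h1.ne' hK.ne'] at h2
  have h3 : σ * N * Real.log (1 + n) ≤ σ * N * ((1 + n) / K + Real.log K) :=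
    mul_le_mul_of_nonneg_left (by linarith) (by positivity)
  have h4 : σ * N * ((1 + n) / K) ≤ (1 + n) / 2 := by
    rw [mul_div_assoc', div_le_div_iff₀ hK two_pos]
    nlinarith
  nlinarith

variable [Fintype I] [DecidableEq I]

/-- The Kempf–Ness function attains its minimum on the orbit of a costable representation. -/
theorem Costable.exists_minimizer {o : I} {x : Rep Q v} (hx : Costable o x) {σ : ℝ}
    (hσ : 0 < σ) : ∃ g₀ : Gauge v, g₀ o = 1 ∧ ∀ g : Gauge v, g o = 1 →
      metric (act g₀ x) (act g₀ x) +
        σ * Real.log (‖∏ i, (g₀ i : Matrix (Fin (v i)) (Fin (v i)) ℂ).det‖ ^ 2) ≤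
      metric (act g x) (act g x) +
        σ * Real.log (‖∏ i, (g i : Matrix (Fin (v i)) (Fin (v i)) ℂ).det‖ ^ 2) := by
  obtain ⟨F, hF, hFx⟩ := hx.exists_reconstruction
  have hFc : ∀ i, Continuous fun y => F y i := fun i =>
    continuous_pi fun p => continuous_pi fun q => (hF i p q).1
  let D : Rep Q v → ℂ := fun y => ∏ i, (F y i).det
  have hD : Tame D := Tame.prod _ fun i => Tame.det (hF i)
  obtain ⟨hDc, C, N, hC, hDb⟩ := hD
  -- On the normalised orbit `D` is the inverse of the determinant of `g`; this expresses the
  -- Kempf–Ness function through the point `y = g · x` alone.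
  let φ : Rep Q v → ℝ := fun y => metric y y - σ * Real.log (‖D y‖ ^ 2)
  have hgauge : ∀ g : Gauge v, g o = 1 → (fun i => ((g⁻¹ i : GL (Fin (v i)) ℂ) :
      Matrix (Fin (v i)) (Fin (v i)) ℂ)) = F (act g x) := fun g hg =>
    hFx _ _ (by simp [hg]) (intertwines_inv_act g x)
  have hDg : ∀ g : Gauge v, g o = 1 →
      D (act g x) * ∏ i, (g i : Matrix (Fin (v i)) (Fin (v i)) ℂ).det = 1 := by
    intro g hg
    simp only [D, ← hgauge g hg]
    rw [← Finset.prod_mul_distrib]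
    refine Finset.prod_eq_one fun i _ => ?_
    rw [← Matrix.det_mul, ← Units.val_mul, Pi.inv_apply, inv_mul_cancel]
    simp
  have hφ : ∀ g : Gauge v, g o = 1 → φ (act g x) = metric (act g x) (act g x) +
      σ * Real.log (‖∏ i, (g i : Matrix (Fin (v i)) (Fin (v i)) ℂ).det‖ ^ 2) := by
    intro g hg
    simp only [φ]
    rw [eq_inv_of_mul_eq_one_left (hDg g hg), norm_inv, inv_pow, Real.log_inv]
    ring
  let c := φ x
  -- The constant `C` may vanish; `C + 1` is positive, as the logarithm requires.
  obtain ⟨R, hR⟩ := exists_bound_of_sub_log_le (c := c) hσ.le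
    (show 0 < (C + 1) ^ 2 by positivity) (2 * N)
  -- The relevant sublevel points lie in this compact set. The last condition follows from `φ ≤ c`
  -- because the metric is nonnegative. It keeps `D` away from zero, so that limit points remain in
  -- the orbit and `φ` is continuous on `K`.
  let K : Set (Rep Q v) := {y | metric y y ≤ R ∧ F y o = 1 ∧
    (∀ a, F y (Q.head a) * y a = x a * F y (Q.tail a)) ∧ Real.exp (-c / σ) ≤ ‖D y‖ ^ 2}
  have hle : ∀ y, ‖D y‖ ^ 2 ≤ (C + 1) ^ 2 * (1 + metric y y) ^ (2 * N) := by
    intro y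
    have h1 : 0 ≤ metric y y := metric_self_nonneg y
    have h2 : ‖D y‖ ≤ (C + 1) * (1 + metric y y) ^ N :=
      (hDb y).trans (mul_le_mul_of_nonneg_right (by linarith) (by positivity))
    calc ‖D y‖ ^ 2 ≤ ((C + 1) * (1 + metric y y) ^ N) ^ 2 := by gcongr
      _ = _ := by ring
  have hmem : ∀ g : Gauge v, g o = 1 → φ (act g x) ≤ c → act g x ∈ K := by
    intro g hg hc
    have hD0 : 0 < ‖D (act g x)‖ ^ 2 := by
      have := left_ne_zero_of_mul_eq_one (hDg g hg)
      positivity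
    refine ⟨hR _ (metric_self_nonneg _) (le_trans ?_ hc), ?_, ?_, ?_⟩
    · simp only [φ]
      have := Real.log_le_log hD0 (hle (act g x))
      nlinarith
    · rw [← hgauge g hg]; simp [hg]
    · rw [← hgauge g hg]; exact intertwines_inv_act g x
    · rw [← Real.le_log_iff_exp_le hD0, div_le_iff₀ hσ]
      simp only [φ] at hc
      linarith [metric_self_nonneg (act g x)]
  have hclosed : IsClosed K := by
    have h1 : IsClosed {y : Rep Q v | metric y y ≤ R} :=
      isClosed_le continuous_metric_self continuous_const
    have h2 : IsClosed {y : Rep Q v | F y o = 1} := isClosed_eq (hFc o) continuous_const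
    have h3 : IsClosed {y : Rep Q v | ∀ a, F y (Q.head a) * y a = x a * F y (Q.tail a)} := by
      have h := isClosed_iInter fun a : E => isClosed_eq
        ((hFc (Q.head a)).matrix_mul (continuous_apply a))
        ((continuous_const (y := x a)).matrix_mul (hFc (Q.tail a)))
      convert! h using 1
      ext z
      simp only [Set.mem_iInter]
      rfl
    have h4 : IsClosed {y : Rep Q v | Real.exp (-c / σ) ≤ ‖D y‖ ^ 2} :=
      isClosed_le continuous_const (hDc.norm.pow 2)
    exact h1.inter (h2.inter (h3.inter h4))
  have hcompact : IsCompact K := by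
    refine (isCompact_entries_le (1 + R)).of_isClosed_subset hclosed fun y hy a p q => ?_
    have h1 := (sq_norm_apply_le_metric_self y a p q).trans hy.1
    nlinarith [sq_nonneg (‖y a p q‖ - 1)]
  have hx1 : x ∈ K := by
    have := hmem 1 rfl
    rw [act_one] at this
    exact this le_rfl
  have hφc : ContinuousOn φ K := by
    refine continuous_metric_self.continuousOn.sub (continuousOn_const.mul
      (ContinuousOn.log (hDc.norm.pow 2).continuousOn fun y hy => ?_))
    exact ((Real.exp_pos _).trans_le hy.2.2.2).ne'
  obtain ⟨y, hyK, hy⟩ := hcompact.exists_isMinOn ⟨x, hx1⟩ hφc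
  have hdet : ∀ i, (F y i).det ≠ 0 := by
    intro i hi
    have h1 : D y = 0 := Finset.prod_eq_zero (Finset.mem_univ i) hi
    have h2 := hyK.2.2.2
    rw [h1] at h2
    simp only [norm_zero, ne_eq, OfNat.ofNat_ne_zero, not_false_eq_true, zero_pow] at h2
    exact absurd h2 (not_le.2 (Real.exp_pos _))
  let g₀ : Gauge v := fun i => (Matrix.GeneralLinearGroup.mkOfDetNeZero _ (hdet i))⁻¹
  have hgi : ∀ i, (((g₀ i)⁻¹ : GL (Fin (v i)) ℂ) : Matrix (Fin (v i)) (Fin (v i)) ℂ) = F y i :=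
    fun i => by simp only [g₀, inv_inv]; rfl
  have hgo : g₀ o = 1 := by
    rw [← inv_eq_one]
    ext1
    rw [hgi, hyK.2.1]
    rfl
  have hact : act g₀ x = y := act_eq_of_intertwines g₀ fun a => by
    change (((g₀ (Q.head a))⁻¹ : GL (Fin (v (Q.head a))) ℂ) : Matrix _ _ ℂ) * y a =
      x a * (((g₀ (Q.tail a))⁻¹ : GL (Fin (v (Q.tail a))) ℂ) : Matrix _ _ ℂ)
    rw [hgi, hgi]
    exact hyK.2.2.1 a
  refine ⟨g₀, hgo, fun g hg => ?_⟩
  rw [← hφ g₀ hgo, ← hφ g hg, hact]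
  by_cases hc : φ (act g x) ≤ c
  · exact hy (hmem g hg hc)
  · exact (hy hx1).trans (not_le.1 hc).le

/-- First-order condition at a Kempf–Ness minimum, for variations `1 + tu` that keep the
normalisation at `o`. The logarithm of the determinant contributes `σ Re Tr u`. -/
theorem Costable.exists_crossMoment_orthogonal {o : I} {x : Rep Q v} (hx : Costable o x) {σ : ℝ}
    (hσ : 0 < σ) : ∃ g₀ : Gauge v, ∀ u : GaugeLie v, u o = 0 →
      ((Matrix.blockDiagonal' u * (crossMoment (act g₀ x) (act g₀ x) + (σ : ℂ) • 1)).trace).re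
        = 0 := by
  obtain ⟨g₀, hgo, hmin⟩ := hx.exists_minimizer hσ
  refine ⟨g₀, fun u hu => ?_⟩
  set y := act g₀ x with hy
  -- With the total matrix inverse this curve is defined for all `t`; for small `t` it lies in the
  -- orbit.
  let Y : ℝ → Rep Q v := fun t a => (1 + (t : ℂ) • u (Q.head a)) * y a *
    (1 + (t : ℂ) • u (Q.tail a))⁻¹
  have hY0 : Y 0 = y := by funext a; simp [Y]
  have hY : ∀ a p q, HasDerivAt (fun t => Y t a p q) (infAct y u a p q) 0 := by
    intro a p q
    have h1 := hasDerivAt_mul_apply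
      (hasDerivAt_mul_apply (hasDerivAt_one_add_smul _ (u (Q.head a)))
        (fun p q => hasDerivAt_const (0 : ℝ) (y a p q)))
      (hasDerivAt_one_add_smul_inv (u (Q.tail a))) p q
    convert! h1 using 1
    have : (fun p q => (0 : ℂ)) = (0 : Matrix (Fin (v (Q.head a))) (Fin (v (Q.tail a))) ℂ) := rfl
    simp [infAct, this, sub_eq_add_neg]
  have hder := (hasDerivAt_metric_self hY).add ((HasDerivAt.fun_sum fun i (_ : i ∈ Finset.univ) =>
    hasDerivAt_log_det (u i)).const_mul σ)
  have hloc : IsLocalMin (fun t : ℝ => metric (Y t) (Y t) +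
      σ * ∑ i, Real.log (‖(1 + (t : ℂ) • u i).det‖ ^ 2)) 0 := by
    have hev : ∀ᶠ t : ℝ in nhds 0, ∀ i, (1 + (t : ℂ) • u i).det ≠ 0 :=
      Filter.eventually_all.2 fun i => eventually_det_ne_zero (u i)
    filter_upwards [hev] with t ht
    let k : Gauge v := fun i => Matrix.GeneralLinearGroup.mkOfDetNeZero _ (ht i)
    have hk : ∀ i, (k i : Matrix (Fin (v i)) (Fin (v i)) ℂ) = 1 + (t : ℂ) • u i := fun i => rfl
    have hko : k o = 1 := by
      ext1
      rw [hk, hu]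
      simp
    have hYt : Y t = act (k * g₀) x := by
      rw [act_mul, ← hy]
      funext a
      simp only [Y, act, hk, Matrix.coe_units_inv]
    have h1 := hmin (k * g₀) (by simp [hko, hgo])
    have hlog : ∀ g : Gauge v, Real.log (‖∏ i, (g i : Matrix (Fin (v i)) (Fin (v i)) ℂ).det‖ ^ 2) =
        ∑ i, Real.log (‖(g i : Matrix (Fin (v i)) (Fin (v i)) ℂ).det‖ ^ 2) := by
      intro g
      rw [norm_prod, ← Finset.prod_pow, Real.log_prod]
      intro i _
      have := ((Matrix.isUnit_iff_isUnit_det _).1 (g i).isUnit).ne_zero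
      positivity
    have hdetk : ∀ i, (k i : Matrix (Fin (v i)) (Fin (v i)) ℂ).det ≠ 0 := ht
    have h2 : ∑ i, Real.log (‖((k * g₀) i : Matrix (Fin (v i)) (Fin (v i)) ℂ).det‖ ^ 2) =
        ∑ i, Real.log (‖(1 + (t : ℂ) • u i).det‖ ^ 2) +
        ∑ i, Real.log (‖(g₀ i : Matrix (Fin (v i)) (Fin (v i)) ℂ).det‖ ^ 2) := by
      rw [← Finset.sum_add_distrib]
      refine Finset.sum_congr rfl fun i _ => ?_
      have h3 := ((Matrix.isUnit_iff_isUnit_det _).1 (g₀ i).isUnit).ne_zero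
      rw [Pi.mul_apply, Units.val_mul, Matrix.det_mul, norm_mul, mul_pow, Real.log_mul, hk]
      · have := hdetk i; positivity
      · positivity
    rw [hlog, hlog, h2, ← hYt] at h1
    simp only [hY0, Complex.ofReal_zero, zero_smul, add_zero, Matrix.det_one, norm_one, one_pow,
      Real.log_one, Finset.sum_const_zero, mul_zero]
    linarith
  have h0 := hloc.hasDerivAt_eq_zero hder
  rw [hY0, metric_comm, metric_infAct_left, ← Finset.mul_sum] at h0
  rw [Matrix.mul_add, Matrix.trace_add, Matrix.mul_smul, Matrix.mul_one, Matrix.trace_smul,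
    Matrix.trace_blockDiagonal', smul_eq_mul, Complex.add_re, Complex.re_ofReal_mul,
    Complex.re_sum]
  linarith

/-- The Kempf–Ness minimum with `σ = 2τ` satisfies `μ = τ · iα(Q, v)`. The variations fix all blocks
away from `o`; the block at `o` is a number, determined by the vanishing of the total trace. -/
theorem Costable.exists_crossMoment_eq {o : I} (hv : v o = 1) {x : Rep Q v} (hx : Costable o x)
    {τ : ℝ} (hτ : 0 < τ) : ∃ g : Gauge v, crossMoment (act g x) (act g x) =
      Matrix.diagonal fun p => -(2 * τ * (canonicalParam o v p.1 : ℂ)) := by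
  obtain ⟨g, hg⟩ := hx.exists_crossMoment_orthogonal (σ := 2 * τ) (by positivity)
  refine ⟨g, ?_⟩
  set H := crossMoment (act g x) (act g x) with hH
  have hne : ∀ p q, p.1 ≠ q.1 → H p q = 0 := crossMoment_apply_ne _ _
  have hblock : ∀ i, i ≠ o → H.blockDiag' i = -((2 * τ : ℝ) : ℂ) • 1 := by
    intro i hi
    set Z := (H + ((2 * τ : ℝ) : ℂ) • 1).blockDiag' i with hZ
    -- Testing with `Zᴴ` in the single block `i` gives `Re Tr(Zᴴ Z) = 0`, hence `Z = 0`.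
    have h1 := hg (Function.update 0 i Zᴴ) (by simp [Function.update_of_ne hi.symm])
    rw [blockDiag'_mul_trace, Finset.sum_eq_single i, Function.update_self, ← hZ] at h1
    · have h2 := eq_zero_of_re_trace_mul_conjTranspose_self (X := Zᴴ)
        (by rwa [Matrix.conjTranspose_conjTranspose])
      rw [Matrix.conjTranspose_eq_zero, hZ] at h2
      rw [neg_smul]
      refine eq_neg_of_add_eq_zero_left ?_
      rw [← h2]
      ext p q
      simp [Matrix.blockDiag'_apply, Matrix.one_apply]
    · intro j _ hj
      rw [Function.update_of_ne hj]
      simp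
    · simp
  have hentry : ∀ i, i ≠ o → ∀ p q, H ⟨i, p⟩ ⟨i, q⟩ = if p = q then -(2 * τ : ℂ) else 0 := by
    intro i hi p q
    have := congrFun (congrFun (hblock i hi) p) q
    rw [Matrix.blockDiag'_apply] at this
    rw [this]
    simp [Matrix.one_apply]
  have htr : H.trace = 0 := trace_crossMoment _ _
  have ho : ∀ p : Fin (v o), H ⟨o, p⟩ ⟨o, p⟩ = 2 * τ * ∑ i ∈ Finset.univ.erase o, (v i : ℂ) := by
    intro p
    have : Subsingleton (Fin (v o)) := by rw [hv]; infer_instance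
    rw [Matrix.trace, Fintype.sum_sigma, ← Finset.add_sum_erase _ _ (Finset.mem_univ o),
      Fintype.sum_subsingleton _ p] at htr
    have h1 : ∀ i ∈ Finset.univ.erase o, ∑ q, Matrix.diag H ⟨i, q⟩ = -(2 * τ * v i) := by
      intro i hi
      simp [Matrix.diag, hentry i (Finset.ne_of_mem_erase hi)]
      ring
    rw [Finset.sum_congr rfl h1, Finset.sum_neg_distrib, ← Finset.mul_sum] at htr
    exact eq_of_sub_eq_zero (by rw [sub_eq_add_neg]; exact htr)
  funext p q
  obtain ⟨i, p⟩ := p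
  obtain ⟨j, q⟩ := q
  by_cases hij : i = j
  · subst hij
    by_cases hi : i = o
    · subst hi
      have : Subsingleton (Fin (v i)) := by rw [hv]; infer_instance
      obtain rfl := Subsingleton.elim p q
      rw [ho, Matrix.diagonal_apply_eq]
      simp [canonicalParam]
      ring
    · rw [hentry i hi]
      simp [Matrix.diagonal_apply, canonicalParam, hi]
  · rw [hne _ _ hij, Matrix.diagonal_apply_ne]
    exact fun h => hij (congrArg Sigma.fst h)

end KempfNess

/-! ### Gradient and Hessian of `‖μ - α‖²` -/

section Frobenius

variable {m : Type*} [Fintype m]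

/-- The real inner product `Re Tr(M N^*)`. -/
def frob (M N : Matrix m m ℂ) : ℝ := ((M * Nᴴ).trace).re

theorem frob_comm (M N : Matrix m m ℂ) : frob M N = frob N M := by
  rw [frob, ← Complex.conj_re, ← Complex.star_def, ← Matrix.trace_conjTranspose,
    Matrix.conjTranspose_mul, Matrix.conjTranspose_conjTranspose, frob]

theorem frob_add_left (M M' N : Matrix m m ℂ) : frob (M + M') N = frob M N + frob M' N := by
  simp [frob, Matrix.add_mul]

theorem frob_smul_left (t : ℝ) (M N : Matrix m m ℂ) : frob (t • M) N = t * frob M N := by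
  simp [frob]

theorem frob_add_right (M N N' : Matrix m m ℂ) : frob M (N + N') = frob M N + frob M N' := by
  rw [frob_comm, frob_add_left, frob_comm N, frob_comm N']

theorem frob_smul_right (t : ℝ) (M N : Matrix m m ℂ) : frob M (t • N) = t * frob M N := by
  rw [frob_comm, frob_smul_left, frob_comm]

end Frobenius

/-- Along a line the energy is a quartic polynomial in the parameter and its differential is a cubic
one. First and second derivatives are therefore read off as linear coefficients. -/
theorem hasDerivAt_polynomial_zero (a b c d e : ℝ) :
    HasDerivAt (fun t : ℝ => a + b * t + c * t ^ 2 + d * t ^ 3 + e * t ^ 4) b 0 := by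
  have h1 := (hasDerivAt_id (0 : ℝ)).const_mul b
  have h2 := (hasDerivAt_pow 2 (0 : ℝ)).const_mul c
  have h3 := (hasDerivAt_pow 3 (0 : ℝ)).const_mul d
  have h4 := (hasDerivAt_pow 4 (0 : ℝ)).const_mul e
  have := (((h1.const_add a).add h2).add h3).add h4
  convert! this using 1
  simp

section Energy

variable {I : Type u} {E : Type w} [Fintype I] [DecidableEq I] [Fintype E] {Q : Quiv I E}
  {v : I → ℕ}

/-- The Hermitian matrix `-i (μ(A) - α)`. -/
def defect (α : I → ℤ) (A : Rep Q v) : Matrix (VectIdx v) (VectIdx v) ℂ :=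
  (-(1 / 2) : ℝ) • crossMoment A A - Matrix.diagonal fun p => (α p.1 : ℂ)

/-- The diagonal blocks of `-i (μ(A) - α)`. -/
def defectLie (α : I → ℤ) (A : Rep Q v) : GaugeLie v := (defect α A).blockDiag'

theorem blockDiagonal'_defectLie (α : I → ℤ) (A : Rep Q v) :
    Matrix.blockDiagonal' (defectLie α A) = defect α A := by
  refine blockDiagonal'_blockDiag' _ fun p q h => ?_
  rw [defect, Matrix.sub_apply, Matrix.smul_apply, crossMoment_apply_ne _ _ _ _ h,
    Matrix.diagonal_apply_ne _ fun h' => h (congrArg Sigma.fst h')]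
  simp

theorem defect_conjTranspose (α : I → ℤ) (A : Rep Q v) : (defect α A)ᴴ = defect α A := by
  rw [defect, Matrix.conjTranspose_sub, Matrix.conjTranspose_smul, crossMoment_conjTranspose,
    Matrix.diagonal_conjTranspose, star_trivial]
  congr 2
  funext p
  simp

theorem momentMap_sub_centralElement (α : I → ℤ) (A : Rep Q v) :
    momentMap A - centralElement v α = Complex.I • defect α A := by
  ext p q
  have hI : (1 / (2 * Complex.I)) = -(Complex.I / 2) := by
    field_simp
    simp
  rw [momentMap_eq, hI, centralElement, defect]
  by_cases h : p = q
  · subst h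
    simp
    ring
  · simp [Matrix.diagonal_apply_ne _ h]
    ring

theorem energy_eq (α : I → ℤ) (A : Rep Q v) : energy α A = frob (defect α A) (defect α A) := by
  rw [frob, re_trace_mul_conjTranspose_self, energy, momentMap_sub_centralElement]
  simp

/-- The symmetric bilinear form associated with `∑_a [A_a, A_a^*]`. -/
def polarMoment (A X : Rep Q v) : Matrix (VectIdx v) (VectIdx v) ℂ :=
  crossMoment A X + crossMoment X A

theorem polarMoment_comm (A X : Rep Q v) : polarMoment A X = polarMoment X A := add_comm _ _

theorem defect_add_smul (α : I → ℤ) (A X : Rep Q v) (t : ℝ) :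
    defect α (A + t • X) = defect α A + t • ((-(1 / 2) : ℝ) • polarMoment A X) +
      t ^ 2 • ((-(1 / 2) : ℝ) • crossMoment X X) := by
  simp only [defect, polarMoment, crossMoment_add_left, crossMoment_add_right,
    crossMoment_smul_left, crossMoment_smul_right, smul_add, smul_smul]
  rw [show t * -(1 / 2) = -(1 / 2) * t by ring, show t ^ 2 * -(1 / 2) = -(1 / 2) * (t * t) by ring]
  abel

theorem hasDerivAt_energy (α : I → ℤ) (A X : Rep Q v) :
    HasDerivAt (fun t : ℝ => energy α (A + t • X)) (-frob (defect α A) (polarMoment A X)) 0 := by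
  set D := defect α A
  set L := polarMoment A X
  set S := crossMoment X X
  convert! hasDerivAt_polynomial_zero (frob D D) (-frob D L) (-frob D S + frob L L / 4)
    (frob L S / 2) (frob S S / 4) using 1
  funext t
  rw [energy_eq, defect_add_smul]
  simp only [frob_add_left, frob_add_right, frob_smul_left, frob_smul_right, frob_comm L D,
    frob_comm S D, frob_comm S L, D, L, S]
  ring

/-- Identifies the gradient of the energy at `A` as `-2` times the infinitesimal action of the
defect on `A`, and likewise the second term of the Hessian. -/
theorem frob_defect_polarMoment (α : I → ℤ) (A X Y : Rep Q v) :
    frob (defect α A) (polarMoment X Y) = 2 * metric (infAct X (defectLie α A)) Y := by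
  have h1 : frob (defect α A) (crossMoment Y X) = metric (infAct X (defectLie α A)) Y := by
    rw [frob, crossMoment_conjTranspose, metric_infAct_left, blockDiagonal'_defectLie]
  have h2 : frob (defect α A) (crossMoment X Y) = frob (defect α A) (crossMoment Y X) := by
    rw [frob_comm, frob, defect_conjTranspose, frob, crossMoment_conjTranspose,
      Matrix.trace_mul_comm]
  rw [polarMoment, frob_add_right, h2, h1]
  ring

theorem isCritical_iff (α : I → ℤ) (A : Rep Q v) :
    IsCritical α A ↔ infAct A (defectLie α A) = 0 := by
  constructor
  · intro h
    -- Differentiating in the direction of `infAct A (defectLie α A)` itself yields the vanishing of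
    -- its norm.
    have h1 := (hasDerivAt_energy α A (infAct A (defectLie α A))).unique (h _)
    rw [frob_defect_polarMoment] at h1
    exact metric_self_eq_zero (by linarith)
  · intro h X
    have h1 := hasDerivAt_energy α A X
    rwa [frob_defect_polarMoment, h, metric_zero_left, mul_zero, neg_zero] at h1

theorem polarMoment_add_smul (A X Y : Rep Q v) (s : ℝ) :
    polarMoment (A + s • X) Y = polarMoment A Y + s • polarMoment X Y := by
  simp only [polarMoment, crossMoment_add_left, crossMoment_add_right, crossMoment_smul_left,
    crossMoment_smul_right, smul_add]
  abel

/-- The first term comes from the variation of the defect, the second from that of the polarised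
moment map with the defect frozen. -/
theorem hessian_eq (α : I → ℤ) (A X Y : Rep Q v) :
    hessian α A X Y = frob (polarMoment A X) (polarMoment A Y) / 2 -
      2 * metric (infAct X (defectLie α A)) Y := by
  have h1 : (fun s : ℝ => deriv (fun t : ℝ => energy α (A + s • X + t • Y)) 0) =
      fun s : ℝ => -frob (defect α (A + s • X)) (polarMoment (A + s • X) Y) :=
    funext fun s => (hasDerivAt_energy α (A + s • X) Y).deriv
  rw [hessian, h1, ← frob_defect_polarMoment]
  refine HasDerivAt.deriv ?_
  set D := defect α A with hD
  set L := polarMoment A X with hL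
  set S := crossMoment X X with hS
  set K := polarMoment A Y with hK
  set M := polarMoment X Y with hM
  convert! hasDerivAt_polynomial_zero (-frob D K) (frob L K / 2 - frob D M)
    (frob L M / 2 + frob S K / 2) (frob S M / 2) 0 using 1
  funext s
  rw [defect_add_smul, polarMoment_add_smul, ← hD, ← hL, ← hS, ← hK, ← hM]
  simp only [frob_add_left, frob_add_right, frob_smul_left, frob_smul_right]
  ring

theorem hessian_comm (α : I → ℤ) (A X Y : Rep Q v) : hessian α A X Y = hessian α A Y X := by
  rw [hessian_eq, hessian_eq, frob_comm, ← frob_defect_polarMoment, ← frob_defect_polarMoment,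
    polarMoment_comm X Y]

/-- The orthogonality is tested on `u = (crossMoment A δ)ᴴ`, which is block diagonal and hence a
legitimate element of the Lie algebra. -/
theorem crossMoment_eq_zero_of_orthogonal {A δ : Rep Q v}
    (h : ∀ u : GaugeLie v, metric (infAct A u) δ = 0) : crossMoment A δ = 0 := by
  have h1 := h (crossMoment A δ)ᴴ.blockDiag'
  rw [metric_infAct_left, blockDiagonal'_blockDiag'] at h1
  · refine Matrix.conjTranspose_eq_zero.1 (eq_zero_of_re_trace_mul_conjTranspose_self ?_)
    rwa [Matrix.conjTranspose_conjTranspose]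
  · intro p q hpq
    rw [crossMoment_conjTranspose, crossMoment_apply_ne _ _ _ _ hpq]

/-- Orthogonally to the orbit, the Hessian is given by the infinitesimal action of
`-2 (-i) (μ(A) - α)`. -/
theorem hessian_of_orthogonal (α : I → ℤ) {A δ : Rep Q v}
    (h : ∀ u : GaugeLie v, metric (infAct A u) δ = 0) (Y : Rep Q v) :
    hessian α A δ Y = -2 * metric (infAct δ (defectLie α A)) Y := by
  have h1 := crossMoment_eq_zero_of_orthogonal h
  have h2 : crossMoment δ A = 0 := by rw [← crossMoment_conjTranspose, h1, Matrix.conjTranspose_zero]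
  rw [hessian_eq, polarMoment, h1, h2]
  simp [frob]

/-- Nonnegative eigenvectors of the Hessian are orthogonal to the negative eigenspace. -/
theorem metric_eq_zero_of_mem_negSpace (α : I → ℤ) {A X δ : Rep Q v} {l : ℝ} (hl : 0 ≤ l)
    (hX : ∀ Y, hessian α A X Y = l * metric X Y) (hδ : δ ∈ negSpace α A) : metric δ X = 0 := by
  let Z : Submodule ℝ (Rep Q v) :=
    { carrier := {δ | metric δ X = 0}
      add_mem' := fun {a b} ha hb => by
        change metric (a + b) X = 0
        rw [metric_add_left, show metric a X = 0 from ha, show metric b X = 0 from hb, add_zero]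
      zero_mem' := metric_zero_left X
      smul_mem' := fun c a ha => by
        change metric (c • a) X = 0
        rw [metric_smul_left, show metric a X = 0 from ha, mul_zero] }
  have : negSpace α A ≤ Z := by
    refine iSup_le fun m => Submodule.span_le.2 fun Y hY => ?_
    change metric Y X = 0
    have h1 : hessian α A Y X = m * metric Y X := hY X
    -- Symmetry of the Hessian: eigenvectors for the distinct eigenvalues `m < 0 ≤ l` are
    -- orthogonal.
    rw [hessian_comm, hX, metric_comm X Y] at h1
    have hm : (m : ℝ) < 0 := m.2
    have h2 : (l - m) * metric Y X = 0 := by linarith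
    rcases mul_eq_zero.1 h2 with h3 | h3
    · linarith
    · exact h3
  exact this hδ

theorem mem_negSpace_of_eigenvector (α : I → ℤ) {A X : Rep Q v} {l : ℝ} (hl : l < 0)
    (hX : ∀ Y, hessian α A X Y = l * metric X Y) : X ∈ negSpace α A :=
  Submodule.mem_iSup_of_mem (⟨l, hl⟩ : Set.Iio (0 : ℝ)) (Submodule.subset_span hX)

end Energy

/-! ### Sub-dimension-vectors -/

section Inclusion

variable {I : Type u} {v₁ v : I → ℕ}

/-- The inclusion `ℂ^{v₁ i} ⊆ ℂ^{v i}` of the first coordinates. -/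
def inc (v₁ v : I → ℕ) (i : I) : Matrix (Fin (v i)) (Fin (v₁ i)) ℂ :=
  fun p q => if (p : ℕ) = q then 1 else 0

/-- The projection of `ℂ^{v i}` onto `ℂ^{v₁ i}`. -/
def proj₁ (v₁ v : I → ℕ) (i : I) : Matrix (Fin (v i)) (Fin (v i)) ℂ := inc v₁ v i * (inc v₁ v i)ᴴ

/-- The projection of `ℂ^{v i}` onto the orthogonal complement of `ℂ^{v₁ i}`. -/
def proj₂ (v₁ v : I → ℕ) (i : I) : Matrix (Fin (v i)) (Fin (v i)) ℂ := 1 - proj₁ v₁ v i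

theorem conjTranspose_inc_mul_inc (h : v₁ ≤ v) (i : I) : (inc v₁ v i)ᴴ * inc v₁ v i = 1 := by
  ext p q
  rw [Matrix.mul_apply, Finset.sum_eq_single (Fin.castLE (h i) p)]
  · by_cases hpq : p = q
    · subst hpq
      simp [inc]
    · have : (p : ℕ) ≠ q := fun h => hpq (Fin.ext h)
      simp [inc, hpq, this]
  · intro r _ hr
    have : (r : ℕ) ≠ p := fun h => hr (Fin.ext h)
    simp [inc, this]
  · simp

theorem proj₁_eq (i : I) :
    proj₁ v₁ v i = Matrix.diagonal fun p : Fin (v i) => if (p : ℕ) < v₁ i then 1 else 0 := by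
  ext p q
  rw [proj₁, Matrix.mul_apply]
  by_cases hp : (p : ℕ) < v₁ i
  · rw [Finset.sum_eq_single ⟨p, hp⟩]
    · by_cases hpq : p = q
      · subst hpq
        simp [inc, hp]
      · have : (q : ℕ) ≠ p := fun h => hpq (Fin.ext h.symm)
        simp [inc, hpq, this]
    · intro r _ hr
      have : (p : ℕ) ≠ r := fun h => hr (Fin.ext h.symm)
      simp [inc, this]
    · simp
  · rw [Finset.sum_eq_zero]
    · by_cases hpq : p = q
      · subst hpq
        simp [hp]
      · simp [hpq]
    · intro r _
      have : (p : ℕ) ≠ r := fun h => hp (h ▸ r.2)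
      simp [inc, this]

theorem proj₁_add_proj₂ (v₁ v : I → ℕ) (i : I) : proj₁ v₁ v i + proj₂ v₁ v i = 1 := by
  simp [proj₂]

theorem proj₁_conjTranspose (v₁ v : I → ℕ) (i : I) : (proj₁ v₁ v i)ᴴ = proj₁ v₁ v i := by
  simp [proj₁]

theorem proj₂_conjTranspose (v₁ v : I → ℕ) (i : I) : (proj₂ v₁ v i)ᴴ = proj₂ v₁ v i := by
  simp [proj₂, proj₁_conjTranspose]

theorem proj₁_mul_inc (h : v₁ ≤ v) (i : I) : proj₁ v₁ v i * inc v₁ v i = inc v₁ v i := by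
  rw [proj₁, Matrix.mul_assoc, conjTranspose_inc_mul_inc h, Matrix.mul_one]

theorem conjTranspose_inc_mul_proj₁ (h : v₁ ≤ v) (i : I) :
    (inc v₁ v i)ᴴ * proj₁ v₁ v i = (inc v₁ v i)ᴴ := by
  rw [proj₁, ← Matrix.mul_assoc, conjTranspose_inc_mul_inc h, Matrix.one_mul]

theorem proj₂_mul_inc (h : v₁ ≤ v) (i : I) : proj₂ v₁ v i * inc v₁ v i = 0 := by
  rw [proj₂, Matrix.sub_mul, proj₁_mul_inc h, Matrix.one_mul, sub_self]

theorem conjTranspose_inc_mul_proj₂ (h : v₁ ≤ v) (i : I) :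
    (inc v₁ v i)ᴴ * proj₂ v₁ v i = 0 := by
  rw [proj₂, Matrix.mul_sub, conjTranspose_inc_mul_proj₁ h, Matrix.mul_one, sub_self]

theorem proj₁_mul_self (h : v₁ ≤ v) (i : I) : proj₁ v₁ v i * proj₁ v₁ v i = proj₁ v₁ v i := by
  nth_rw 2 [proj₁]
  rw [← Matrix.mul_assoc, proj₁_mul_inc h, proj₁]

theorem proj₁_mul_proj₂ (h : v₁ ≤ v) (i : I) : proj₁ v₁ v i * proj₂ v₁ v i = 0 := by
  rw [proj₂, Matrix.mul_sub, Matrix.mul_one, proj₁_mul_self h, sub_self]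

theorem proj₂_mul_proj₁ (h : v₁ ≤ v) (i : I) : proj₂ v₁ v i * proj₁ v₁ v i = 0 := by
  rw [proj₂, Matrix.sub_mul, Matrix.one_mul, proj₁_mul_self h, sub_self]

theorem proj₂_mul_self (h : v₁ ≤ v) (i : I) : proj₂ v₁ v i * proj₂ v₁ v i = proj₂ v₁ v i := by
  nth_rw 1 [proj₂]
  rw [Matrix.sub_mul, Matrix.one_mul, proj₁_mul_proj₂ h, sub_zero]

theorem proj₂_eq_zero {i : I} (hi : v₁ i = v i) : proj₂ v₁ v i = 0 := by
  rw [proj₂, proj₁_eq]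
  have : (Matrix.diagonal fun p : Fin (v i) => if (p : ℕ) < v₁ i then (1 : ℂ) else 0) = 1 := by
    rw [← Matrix.diagonal_one]
    congr 1
    funext p
    simp [hi]
  rw [this, sub_self]

theorem trace_proj₁ (h : v₁ ≤ v) (i : I) : (proj₁ v₁ v i).trace = v₁ i := by
  rw [proj₁, Matrix.trace_mul_comm, conjTranspose_inc_mul_inc h]
  simp

theorem trace_proj₂ (h : v₁ ≤ v) (i : I) : (proj₂ v₁ v i).trace = v i - v₁ i := by
  rw [proj₂, Matrix.trace_sub, trace_proj₁ h]
  simp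

end Inclusion

/-! ### Extension by zero and restriction as matrix products -/

section ExtendRestrict

variable {I : Type u} {E : Type w} {Q : Quiv I E} {v₁ v : I → ℕ}

theorem extend_eq (x₁ : Rep Q v₁) (a : E) : (extend x₁ : Rep Q v) a =
    inc v₁ v (Q.head a) * x₁ a * (inc v₁ v (Q.tail a))ᴴ := by
  ext p q
  rw [Matrix.mul_apply]
  by_cases hq : (q : ℕ) < v₁ (Q.tail a)
  · rw [Finset.sum_eq_single ⟨q, hq⟩]
    · rw [Matrix.mul_apply]
      by_cases hp : (p : ℕ) < v₁ (Q.head a)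
      · rw [Finset.sum_eq_single ⟨p, hp⟩]
        · simp [extend, hp, hq, inc]
        · intro r _ hr
          have : (p : ℕ) ≠ r := fun h => hr (Fin.ext h.symm)
          simp [inc, this]
        · simp
      · rw [Finset.sum_eq_zero]
        · simp [extend, hp]
        · intro r _
          have : (p : ℕ) ≠ r := fun h => hp (h ▸ r.2)
          simp [inc, this]
    · intro r _ hr
      have : (q : ℕ) ≠ r := fun h => hr (Fin.ext h.symm)
      simp [inc, this]
    · simp
  · rw [Finset.sum_eq_zero]
    · simp [extend, hq]
    · intro r _
      have : (q : ℕ) ≠ r := fun h => hq (h ▸ r.2)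
      simp [inc, this]

theorem restrict_eq (h : v₁ ≤ v) (x : Rep Q v) (a : E) : restrict h x a =
    (inc v₁ v (Q.head a))ᴴ * x a * inc v₁ v (Q.tail a) := by
  ext p q
  rw [Matrix.mul_apply, Finset.sum_eq_single (Fin.castLE (h _) q), Matrix.mul_apply,
    Finset.sum_eq_single (Fin.castLE (h _) p)]
  · simp [restrict, inc]
  · intro r _ hr
    have : (r : ℕ) ≠ p := fun h => hr (Fin.ext h)
    simp [inc, this]
  · simp
  · intro r _ hr
    have : (r : ℕ) ≠ q := fun h => hr (Fin.ext h)
    simp [inc, this]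
  · simp

theorem extend_self (x : Rep Q v) : (extend x : Rep Q v) = x := by
  funext a
  ext p q
  simp [extend]

theorem restrict_extend (h : v₁ ≤ v) (x₁ : Rep Q v₁) : restrict h (extend x₁) = x₁ := by
  funext a
  ext p q
  simp [extend, restrict]

theorem restrict_add (h : v₁ ≤ v) (x y : Rep Q v) :
    restrict h (x + y) = restrict h x + restrict h y := rfl

theorem proj₁_mul_extend (h : v₁ ≤ v) (x₁ : Rep Q v₁) (a : E) :
    proj₁ v₁ v (Q.head a) * (extend x₁ : Rep Q v) a = extend x₁ a := by
  rw [extend_eq, ← Matrix.mul_assoc, ← Matrix.mul_assoc, proj₁_mul_inc h]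

theorem extend_mul_proj₁ (h : v₁ ≤ v) (x₁ : Rep Q v₁) (a : E) :
    (extend x₁ : Rep Q v) a * proj₁ v₁ v (Q.tail a) = extend x₁ a := by
  rw [extend_eq, Matrix.mul_assoc, conjTranspose_inc_mul_proj₁ h]

theorem proj₂_mul_extend (h : v₁ ≤ v) (x₁ : Rep Q v₁) (a : E) :
    proj₂ v₁ v (Q.head a) * (extend x₁ : Rep Q v) a = 0 := by
  rw [proj₂, Matrix.sub_mul, Matrix.one_mul, proj₁_mul_extend h, sub_self]

theorem extend_mul_proj₂ (h : v₁ ≤ v) (x₁ : Rep Q v₁) (a : E) :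
    (extend x₁ : Rep Q v) a * proj₂ v₁ v (Q.tail a) = 0 := by
  rw [proj₂, Matrix.mul_sub, Matrix.mul_one, extend_mul_proj₁ h, sub_self]

end ExtendRestrict

/-! ### Critical points of the form `(x₁, 0)` -/

section Critical

variable {I : Type u} {E : Type w} [Fintype I] [DecidableEq I] [Fintype E] {Q : Quiv I E}
  {v₁ v : I → ℕ}

theorem blockDiag'_eq (N : Matrix (VectIdx v) (VectIdx v) ℂ) (i : I) :
    N.blockDiag' i = (emb v i)ᴴ * N * emb v i := by
  rw [mul_emb, emb_mul]
  rfl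

theorem blockDiag'_blockDiagonal'_mul_mul (A : ∀ i, Matrix (Fin (v i)) (Fin (v₁ i)) ℂ)
    (N : Matrix (VectIdx v₁) (VectIdx v₁) ℂ) (B : ∀ i, Matrix (Fin (v₁ i)) (Fin (v i)) ℂ) (i : I) :
    (Matrix.blockDiagonal' A * N * Matrix.blockDiagonal' B).blockDiag' i =
      A i * N.blockDiag' i * B i := by
  rw [blockDiag'_eq, blockDiag'_eq]
  simp only [← Matrix.mul_assoc, emb_mul_blockDiagonal']
  simp only [Matrix.mul_assoc, blockDiagonal'_mul_emb]

theorem crossMoment_extend (h : v₁ ≤ v) (x₁ y₁ : Rep Q v₁) :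
    crossMoment (extend x₁ : Rep Q v) (extend y₁) = Matrix.blockDiagonal' (inc v₁ v) *
      crossMoment x₁ y₁ * Matrix.blockDiagonal' fun i => (inc v₁ v i)ᴴ := by
  have hJ : (Matrix.blockDiagonal' fun i => (inc v₁ v i)ᴴ) * Matrix.blockDiagonal' (inc v₁ v) =
      1 := by
    rw [← Matrix.blockDiagonal'_mul]
    simp only [conjTranspose_inc_mul_inc h]
    exact Matrix.blockDiagonal'_one
  have hT : ∀ (z₁ : Rep Q v₁) (a : E), toEnd ((extend z₁ : Rep Q v) a) =
      Matrix.blockDiagonal' (inc v₁ v) * toEnd (z₁ a) *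
        Matrix.blockDiagonal' fun i => (inc v₁ v i)ᴴ := fun z₁ a => by
    rw [extend_eq]
    exact toEnd_mul_mul (inc v₁ v) (fun i => (inc v₁ v i)ᴴ) (z₁ a)
  have hT' : ∀ (z₁ : Rep Q v₁) (a : E), (toEnd ((extend z₁ : Rep Q v) a))ᴴ =
      Matrix.blockDiagonal' (inc v₁ v) * (toEnd (z₁ a))ᴴ *
        Matrix.blockDiagonal' fun i => (inc v₁ v i)ᴴ := fun z₁ a => by
    rw [hT, Matrix.conjTranspose_mul, Matrix.conjTranspose_mul, Matrix.blockDiagonal'_conjTranspose,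
      Matrix.blockDiagonal'_conjTranspose]
    simp only [Matrix.conjTranspose_conjTranspose, Matrix.mul_assoc]
  have hmul : ∀ M N : Matrix (VectIdx v₁) (VectIdx v₁) ℂ,
      (Matrix.blockDiagonal' (inc v₁ v) * M * Matrix.blockDiagonal' fun i => (inc v₁ v i)ᴴ) *
      (Matrix.blockDiagonal' (inc v₁ v) * N * Matrix.blockDiagonal' fun i => (inc v₁ v i)ᴴ) =
      Matrix.blockDiagonal' (inc v₁ v) * (M * N) *
        Matrix.blockDiagonal' fun i => (inc v₁ v i)ᴴ := fun M N => by
    calc _ = Matrix.blockDiagonal' (inc v₁ v) * M *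
          ((Matrix.blockDiagonal' fun i => (inc v₁ v i)ᴴ) * Matrix.blockDiagonal' (inc v₁ v)) * N *
          Matrix.blockDiagonal' fun i => (inc v₁ v i)ᴴ := by simp only [Matrix.mul_assoc]
      _ = _ := by rw [hJ, Matrix.mul_one, Matrix.mul_assoc _ M N]
  rw [crossMoment, crossMoment, Matrix.mul_sum, Matrix.sum_mul]
  refine Finset.sum_congr rfl fun a _ => ?_
  rw [comm, comm, hT', hT, hmul, hmul, Matrix.mul_sub, Matrix.sub_mul]

theorem blockDiag'_diagonal_fst (α : I → ℤ) (i : I) :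
    (Matrix.diagonal fun p : VectIdx v => (α p.1 : ℂ)).blockDiag' i = (α i : ℂ) • 1 := by
  ext p q
  rw [Matrix.blockDiag'_apply]
  by_cases h : p = q
  · simp [h]
  · simp [h]

theorem defectLie_apply (α : I → ℤ) (A : Rep Q v) (i : I) : defectLie α A i =
    (-(1 / 2) : ℝ) • (crossMoment A A).blockDiag' i - (α i : ℂ) • 1 := by
  rw [← blockDiag'_diagonal_fst α i]
  rfl

/-- The moment map of `(x₁, 0)` vanishes on the complement. Since `v₁ o = v o`, the complement is
supported at vertices with `α_i = 1`, which leaves `-1` there. -/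
theorem defectLie_extend {o : I} (h : v₁ ≤ v) (ho : v₁ o = v o) (x₁ : Rep Q v₁) (i : I) :
    defectLie (canonicalParam o v) (extend x₁ : Rep Q v) i =
      inc v₁ v i * defectLie (canonicalParam o v) x₁ i * (inc v₁ v i)ᴴ - proj₂ v₁ v i := by
  rw [defectLie_apply, defectLie_apply, crossMoment_extend h, blockDiag'_blockDiagonal'_mul_mul]
  have h1 : (canonicalParam o v i : ℂ) • proj₂ v₁ v i = proj₂ v₁ v i := by
    by_cases hi : i = o
    · subst hi
      rw [proj₂_eq_zero ho, smul_zero]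
    · simp [canonicalParam, hi]
  have h2 : (canonicalParam o v i : ℂ) • (1 : Matrix (Fin (v i)) (Fin (v i)) ℂ) =
      (canonicalParam o v i : ℂ) • (inc v₁ v i * (inc v₁ v i)ᴴ) + proj₂ v₁ v i := by
    rw [← h1, ← smul_add]
    congr 1
    exact (proj₁_add_proj₂ v₁ v i).symm
  rw [h2]
  simp only [Matrix.mul_sub, Matrix.sub_mul, Matrix.mul_smul, Matrix.smul_mul, Matrix.mul_one]
  abel

theorem infAct_extend_defectLie {o : I} (h : v₁ ≤ v) (ho : v₁ o = v o) (x₁ : Rep Q v₁) :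
    infAct (extend x₁ : Rep Q v) (defectLie (canonicalParam o v) (extend x₁)) =
      extend (infAct x₁ (defectLie (canonicalParam o v) x₁)) := by
  funext a
  rw [infAct, defectLie_extend h ho, defectLie_extend h ho, Matrix.sub_mul, Matrix.mul_sub,
    proj₂_mul_extend h, extend_mul_proj₂ h, sub_zero, sub_zero, extend_eq, extend_eq, infAct]
  have h1 : ∀ i {m : ℕ} (N : Matrix (Fin (v₁ i)) (Fin m) ℂ),
      (inc v₁ v i)ᴴ * (inc v₁ v i * N) = N := fun i m N => by
    rw [← Matrix.mul_assoc, conjTranspose_inc_mul_inc h, Matrix.one_mul]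
  simp only [Matrix.mul_assoc, h1, Matrix.mul_sub, Matrix.sub_mul]

theorem isCritical_extend_iff {o : I} (h : v₁ ≤ v) (ho : v₁ o = v o) (x₁ : Rep Q v₁) :
    IsCritical (canonicalParam o v) (extend x₁ : Rep Q v) ↔
      infAct x₁ (defectLie (canonicalParam o v) x₁) = 0 := by
  rw [isCritical_iff, infAct_extend_defectLie h ho]
  constructor
  · intro h1
    rw [← restrict_extend h (infAct x₁ _), h1]
    rfl
  · intro h1
    rw [h1]
    funext a
    rw [extend_eq]
    simp

/-- Schur's lemma: subtracting the scalar by which an endomorphism acts at `o` leaves an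
endomorphism that vanishes at `o`, hence is zero. -/
theorem Costable.eq_smul_one {o : I} (hv : v o = 1) {x : Rep Q v} (hx : Costable o x)
    {e : GaugeLie v} (he : infAct x e = 0) : ∃ z : ℂ, ∀ i, e i = z • 1 := by
  refine ⟨(e o).det, fun i => ?_⟩
  have h1 : (fun i => e i - (e o).det • 1) = (0 : GaugeLie v) := by
    refine Intertwines.eq_zero hx (y := x) (fun a => ?_) (sub_eq_zero.2 (eq_det_smul_one hv (e o)))
    have := congrFun he a
    rw [infAct, Pi.zero_apply, sub_eq_zero] at this
    simp only [Matrix.sub_mul, Matrix.mul_sub, this, Matrix.smul_mul, Matrix.mul_smul,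
      Matrix.one_mul, Matrix.mul_one]
  exact sub_eq_zero.1 (congrFun h1 i)

/-- At a critical point `(x₁, 0)` with `x₁` costable, `-i(μ - α)` is a nonnegative scalar on the
first summand and `-1` on the second one. -/
theorem Costable.exists_defectLie_extend_eq {o : I} (hv : v o = 1) (h : v₁ ≤ v)
    (ho : v₁ o = v o) {x₁ : Rep Q v₁} (hx : Costable o x₁)
    (hcrit : IsCritical (canonicalParam o v) (extend x₁ : Rep Q v)) :
    ∃ c : ℝ, 0 ≤ c ∧ ∀ i, defectLie (canonicalParam o v) (extend x₁ : Rep Q v) i =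
      (c : ℂ) • proj₁ v₁ v i - proj₂ v₁ v i := by
  obtain ⟨z, hz⟩ := hx.eq_smul_one (ho.trans hv) ((isCritical_extend_iff h ho x₁).1 hcrit)
  have hd : ∀ i, defectLie (canonicalParam o v) (extend x₁ : Rep Q v) i =
      z • proj₁ v₁ v i - proj₂ v₁ v i := fun i => by
    rw [defectLie_extend h ho, hz, proj₁]
    simp
  -- Commutators are traceless and `∑ α_i v_i = 0`. The trace of the defect is therefore zero, which
  -- determines `z` as the ratio of the total dimensions of `V₂` and `V₁`.
  have htr : ∑ i, (defectLie (canonicalParam o v) (extend x₁ : Rep Q v) i).trace = 0 := by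
    rw [← Matrix.trace_blockDiagonal', blockDiagonal'_defectLie, defect, Matrix.trace_sub,
      Matrix.trace_smul, trace_crossMoment, smul_zero, zero_sub, neg_eq_zero, Matrix.trace,
      Fintype.sum_sigma]
    have := sum_canonicalParam_mul hv
    have h2 : ((∑ i, canonicalParam o v i * (v i : ℤ) : ℤ) : ℂ) = 0 := by rw [this]; simp
    rw [← h2]
    push_cast
    refine Finset.sum_congr rfl fun i _ => ?_
    simp [Matrix.diag, mul_comm]
  have hpos : 0 < ∑ i, (v₁ i : ℝ) := by
    refine Finset.sum_pos' (fun i _ => by positivity) ⟨o, Finset.mem_univ o, ?_⟩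
    rw [ho, hv]
    simp
  have hne : (∑ i, (v₁ i : ℂ)) ≠ 0 := by exact_mod_cast hpos.ne'
  refine ⟨(∑ i, ((v i : ℝ) - v₁ i)) / ∑ i, (v₁ i : ℝ), div_nonneg (Finset.sum_nonneg fun i _ =>
    sub_nonneg.2 (by exact_mod_cast h i)) hpos.le, fun i => ?_⟩
  rw [hd]
  congr 2
  simp only [hd, Matrix.trace_sub, Matrix.trace_smul, trace_proj₁ h, trace_proj₂ h,
    Finset.sum_sub_distrib, smul_eq_mul, ← Finset.mul_sum] at htr
  push_cast
  rw [eq_div_iff hne, Finset.sum_sub_distrib]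
  linear_combination htr

/-- If `x₁` is a solution of the moment map equation for the multiple of `α(Q, v₁)` induced by
`α(Q, v)`, then `(x₁, 0)` is a critical point. -/
theorem isCritical_extend_of_crossMoment {o : I} (hv : v o = 1) (h : v₁ ≤ v)
    (ho : v₁ o = v o) {x₁ : Rep Q v₁}
    (hx : crossMoment x₁ x₁ = Matrix.diagonal fun p =>
      -(2 * (((∑ i, (v i : ℝ)) / ∑ i, (v₁ i : ℝ) : ℝ) : ℂ) * (canonicalParam o v₁ p.1 : ℂ))) :
    IsCritical (canonicalParam o v) (extend x₁ : Rep Q v) := by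
  set τ : ℝ := (∑ i, (v i : ℝ)) / ∑ i, (v₁ i : ℝ) with hτ
  have hpos : 0 < ∑ i, (v₁ i : ℝ) := by
    refine Finset.sum_pos' (fun i _ => by positivity) ⟨o, Finset.mem_univ o, ?_⟩
    rw [ho, hv]
    simp
  have hmul : (τ : ℂ) * ∑ i, (v₁ i : ℂ) = ∑ i, (v i : ℂ) := by
    have : τ * ∑ i, (v₁ i : ℝ) = ∑ i, (v i : ℝ) := by rw [hτ]; field_simp
    exact_mod_cast this
  have he : ∀ i, defectLie (canonicalParam o v) x₁ i = ((τ : ℂ) - 1) • 1 := by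
    intro i
    -- The factor `τ` is chosen so that `τ α(Q, v₁)` and the restriction of `α(Q, v)` differ by one
    -- constant at all vertices. At `o` the canonical parameter is `1` minus the total dimension,
    -- and `τ` exchanges the two total dimensions.
    have h1 : (τ : ℂ) * canonicalParam o v₁ i - canonicalParam o v i = τ - 1 := by
      by_cases hi : i = o
      · subst hi
        have h2 : ∀ f : I → ℕ, f i = 1 →
            (canonicalParam i f i : ℂ) = 1 - ∑ j, (f j : ℂ) := by
          intro f hf
          rw [← Finset.add_sum_erase _ _ (Finset.mem_univ i), hf]
          simp [canonicalParam]
        rw [h2 _ hv, h2 _ (ho.trans hv)]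
        linear_combination -hmul
      · simp [canonicalParam, hi]
    rw [defectLie_apply, hx, ← h1, sub_smul]
    congr 1
    ext p q
    rw [Matrix.smul_apply, Matrix.blockDiag'_apply]
    by_cases hpq : p = q
    · subst hpq
      simp
      ring
    · simp [hpq]
  rw [isCritical_extend_iff h ho]
  funext a
  rw [infAct, he, he]
  simp

end Critical

/-! ### The negative slice at `(x₁, 0)` -/

section NegSlice

variable {I : Type u} {E : Type w} {Q : Quiv I E} {v : I → ℕ}

/-- The representation `(P_{h(a)} X_a P'_{t(a)})_a`. -/
def sandwich (P P' : GaugeLie v) (X : Rep Q v) : Rep Q v := fun a =>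
  P (Q.head a) * X a * P' (Q.tail a)

/-- Projections commuting with `A` cut the tangent space of its orbit into blocks; hence blocks of
vectors orthogonal to the orbit are again orthogonal to it. -/
theorem sandwich_infAct {P P' : GaugeLie v} {A : Rep Q v}
    (hP : ∀ a, P (Q.head a) * A a = A a * P (Q.tail a))
    (hP' : ∀ a, P' (Q.head a) * A a = A a * P' (Q.tail a)) (u : GaugeLie v) :
    sandwich P P' (infAct A u) = infAct A fun i => P i * u i * P' i := by
  funext a
  simp only [sandwich, infAct, Matrix.mul_sub, Matrix.sub_mul, Matrix.mul_assoc, hP']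
  simp only [← Matrix.mul_assoc, hP]

variable [Fintype E]

theorem metric_sandwich {P P' : GaugeLie v} (hP : ∀ i, (P i)ᴴ = P i) (hP' : ∀ i, (P' i)ᴴ = P' i)
    (X Y : Rep Q v) : metric (sandwich P P' X) Y = metric X (sandwich P P' Y) := by
  refine Finset.sum_congr rfl fun a _ => ?_
  simp only [sandwich, Matrix.conjTranspose_mul, hP, hP']
  rw [Matrix.mul_assoc, Matrix.mul_assoc, Matrix.trace_mul_comm]
  simp only [Matrix.mul_assoc]

theorem sandwich_orthogonal {P P' : GaugeLie v} (hP : ∀ i, (P i)ᴴ = P i)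
    (hP' : ∀ i, (P' i)ᴴ = P' i) {A : Rep Q v}
    (hPA : ∀ a, P (Q.head a) * A a = A a * P (Q.tail a))
    (hPA' : ∀ a, P' (Q.head a) * A a = A a * P' (Q.tail a)) {δ : Rep Q v}
    (hδ : ∀ u : GaugeLie v, metric (infAct A u) δ = 0) (u : GaugeLie v) :
    metric (infAct A u) (sandwich P P' δ) = 0 := by
  rw [← metric_sandwich hP hP', sandwich_infAct hPA hPA', hδ]

variable [Fintype I] [DecidableEq I]

/-- A block consists of maps from the range of `P'` to that of `P`. The defect `s` at the head and
`t` at the tail act on it by `s - t`, so it is an eigenspace with eigenvalue `2(t - s)`. -/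
theorem hessian_sandwich {P P' : GaugeLie v} (hP : ∀ i, (P i)ᴴ = P i)
    (hP' : ∀ i, (P' i)ᴴ = P' i) {A : Rep Q v}
    (hPA : ∀ a, P (Q.head a) * A a = A a * P (Q.tail a))
    (hPA' : ∀ a, P' (Q.head a) * A a = A a * P' (Q.tail a)) {α : I → ℤ} {s t : ℝ}
    (hs : ∀ i, defectLie α A i * P i = (s : ℂ) • P i)
    (ht : ∀ i, P' i * defectLie α A i = (t : ℂ) • P' i) {δ : Rep Q v}
    (hδ : ∀ u : GaugeLie v, metric (infAct A u) δ = 0) (Y : Rep Q v) :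
    hessian α A (sandwich P P' δ) Y = 2 * (t - s) * metric (sandwich P P' δ) Y := by
  rw [hessian_of_orthogonal α (sandwich_orthogonal hP hP' hPA hPA' hδ)]
  have : infAct (sandwich P P' δ) (defectLie α A) = (s - t) • sandwich P P' δ := by
    funext a
    simp only [infAct, sandwich, Pi.smul_apply, ← Matrix.mul_assoc, hs]
    rw [Matrix.mul_assoc _ (P' _), ht]
    ext p q
    simp
    ring
  rw [this, metric_smul_left]
  ring

/-- For `s ≤ t` the block of `δ` is an eigenvector with nonnegative eigenvalue, hence orthogonal to
`δ`; but the inner product of the two is the square norm of the block. -/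
theorem sandwich_eq_zero_of_mem_negSpace {P P' : GaugeLie v} (hP : ∀ i, (P i)ᴴ = P i)
    (hP' : ∀ i, (P' i)ᴴ = P' i) (hPP : ∀ i, P i * P i = P i) (hPP' : ∀ i, P' i * P' i = P' i)
    {A : Rep Q v} (hPA : ∀ a, P (Q.head a) * A a = A a * P (Q.tail a))
    (hPA' : ∀ a, P' (Q.head a) * A a = A a * P' (Q.tail a)) {α : I → ℤ} {s t : ℝ}
    (hs : ∀ i, defectLie α A i * P i = (s : ℂ) • P i)
    (ht : ∀ i, P' i * defectLie α A i = (t : ℂ) • P' i) (hst : s ≤ t) {δ : Rep Q v}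
    (hδ : ∀ u : GaugeLie v, metric (infAct A u) δ = 0) (hneg : δ ∈ negSpace α A) :
    sandwich P P' δ = 0 := by
  have h1 := metric_eq_zero_of_mem_negSpace α (l := 2 * (t - s)) (by linarith)
    (hessian_sandwich hP hP' hPA hPA' hs ht hδ) hneg
  have h2 : sandwich P P' (sandwich P P' δ) = sandwich P P' δ := by
    funext a
    simp only [sandwich, ← Matrix.mul_assoc, hPP]
    rw [Matrix.mul_assoc _ (P' _), hPP']
  refine metric_self_eq_zero ?_
  rwa [metric_sandwich hP hP', h2]

variable {v₁ : I → ℕ}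

theorem defectLie_mul_proj {o : I} (h : v₁ ≤ v) {A : Rep Q v} {c : ℝ}
    (hd : ∀ i, defectLie (canonicalParam o v) A i = (c : ℂ) • proj₁ v₁ v i - proj₂ v₁ v i) (i : I) :
    (defectLie (canonicalParam o v) A i * proj₁ v₁ v i = (c : ℂ) • proj₁ v₁ v i ∧
      proj₁ v₁ v i * defectLie (canonicalParam o v) A i = (c : ℂ) • proj₁ v₁ v i) ∧
    (defectLie (canonicalParam o v) A i * proj₂ v₁ v i = ((-1 : ℝ) : ℂ) • proj₂ v₁ v i ∧
      proj₂ v₁ v i * defectLie (canonicalParam o v) A i = ((-1 : ℝ) : ℂ) • proj₂ v₁ v i) := by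
  simp [hd, Matrix.sub_mul, Matrix.mul_sub, proj₁_mul_self h, proj₂_mul_self h, proj₁_mul_proj₂ h,
    proj₂_mul_proj₁ h]

theorem proj₁_extend_comm (h : v₁ ≤ v) (x₁ : Rep Q v₁) (a : E) :
    proj₁ v₁ v (Q.head a) * (extend x₁ : Rep Q v) a =
      (extend x₁ : Rep Q v) a * proj₁ v₁ v (Q.tail a) := by
  rw [proj₁_mul_extend h, extend_mul_proj₁ h]

theorem proj₂_extend_comm (h : v₁ ≤ v) (x₁ : Rep Q v₁) (a : E) :
    proj₂ v₁ v (Q.head a) * (extend x₁ : Rep Q v) a =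
      (extend x₁ : Rep Q v) a * proj₂ v₁ v (Q.tail a) := by
  rw [proj₂_mul_extend h, extend_mul_proj₂ h]

/-- Elements of the negative slice at `(x₁, 0)` are homomorphisms from the second summand to the
first one. -/
theorem sandwich_eq_self_of_mem_negSpace {o : I} (h : v₁ ≤ v) {x₁ : Rep Q v₁} {c : ℝ} (hc : 0 ≤ c)
    (hd : ∀ i, defectLie (canonicalParam o v) (extend x₁ : Rep Q v) i =
      (c : ℂ) • proj₁ v₁ v i - proj₂ v₁ v i) {δ : Rep Q v}
    (hδ : ∀ u : GaugeLie v, metric (infAct (extend x₁) u) δ = 0)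
    (hneg : δ ∈ negSpace (canonicalParam o v) (extend x₁)) :
    sandwich (proj₁ v₁ v) (proj₂ v₁ v) δ = δ := by
  have hD := defectLie_mul_proj h hd
  -- With defects `c` on `V₁` and `-1` on `V₂`, the eigenvalues of these three blocks are `0`, `2(c
  -- + 1)` and `0`. Only `Hom(V₂, V₁)` survives.
  have h11 := sandwich_eq_zero_of_mem_negSpace (proj₁_conjTranspose v₁ v) (proj₁_conjTranspose v₁ v)
    (proj₁_mul_self h) (proj₁_mul_self h) (proj₁_extend_comm h x₁) (proj₁_extend_comm h x₁)
    (fun i => (hD i).1.1) (fun i => (hD i).1.2) le_rfl hδ hneg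
  have h21 := sandwich_eq_zero_of_mem_negSpace (proj₂_conjTranspose v₁ v) (proj₁_conjTranspose v₁ v)
    (proj₂_mul_self h) (proj₁_mul_self h) (proj₂_extend_comm h x₁) (proj₁_extend_comm h x₁)
    (fun i => (hD i).2.1) (fun i => (hD i).1.2) (by linarith) hδ hneg
  have h22 := sandwich_eq_zero_of_mem_negSpace (proj₂_conjTranspose v₁ v) (proj₂_conjTranspose v₁ v)
    (proj₂_mul_self h) (proj₂_mul_self h) (proj₂_extend_comm h x₁) (proj₂_extend_comm h x₁)
    (fun i => (hD i).2.1) (fun i => (hD i).2.2) le_rfl hδ hneg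
  funext a
  have h1 := congrFun h11 a
  have h2 := congrFun h21 a
  have h3 := congrFun h22 a
  simp only [sandwich, Pi.zero_apply] at h1 h2 h3 ⊢
  calc proj₁ v₁ v (Q.head a) * δ a * proj₂ v₁ v (Q.tail a)
      = proj₁ v₁ v (Q.head a) * δ a * proj₁ v₁ v (Q.tail a) +
        proj₁ v₁ v (Q.head a) * δ a * proj₂ v₁ v (Q.tail a) +
        (proj₂ v₁ v (Q.head a) * δ a * proj₁ v₁ v (Q.tail a) +
        proj₂ v₁ v (Q.head a) * δ a * proj₂ v₁ v (Q.tail a)) := by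
        rw [h1, h2, h3, zero_add, add_zero, add_zero]
    _ = (proj₁ v₁ v (Q.head a) + proj₂ v₁ v (Q.head a)) * δ a *
        (proj₁ v₁ v (Q.tail a) + proj₂ v₁ v (Q.tail a)) := by
        simp only [Matrix.add_mul, Matrix.mul_add]
        abel
    _ = δ a := by rw [proj₁_add_proj₂, proj₁_add_proj₂, Matrix.one_mul, Matrix.mul_one]

theorem sandwich_mem_negSpace {o : I} (h : v₁ ≤ v) {x₁ : Rep Q v₁} {c : ℝ} (hc : 0 ≤ c)
    (hd : ∀ i, defectLie (canonicalParam o v) (extend x₁ : Rep Q v) i =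
      (c : ℂ) • proj₁ v₁ v i - proj₂ v₁ v i) {δ : Rep Q v}
    (hδ : ∀ u : GaugeLie v, metric (infAct (extend x₁) u) δ = 0) :
    sandwich (proj₁ v₁ v) (proj₂ v₁ v) δ ∈ negSpace (canonicalParam o v) (extend x₁) := by
  have hD := defectLie_mul_proj h hd
  exact mem_negSpace_of_eigenvector _ (l := 2 * (-1 - c)) (by linarith)
    (hessian_sandwich (proj₁_conjTranspose v₁ v) (proj₂_conjTranspose v₁ v)
      (proj₁_extend_comm h x₁) (proj₂_extend_comm h x₁)
      (fun i => (hD i).1.1) (fun i => (hD i).2.2) hδ)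

/-- Every representation is orthogonal to the tangent space of an orbit up to a tangent vector. -/
theorem exists_orthogonal_correction (A δ : Rep Q v) :
    ∃ u : GaugeLie v, ∀ w : GaugeLie v, metric (infAct A w) (δ + infAct A u) = 0 := by
  let B : LinearMap.BilinForm ℝ (Rep Q v) := LinearMap.mk₂ ℝ metric metric_add_left
    metric_smul_left
    (fun X Y Z => by
      rw [metric_comm, metric_add_left, metric_comm Y, metric_comm Z])
    (fun c X Y => by rw [metric_comm, metric_smul_left, metric_comm Y]; rfl)
  let W : Submodule ℝ (Rep Q v) :=
    { carrier := Set.range fun u : GaugeLie v => infAct A u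
      add_mem' := by
        rintro _ _ ⟨u, rfl⟩ ⟨w, rfl⟩
        refine ⟨u + w, ?_⟩
        funext a
        simp only [infAct, Pi.add_apply, Matrix.add_mul, Matrix.mul_add]
        abel
      zero_mem' := ⟨0, by funext a; simp [infAct]⟩
      smul_mem' := by
        rintro c _ ⟨u, rfl⟩
        refine ⟨c • u, ?_⟩
        funext a
        simp [infAct, smul_sub] }
  have hB : B.IsRefl := fun X Y hXY => by
    change metric Y X = 0
    rw [metric_comm]
    exact hXY
  -- The metric is positive definite, so every subspace has an orthogonal complement.
  have hnd : (B.restrict W).Nondegenerate := by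
    refine ⟨fun X hX => ?_, fun X hX => ?_⟩
    · exact Subtype.ext (metric_self_eq_zero (hX X))
    · exact Subtype.ext (metric_self_eq_zero (hX X))
  have hcompl := LinearMap.BilinForm.isCompl_orthogonal_of_restrict_nondegenerate hB hnd
  obtain ⟨y, hy, z, hz, hyz⟩ := Submodule.mem_sup.1
    (hcompl.sup_eq_top ▸ Submodule.mem_top : δ ∈ W ⊔ B.orthogonal W)
  obtain ⟨u, rfl⟩ := hy
  refine ⟨-u, fun w => ?_⟩
  have h1 : δ + infAct A (-u) = z := by
    rw [← hyz]
    funext a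
    simp only [infAct, Pi.add_apply, Pi.neg_apply, Matrix.neg_mul, Matrix.mul_neg]
    abel
  rw [h1]
  exact hz _ ⟨w, rfl⟩

end NegSlice

/-! ### Invariant sub-dimension-vectors -/

section Invariant

variable {I : Type u} {E : Type w} {Q : Quiv I E} {v₁ v : I → ℕ}

theorem proj₁_mul_of_proj₂_mul {x : Rep Q v}
    (hx : ∀ a, proj₂ v₁ v (Q.head a) * x a = 0) (a : E) : proj₁ v₁ v (Q.head a) * x a = x a := by
  have := congrArg (· * x a) (proj₁_add_proj₂ v₁ v (Q.head a))
  simpa [Matrix.add_mul, hx] using this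

theorem mul_inc_of_proj₂_mul (h : v₁ ≤ v) {x : Rep Q v}
    (hx : ∀ a, proj₂ v₁ v (Q.head a) * x a = 0) (a : E) :
    x a * inc v₁ v (Q.tail a) = inc v₁ v (Q.head a) * restrict h x a := by
  rw [restrict_eq, ← Matrix.mul_assoc, ← Matrix.mul_assoc, ← proj₁, proj₁_mul_of_proj₂_mul hx]

theorem inc_mulVec_injective (h : v₁ ≤ v) (i : I) :
    Function.Injective (inc v₁ v i).mulVecLin := by
  intro w w' hw
  have := congrArg (fun z => (inc v₁ v i)ᴴ *ᵥ z) hw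
  simpa [Matrix.mulVec_mulVec, conjTranspose_inc_mul_inc h] using this

/-- A subrepresentation of the restriction is carried by the inclusion to a subrepresentation of
`x`. -/
theorem Costable.restrict {o : I} (h : v₁ ≤ v) {x : Rep Q v} (hx : Costable o x)
    (hinv : ∀ a, proj₂ v₁ v (Q.head a) * x a = 0) : Costable o (restrict h x) := by
  intro W hW ho i
  have key := hx (fun i => (W i).map (inc v₁ v i).mulVecLin) ?_ ?_ i
  · rw [Submodule.eq_bot_iff] at key ⊢
    exact fun w hw => inc_mulVec_injective h i ((key _ ⟨w, hw, rfl⟩).trans (map_zero _).symm)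
  · rintro a _ ⟨w, hw, rfl⟩
    refine ⟨_, hW a w hw, ?_⟩
    simp only [Matrix.mulVecLin_apply, Matrix.mulVec_mulVec, mul_inc_of_proj₂_mul h hinv]
  · simp [ho]

/-- Elements of `G_v` that preserve the subspaces `ℂ^{v₁ i}` act on the restriction. -/
theorem exists_act_restrict_eq (h : v₁ ≤ v) {x : Rep Q v}
    (hx : ∀ a, proj₂ v₁ v (Q.head a) * x a = 0) {g : Gauge v}
    (hg : ∀ i, proj₂ v₁ v i * (g i : Matrix (Fin (v i)) (Fin (v i)) ℂ) * inc v₁ v i = 0)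
    (hg' : ∀ i, proj₂ v₁ v i *
      (((g i)⁻¹ : GL (Fin (v i)) ℂ) : Matrix (Fin (v i)) (Fin (v i)) ℂ) * inc v₁ v i = 0) :
    ∃ g₁ : Gauge v₁, act g₁ (restrict h x) = restrict h (act g x) := by
  -- For matrices preserving `V₁`, compression to `V₁` is multiplicative; so the compressions of `g`
  -- and `g⁻¹` are mutually inverse.
  have key : ∀ i (M : Matrix (Fin (v i)) (Fin (v i)) ℂ), proj₂ v₁ v i * M * inc v₁ v i = 0 →
      inc v₁ v i * ((inc v₁ v i)ᴴ * M * inc v₁ v i) = M * inc v₁ v i := by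
    intro i M hM
    have := congrArg (· * (M * inc v₁ v i)) (proj₁_add_proj₂ v₁ v i)
    simp only [Matrix.add_mul, Matrix.one_mul] at this
    rw [← Matrix.mul_assoc (proj₂ v₁ v i), hM, add_zero, proj₁] at this
    simpa [Matrix.mul_assoc] using this
  have hmul : ∀ i (M N : Matrix (Fin (v i)) (Fin (v i)) ℂ), proj₂ v₁ v i * N * inc v₁ v i = 0 →
      M * N = 1 → ((inc v₁ v i)ᴴ * M * inc v₁ v i) * ((inc v₁ v i)ᴴ * N * inc v₁ v i) = 1 := by
    intro i M N hN hMN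
    rw [Matrix.mul_assoc, key i N hN, Matrix.mul_assoc, ← Matrix.mul_assoc M, hMN, Matrix.one_mul,
      conjTranspose_inc_mul_inc h]
  let g₁ : Gauge v₁ := fun i =>
    ⟨(inc v₁ v i)ᴴ * (g i : Matrix (Fin (v i)) (Fin (v i)) ℂ) * inc v₁ v i,
      (inc v₁ v i)ᴴ * (((g i)⁻¹ : GL (Fin (v i)) ℂ) : Matrix (Fin (v i)) (Fin (v i)) ℂ) *
        inc v₁ v i,
      hmul i _ _ (hg' i) (by rw [← Units.val_mul, mul_inv_cancel]; rfl),
      hmul i _ _ (hg i) (by rw [← Units.val_mul, inv_mul_cancel]; rfl)⟩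
  refine ⟨g₁, ?_⟩
  funext a
  change ((inc v₁ v (Q.head a))ᴴ * (g (Q.head a) : Matrix (Fin (v (Q.head a))) (Fin (v (Q.head a))) ℂ) * inc v₁ v (Q.head a)) *
    restrict h x a * ((inc v₁ v (Q.tail a))ᴴ *
      (((g (Q.tail a))⁻¹ : GL (Fin (v (Q.tail a))) ℂ) :
        Matrix (Fin (v (Q.tail a))) (Fin (v (Q.tail a))) ℂ) * inc v₁ v (Q.tail a)) = _
  rw [Matrix.mul_assoc _ (inc v₁ v (Q.head a)), ← mul_inc_of_proj₂_mul h hx, Matrix.mul_assoc,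
    Matrix.mul_assoc (x a), key _ _ (hg' _), restrict_eq, act]
  simp only [Matrix.mul_assoc]

/-- The element of `G_v` that acts by `g₁` on the first summand and trivially on the second one. -/
def extendGauge (h : v₁ ≤ v) (g₁ : Gauge v₁) : Gauge v := fun i =>
  have key : ∀ M N : Matrix (Fin (v₁ i)) (Fin (v₁ i)) ℂ, M * N = 1 →
      (inc v₁ v i * M * (inc v₁ v i)ᴴ + proj₂ v₁ v i) *
        (inc v₁ v i * N * (inc v₁ v i)ᴴ + proj₂ v₁ v i) = 1 := by
    intro M N hMN
    rw [Matrix.mul_add, Matrix.add_mul, Matrix.add_mul, proj₂_mul_self h, Matrix.mul_assoc _ _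
      (proj₂ v₁ v i), conjTranspose_inc_mul_proj₂ h, ← Matrix.mul_assoc (proj₂ v₁ v i),
      ← Matrix.mul_assoc (proj₂ v₁ v i), proj₂_mul_inc h]
    have : inc v₁ v i * M * (inc v₁ v i)ᴴ * (inc v₁ v i * N * (inc v₁ v i)ᴴ) =
        inc v₁ v i * (M * ((inc v₁ v i)ᴴ * inc v₁ v i) * N) * (inc v₁ v i)ᴴ := by
      simp only [Matrix.mul_assoc]
    rw [this, conjTranspose_inc_mul_inc h, Matrix.mul_one, hMN, Matrix.mul_one]
    simp only [Matrix.zero_mul, Matrix.mul_zero, add_zero, zero_add]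
    exact proj₁_add_proj₂ v₁ v i
  ⟨inc v₁ v i * (g₁ i : Matrix (Fin (v₁ i)) (Fin (v₁ i)) ℂ) * (inc v₁ v i)ᴴ + proj₂ v₁ v i,
    inc v₁ v i * (((g₁ i)⁻¹ : GL (Fin (v₁ i)) ℂ) : Matrix (Fin (v₁ i)) (Fin (v₁ i)) ℂ) *
      (inc v₁ v i)ᴴ + proj₂ v₁ v i,
    key _ _ (by rw [← Units.val_mul, mul_inv_cancel]; rfl),
    key _ _ (by rw [← Units.val_mul, inv_mul_cancel]; rfl)⟩

theorem coe_extendGauge (h : v₁ ≤ v) (g₁ : Gauge v₁) (i : I) :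
    (extendGauge h g₁ i : Matrix (Fin (v i)) (Fin (v i)) ℂ) =
      inc v₁ v i * (g₁ i : Matrix (Fin (v₁ i)) (Fin (v₁ i)) ℂ) * (inc v₁ v i)ᴴ + proj₂ v₁ v i := rfl

theorem coe_extendGauge_inv (h : v₁ ≤ v) (g₁ : Gauge v₁) (i : I) :
    (((extendGauge h g₁ i)⁻¹ : GL (Fin (v i)) ℂ) : Matrix (Fin (v i)) (Fin (v i)) ℂ) =
      inc v₁ v i * (((g₁ i)⁻¹ : GL (Fin (v₁ i)) ℂ) : Matrix (Fin (v₁ i)) (Fin (v₁ i)) ℂ) *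
        (inc v₁ v i)ᴴ + proj₂ v₁ v i := rfl

theorem proj₂_mul_act_extendGauge (h : v₁ ≤ v) (g₁ : Gauge v₁) {x : Rep Q v}
    (hx : ∀ a, proj₂ v₁ v (Q.head a) * x a = 0) (a : E) :
    proj₂ v₁ v (Q.head a) * act (extendGauge h g₁) x a = 0 := by
  rw [act, coe_extendGauge, ← Matrix.mul_assoc, ← Matrix.mul_assoc, Matrix.mul_add,
    ← Matrix.mul_assoc, ← Matrix.mul_assoc, proj₂_mul_inc h, proj₂_mul_self h, Matrix.zero_mul,
    Matrix.zero_mul, zero_add, hx, Matrix.zero_mul]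

theorem restrict_act_extendGauge (h : v₁ ≤ v) (g₁ : Gauge v₁) (x : Rep Q v) :
    restrict h (act (extendGauge h g₁) x) = act g₁ (restrict h x) := by
  funext a
  have h1 : (inc v₁ v (Q.head a))ᴴ * (extendGauge h g₁ (Q.head a) :
        Matrix (Fin (v (Q.head a))) (Fin (v (Q.head a))) ℂ) =
      (g₁ (Q.head a) : Matrix (Fin (v₁ (Q.head a))) (Fin (v₁ (Q.head a))) ℂ) * (inc v₁ v (Q.head a))ᴴ := by
    rw [coe_extendGauge, Matrix.mul_add, conjTranspose_inc_mul_proj₂ h, add_zero,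
      ← Matrix.mul_assoc, ← Matrix.mul_assoc, conjTranspose_inc_mul_inc h, Matrix.one_mul]
  have h2 : (((extendGauge h g₁ (Q.tail a))⁻¹ : GL (Fin (v (Q.tail a))) ℂ) :
        Matrix (Fin (v (Q.tail a))) (Fin (v (Q.tail a))) ℂ) *
      inc v₁ v (Q.tail a) = inc v₁ v (Q.tail a) *
        (((g₁ (Q.tail a))⁻¹ : GL (Fin (v₁ (Q.tail a))) ℂ) :
        Matrix (Fin (v₁ (Q.tail a))) (Fin (v₁ (Q.tail a))) ℂ) := by
    rw [coe_extendGauge_inv, Matrix.add_mul, proj₂_mul_inc h, add_zero,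
      Matrix.mul_assoc, conjTranspose_inc_mul_inc h, Matrix.mul_one]
  rw [restrict_eq, act, act, restrict_eq, Matrix.mul_assoc, Matrix.mul_assoc _ _ (inc v₁ v _), h2]
  simp only [← Matrix.mul_assoc, h1]

/-- Up to the unipotent group `1 + Hom(V₂, V₁)`, an extension of the trivial representation `V₂`
by `x₁` differs from `(x₁, 0)` by an element of the slice. -/
theorem exists_gauge_orthogonal [Fintype E] [Fintype I] [DecidableEq I] (h : v₁ ≤ v) {x : Rep Q v}
    (hx : ∀ a, proj₂ v₁ v (Q.head a) * x a = 0) :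
    ∃ (g : Gauge v) (δ : Rep Q v), act g x = extend (restrict h x) + δ ∧
      sandwich (proj₁ v₁ v) (proj₂ v₁ v) δ = δ ∧
      ∀ u : GaugeLie v, metric (infAct (extend (restrict h x)) u) δ = 0 := by
  set A : Rep Q v := extend (restrict h x) with hA
  have hAx : ∀ a, A a = x a * proj₁ v₁ v (Q.tail a) := fun a => by
    rw [hA, extend_eq, ← mul_inc_of_proj₂_mul h hx, Matrix.mul_assoc, proj₁]
  obtain ⟨u₀, hu₀⟩ := exists_orthogonal_correction A (x - A)
  -- Only the `Hom(V₂, V₁)` block of the correction is kept. It squares to zero, which makes `1 + u`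
  -- invertible, and its effect on the orbit is affine.
  let u : GaugeLie v := fun i => proj₁ v₁ v i * u₀ i * proj₂ v₁ v i
  have hu1 : ∀ i {m : ℕ} (N : Matrix (Fin (v i)) (Fin m) ℂ), proj₂ v₁ v i * N = 0 → u i * N = 0 :=
    fun i m N hN => by simp only [u, Matrix.mul_assoc, hN, Matrix.mul_zero]
  have huu : ∀ i, u i * u i = 0 := fun i => hu1 i _ (by
    simp only [u, ← Matrix.mul_assoc, proj₂_mul_proj₁ h, Matrix.zero_mul])
  let g : Gauge v := fun i => ⟨1 + u i, 1 - u i,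
    by simp [Matrix.mul_sub, Matrix.add_mul, huu],
    by simp [Matrix.mul_add, Matrix.sub_mul, huu]⟩
  let δ : Rep Q v := sandwich (proj₁ v₁ v) (proj₂ v₁ v) (x - A + infAct A u₀)
  have hδ : ∀ a, δ a = x a - A a + (u (Q.head a) * A a - A a * u (Q.tail a)) := by
    intro a
    have h1 := congrFun (sandwich_infAct (proj₁_extend_comm h (restrict h x))
      (proj₂_extend_comm h (restrict h x)) u₀) a
    have h2 : proj₁ v₁ v (Q.head a) * (x a - A a) * proj₂ v₁ v (Q.tail a) = x a - A a := by
      rw [Matrix.mul_sub, proj₁_mul_of_proj₂_mul hx, hA, proj₁_mul_extend h, ← hA, Matrix.sub_mul,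
        hA, extend_mul_proj₂ h, sub_zero, ← hA, hAx, proj₂, Matrix.mul_sub, Matrix.mul_one]
    change proj₁ v₁ v (Q.head a) * (x a - A a + infAct A u₀ a) * proj₂ v₁ v (Q.tail a) = _
    rw [Matrix.mul_add, Matrix.add_mul, h2]
    congr 1
  refine ⟨g, δ, ?_, ?_, fun w => ?_⟩
  · funext a
    change (1 + u (Q.head a)) * x a * (1 - u (Q.tail a)) = A a + δ a
    have h1 : proj₂ v₁ v (Q.head a) * A a = 0 := proj₂_mul_extend h _ a
    -- The image of `u` lies in `V₁`, where `x` and `A` agree. Since `u` also kills `V₁`, acting by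
    -- `1 + u` just subtracts `A u`.
    have h3 : x a * u (Q.tail a) = A a * u (Q.tail a) := by
      simp only [hAx, u, Matrix.mul_assoc]
      rw [← Matrix.mul_assoc (proj₁ v₁ v _) (proj₁ v₁ v _), proj₁_mul_self h]
    rw [hδ, hu1 _ _ h1, Matrix.add_mul, hu1 _ _ (hx a), Matrix.one_mul, add_zero, Matrix.mul_sub,
      Matrix.mul_one, h3]
    abel
  · funext a
    simp only [δ, sandwich, ← Matrix.mul_assoc, proj₁_mul_self h]
    rw [Matrix.mul_assoc _ (proj₂ v₁ v _), proj₂_mul_self h]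
  · exact sandwich_orthogonal (proj₁_conjTranspose v₁ v) (proj₂_conjTranspose v₁ v)
      (proj₁_extend_comm h _) (proj₂_extend_comm h _) hu₀ w

end Invariant

/-! ### Naturality of the complex moment map -/

section ComplexMomentMap

variable {I : Type u} {E : Type w} [Fintype I] [DecidableEq I] [Fintype E] {Q : Quiv I E}
  {v₁ v : I → ℕ}

/-- Covers gauge action, extension and restriction at once. In a product of two arrows the inner
factor `G' G` meets an image of `x`, on which it is the identity, so it cancels. -/
theorem complexMomentMap_of_eq_mul_mul (G : ∀ i, Matrix (Fin (v i)) (Fin (v₁ i)) ℂ)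
    (G' : ∀ i, Matrix (Fin (v₁ i)) (Fin (v i)) ℂ) {x : Rep Q.double v₁} {y : Rep Q.double v}
    (hy : ∀ e, y e = G (Q.double.head e) * x e * G' (Q.double.tail e))
    (hG : ∀ e, G' (Q.double.head e) * G (Q.double.head e) * x e = x e) :
    complexMomentMap y =
      Matrix.blockDiagonal' G * complexMomentMap x * Matrix.blockDiagonal' G' := by
  have h1 : ∀ e, Matrix.blockDiagonal' G' * (Matrix.blockDiagonal' G *
      toEnd (i := Q.double.head e) (j := Q.double.tail e) (x e)) = toEnd (x e) := by
    intro e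
    rw [← Matrix.mul_assoc, ← Matrix.blockDiagonal'_mul,
      ← toEnd_mul_left (fun i => G' i * G i) (x e), hG]
  have h2 : ∀ e, toEnd (i := Q.double.head e) (j := Q.double.tail e) (y e) =
      Matrix.blockDiagonal' G * toEnd (x e) * Matrix.blockDiagonal' G' := fun e => by
    rw [hy, toEnd_mul_mul]
  have h3 : ∀ e e', toEnd (i := Q.double.head e) (j := Q.double.tail e) (y e) *
      toEnd (i := Q.double.head e') (j := Q.double.tail e') (y e') =
      Matrix.blockDiagonal' G * (toEnd (i := Q.double.head e) (j := Q.double.tail e) (x e) *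
        toEnd (i := Q.double.head e') (j := Q.double.tail e') (x e')) *
          Matrix.blockDiagonal' G' := fun e e' => by
    rw [h2, h2]
    simp only [Matrix.mul_assoc]
    rw [← Matrix.mul_assoc (Matrix.blockDiagonal' G) (toEnd (x e')),
      ← Matrix.mul_assoc (Matrix.blockDiagonal' G') (_ * _), h1]
  rw [complexMomentMap, complexMomentMap, Matrix.mul_sum, Matrix.sum_mul]
  refine Finset.sum_congr rfl fun a _ => ?_
  have h4 := h3 (Sum.inl a) (Sum.inr a)
  have h5 := h3 (Sum.inr a) (Sum.inl a)
  rw [comm, comm, Matrix.mul_sub, Matrix.sub_mul]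
  exact congrArg₂ (· - ·) h4 h5

theorem complexMomentMap_act {x : Rep Q.double v} (hx : complexMomentMap x = 0) (g : Gauge v) :
    complexMomentMap (act g x) = 0 := by
  rw [complexMomentMap_of_eq_mul_mul (fun i => (g i : Matrix (Fin (v i)) (Fin (v i)) ℂ))
    (fun i => (((g i)⁻¹ : GL (Fin (v i)) ℂ) : Matrix (Fin (v i)) (Fin (v i)) ℂ)) (x := x)
    (y := act g x) (fun e => rfl) fun e => by rw [← Units.val_mul, inv_mul_cancel]; simp, hx]
  simp

theorem complexMomentMap_extend (h : v₁ ≤ v) {x₁ : Rep Q.double v₁}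
    (hx : complexMomentMap x₁ = 0) : complexMomentMap (extend x₁ : Rep Q.double v) = 0 := by
  rw [complexMomentMap_of_eq_mul_mul (inc v₁ v) (fun i => (inc v₁ v i)ᴴ) (x := x₁)
    (extend_eq x₁) fun e => by rw [conjTranspose_inc_mul_inc h, Matrix.one_mul], hx]
  simp

theorem complexMomentMap_restrict (h : v₁ ≤ v) {x : Rep Q.double v}
    (hx : complexMomentMap x = 0)
    (hinv : ∀ a, proj₂ v₁ v (Q.double.head a) * x a = 0) :
    complexMomentMap (restrict h x) = 0 := by
  rw [complexMomentMap_of_eq_mul_mul (fun i => (inc v₁ v i)ᴴ) (inc v₁ v) (x := x)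
    (restrict_eq h x) (fun e => proj₁_mul_of_proj₂_mul hinv e), hx]
  simp

end ComplexMomentMap

/-! ### The images at a vertex -/

section ImageAt

variable {I : Type u} {E : Type w} {Q : Quiv I E} {v₁ v : I → ℕ}

/-- After substituting `k` by the head of the edge, the cast in this criterion is trivial; the later
arguments use it in this form. -/
theorem imageAt_le_iff {k : I} {x : Rep Q v} {U : Submodule ℂ (Fin (v k) → ℂ)} :
    imageAt k x ≤ U ↔ ∀ a (h : Q.head a = k) (w : Fin (v (Q.tail a)) → ℂ),
      (fun p => (x a *ᵥ w) (Fin.cast (congrArg v h.symm) p)) ∈ U := by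
  rw [imageAt, iSup_le_iff]
  refine forall_congr' fun a => ?_
  rw [iSup_le_iff]
  refine forall_congr' fun h => ?_
  rw [Submodule.map_le_iff_le_comap]
  constructor
  · exact fun h1 w => h1 ⟨w, rfl⟩
  · rintro h1 _ ⟨w, rfl⟩
    exact h1 w

theorem mulVec_mem_imageAt (x : Rep Q v) (a : E) (w : Fin (v (Q.tail a)) → ℂ) :
    x a *ᵥ w ∈ imageAt (Q.head a) x :=
  imageAt_le_iff.1 (le_refl (imageAt (Q.head a) x)) a rfl w

theorem map_imageAt_le (k : I) (g : Gauge v) (x : Rep Q v) :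
    (imageAt k x).map (g k : Matrix (Fin (v k)) (Fin (v k)) ℂ).mulVecLin ≤ imageAt k (act g x) := by
  rw [Submodule.map_le_iff_le_comap, imageAt_le_iff]
  rintro a rfl w
  refine Submodule.mem_comap.2 ?_
  change (g (Q.head a) : Matrix (Fin (v (Q.head a))) (Fin (v (Q.head a))) ℂ) *ᵥ (x a *ᵥ w) ∈
    imageAt (Q.head a) (act g x)
  have := mulVec_mem_imageAt (act g x) a
    ((g (Q.tail a) : Matrix (Fin (v (Q.tail a))) (Fin (v (Q.tail a))) ℂ) *ᵥ w)
  simpa [act, Matrix.mulVec_mulVec, Matrix.mul_assoc, ← Units.val_mul] using this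

theorem imageAt_act (k : I) (g : Gauge v) (x : Rep Q v) :
    imageAt k (act g x) =
      (imageAt k x).map (g k : Matrix (Fin (v k)) (Fin (v k)) ℂ).mulVecLin := by
  refine le_antisymm (fun y hy => ?_) (map_imageAt_le k g x)
  have h1 := map_imageAt_le k g⁻¹ (act g x) ⟨y, hy, rfl⟩
  rw [← act_mul, inv_mul_cancel, act_one] at h1
  refine ⟨_, h1, ?_⟩
  simp [Matrix.mulVec_mulVec, ← Units.val_mul]

theorem gauge_mulVec_injective (g : Gauge v) (k : I) :
    Function.Injective (g k : Matrix (Fin (v k)) (Fin (v k)) ℂ).mulVecLin := by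
  intro w w' hw
  have := congrArg (fun z => (((g k)⁻¹ : GL (Fin (v k)) ℂ) : Matrix (Fin (v k)) (Fin (v k)) ℂ)
    *ᵥ z) hw
  simpa [Matrix.mulVec_mulVec, ← Units.val_mul] using this

theorem finrank_imageAt_act (k : I) (g : Gauge v) (x : Rep Q v) :
    Module.finrank ℂ (imageAt k (act g x)) = Module.finrank ℂ (imageAt k x) := by
  rw [imageAt_act]
  exact (Submodule.equivMapOfInjective _ (gauge_mulVec_injective g k) _).finrank_eq.symm

theorem mem_range_inc_iff (i : I) (y : Fin (v i) → ℂ) :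
    y ∈ LinearMap.range (inc v₁ v i).mulVecLin ↔ ∀ j : Fin (v i), v₁ i ≤ (j : ℕ) → y j = 0 := by
  constructor
  · rintro ⟨w, rfl⟩ j hj
    rw [Matrix.mulVecLin_apply, Matrix.mulVec, dotProduct]
    refine Finset.sum_eq_zero fun r _ => ?_
    have : (j : ℕ) ≠ r := fun h => absurd r.2 (not_lt.2 (h ▸ hj))
    simp [inc, this]
  · intro hy
    refine ⟨(inc v₁ v i)ᴴ *ᵥ y, ?_⟩
    rw [Matrix.mulVecLin_apply, Matrix.mulVec_mulVec, ← proj₁, proj₁_eq]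
    funext j
    rw [Matrix.mulVec_diagonal]
    by_cases hj : (j : ℕ) < v₁ i
    · simp [hj]
    · simp [hj, hy j (not_lt.1 hj)]

theorem mem_range_inc_iff_proj₂ (h : v₁ ≤ v) (i : I) (y : Fin (v i) → ℂ) :
    y ∈ LinearMap.range (inc v₁ v i).mulVecLin ↔ proj₂ v₁ v i *ᵥ y = 0 := by
  constructor
  · rintro ⟨w, rfl⟩
    rw [Matrix.mulVecLin_apply, Matrix.mulVec_mulVec, proj₂_mul_inc h, Matrix.zero_mulVec]
  · intro hy
    refine ⟨(inc v₁ v i)ᴴ *ᵥ y, ?_⟩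
    rw [Matrix.mulVecLin_apply, Matrix.mulVec_mulVec, ← proj₁]
    have := congrArg (· *ᵥ y) (proj₁_add_proj₂ v₁ v i)
    simpa [Matrix.add_mulVec, hy] using this

theorem finrank_range_inc (h : v₁ ≤ v) (i : I) :
    Module.finrank ℂ (LinearMap.range (inc v₁ v i).mulVecLin) = v₁ i := by
  rw [LinearMap.finrank_range_of_inj (inc_mulVec_injective h i)]
  simp

end ImageAt

/-! ### Nakajima's projection -/

theorem exists_gl_map_eq {n : ℕ} {W W' : Submodule ℂ (Fin n → ℂ)}
    (h : Module.finrank ℂ W = Module.finrank ℂ W') :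
    ∃ g : GL (Fin n) ℂ, W.map (g : Matrix (Fin n) (Fin n) ℂ).mulVecLin = W' := by
  obtain ⟨U, hU⟩ := W.exists_isCompl
  obtain ⟨U', hU'⟩ := W'.exists_isCompl
  have h1 := Submodule.finrank_add_eq_of_isCompl hU
  have h2 := Submodule.finrank_add_eq_of_isCompl hU'
  let e₁ : W ≃ₗ[ℂ] W' := LinearEquiv.ofFinrankEq _ _ h
  let e₂ : U ≃ₗ[ℂ] U' := LinearEquiv.ofFinrankEq _ _ (by omega)
  let e : (Fin n → ℂ) ≃ₗ[ℂ] (Fin n → ℂ) := (Submodule.prodEquivOfIsCompl W U hU).symm ≪≫ₗ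
    (e₁.prodCongr e₂) ≪≫ₗ Submodule.prodEquivOfIsCompl W' U' hU'
  have he : ∀ w : W, e w = e₁ w := fun w => by
    simp [e]
  let g : GL (Fin n) ℂ := ⟨LinearMap.toMatrix' e.toLinearMap, LinearMap.toMatrix' e.symm.toLinearMap,
    by rw [← LinearMap.toMatrix'_comp]; simp, by rw [← LinearMap.toMatrix'_comp]; simp⟩
  have hg : ∀ w, (g : Matrix (Fin n) (Fin n) ℂ).mulVecLin w = e w := fun w =>
    LinearMap.toMatrix'_mulVec e.toLinearMap w
  refine ⟨g, le_antisymm ?_ fun y hy => ?_⟩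
  · rintro _ ⟨w, hw, rfl⟩
    rw [hg, he ⟨w, hw⟩]
    exact (e₁ ⟨w, hw⟩).2
  · refine ⟨e₁.symm ⟨y, hy⟩, (e₁.symm ⟨y, hy⟩).2, ?_⟩
    rw [hg, he, LinearEquiv.apply_symm_apply]

section Projection

variable {I : Type u} {E : Type w} [DecidableEq I] {Q : Quiv I E} {v : I → ℕ}

theorem toOrbit_eq_iff {x y : Rep Q v} : toOrbit x = toOrbit y ↔ ∃ g : Gauge v, act g x = y :=
  Quotient.eq (r := orbitSetoid Q v)

theorem lower_self (v : I → ℕ) (k : I) (r : ℕ) : lower v k r k = v k - r := by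
  simp [lower]

theorem lower_of_ne (v : I → ℕ) {k i : I} (h : i ≠ k) (r : ℕ) : lower v k r i = v i := by
  simp [lower, h]

theorem isAdapted_iff_le {k : I} {r : ℕ} {x : Rep Q.double v} :
    IsAdapted k r x ↔ imageAt k x ≤ LinearMap.range (inc (lower v k r) v k).mulVecLin := by
  refine forall₂_congr fun y _ => ?_
  rw [mem_range_inc_iff, lower_self]

/-- Away from `k` the complement of `V₁` is zero, so the condition at `k` is the same as all arrows
having image in `V₁`. -/
theorem isAdapted_iff {k : I} {r : ℕ} {x : Rep Q.double v} :
    IsAdapted k r x ↔ ∀ a, proj₂ (lower v k r) v (Q.double.head a) * x a = 0 := by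
  rw [isAdapted_iff_le, imageAt_le_iff]
  constructor
  · intro h a
    by_cases ha : Q.double.head a = k
    · subst ha
      refine Matrix.toLin'.injective (LinearMap.ext fun w => ?_)
      have := (mem_range_inc_iff_proj₂ (lower_le v _ r) _ _).1 (h a rfl w)
      simpa [Matrix.mulVec_mulVec] using this
    · rw [proj₂_eq_zero (lower_of_ne v ha r), Matrix.zero_mul]
  · rintro h a rfl w
    refine (mem_range_inc_iff_proj₂ (lower_le v _ r) _ _).2 ?_
    change proj₂ (lower v (Q.double.head a) r) v (Q.double.head a) *ᵥ (x a *ᵥ w) = 0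
    rw [Matrix.mulVec_mulVec, h, Matrix.zero_mulVec]

theorem exists_gauge_isAdapted {k : I} {r : ℕ} {x : Rep Q.double v}
    (hx : Module.finrank ℂ (imageAt k x) + r = v k) :
    ∃ g : Gauge v, IsAdapted k r (act g x) := by
  obtain ⟨gk, hgk⟩ := exists_gl_map_eq (W := imageAt k x)
    (W' := LinearMap.range (inc (lower v k r) v k).mulVecLin)
    (by rw [finrank_range_inc (lower_le v k r), lower_self]; omega)
  refine ⟨Function.update 1 k gk, ?_⟩
  rw [isAdapted_iff_le, imageAt_act, Function.update_self, hgk]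

theorem IsAdapted.imageAt_eq {k : I} {r : ℕ} {x : Rep Q.double v} (h : IsAdapted k r x)
    (hx : Module.finrank ℂ (imageAt k x) + r = v k) :
    imageAt k x = LinearMap.range (inc (lower v k r) v k).mulVecLin := by
  refine Submodule.eq_of_le_of_finrank_eq (isAdapted_iff_le.1 h) ?_
  rw [finrank_range_inc (lower_le v k r), lower_self]
  omega

/-- In codimension `r` the image at `k` is all of `V_k'`. A gauge transformation between adapted
representatives therefore preserves `V_k'`, and so acts on the restrictions. -/
theorem proj₂_mul_gauge_mul_inc {k : I} {r : ℕ} {x : Rep Q.double v} {g : Gauge v}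
    (h : IsAdapted k r x) (hg : IsAdapted k r (act g x))
    (hx : Module.finrank ℂ (imageAt k x) + r = v k) (i : I) :
    proj₂ (lower v k r) v i * (g i : Matrix (Fin (v i)) (Fin (v i)) ℂ) *
      inc (lower v k r) v i = 0 := by
  by_cases hi : i = k
  · subst hi
    refine Matrix.toLin'.injective (LinearMap.ext fun w => ?_)
    have h1 : inc (lower v i r) v i *ᵥ w ∈ imageAt i x := by
      rw [h.imageAt_eq hx]
      exact ⟨w, rfl⟩
    have h2 := isAdapted_iff_le.1 hg (map_imageAt_le i g x ⟨_, h1, rfl⟩)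
    rw [mem_range_inc_iff_proj₂ (lower_le v _ r)] at h2
    simpa [Matrix.mulVec_mulVec, Matrix.mul_assoc] using h2
  · rw [proj₂_eq_zero (lower_of_ne v hi r), Matrix.zero_mul, Matrix.zero_mul]

theorem toOrbit_restrict_eq {k : I} {r : ℕ} {x y : Rep Q.double v}
    (hxy : toOrbit x = toOrbit y) (h : IsAdapted k r x) (h' : IsAdapted k r y)
    (hx : Module.finrank ℂ (imageAt k x) + r = v k) :
    toOrbit (restrict (lower_le v k r) x) = toOrbit (restrict (lower_le v k r) y) := by
  obtain ⟨g, rfl⟩ := toOrbit_eq_iff.1 hxy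
  rw [toOrbit_eq_iff]
  refine exists_act_restrict_eq (lower_le v k r) (isAdapted_iff.1 h)
    (proj₂_mul_gauge_mul_inc h h' hx) fun i => ?_
  refine proj₂_mul_gauge_mul_inc (g := g⁻¹) h' ?_ ?_ i
  · rwa [← act_mul, inv_mul_cancel, act_one]
  · rwa [finrank_imageAt_act]

theorem nakajimaProj_eq {k : I} {r : ℕ} {x : Rep Q.double v} (h : IsAdapted k r x)
    (hx : Module.finrank ℂ (imageAt k x) + r = v k) :
    nakajimaProj k r (toOrbit x) = toOrbit (restrict (lower_le v k r) x) := by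
  have hex : ∃ y : Rep Q.double v, toOrbit y = toOrbit x ∧ IsAdapted k r y := ⟨x, rfl, h⟩
  rw [nakajimaProj, dif_pos hex]
  exact (toOrbit_restrict_eq hex.choose_spec.1.symm h hex.choose_spec.2 hx).symm

/-- Without loops the tail of an arrow into `k` is a different vertex, where restriction loses
nothing. The restricted arrows thus have the same images, and these span `V_k'`. -/
theorem imageAt_restrict_eq_top (hloop : ∀ a : E, Q.head a ≠ Q.tail a) {k : I} {r : ℕ}
    {x : Rep Q.double v} (h : IsAdapted k r x)
    (hx : Module.finrank ℂ (imageAt k x) + r = v k) :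
    imageAt k (restrict (lower_le v k r) x) = ⊤ := by
  have hloop' : ∀ a, Q.double.tail a ≠ Q.double.head a := by
    rintro (a | a)
    · exact (hloop a).symm
    · exact hloop a
  have h1 : imageAt k x ≤ (imageAt k (restrict (lower_le v k r) x)).map
      (inc (lower v k r) v k).mulVecLin := by
    rw [imageAt_le_iff]
    rintro a rfl w
    refine ⟨_, mulVec_mem_imageAt (restrict (lower_le v _ r) x) a
      ((inc (lower v (Q.double.head a) r) v (Q.double.tail a))ᴴ *ᵥ w), ?_⟩
    have h2 : proj₁ (lower v (Q.double.head a) r) v (Q.double.tail a) = 1 := by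
      have := proj₁_add_proj₂ (lower v (Q.double.head a) r) v (Q.double.tail a)
      rwa [proj₂_eq_zero (lower_of_ne v (hloop' a) r), add_zero] at this
    rw [Matrix.mulVecLin_apply, Matrix.mulVec_mulVec, Matrix.mulVec_mulVec,
      ← mul_inc_of_proj₂_mul (lower_le v _ r) (isAdapted_iff.1 h), Matrix.mul_assoc, ← proj₁, h2,
      Matrix.mul_one]
    rfl
  rw [eq_top_iff]
  intro y _
  have h3 : (inc (lower v k r) v k).mulVecLin y ∈ imageAt k x := by
    rw [h.imageAt_eq hx]
    exact ⟨y, rfl⟩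
  obtain ⟨z, hz, hzy⟩ := h1 h3
  rwa [← inc_mulVec_injective (lower_le v k r) k hzy]

variable [Fintype I] [Fintype E]

theorem toOrbit_mem_quiverVariety_iff {o : I} (hv : v o = 1) {x : Rep Q.double v} :
    toOrbit x ∈ quiverVariety Q o v ↔ complexMomentMap x = 0 ∧ Costable o x := by
  constructor
  · rintro ⟨y, hyx, hy, hst⟩
    obtain ⟨g, rfl⟩ := toOrbit_eq_iff.1 hyx
    exact ⟨complexMomentMap_act hy g, ((isStable_iff_costable hv).1 hst).gauge g⟩
  · exact fun h => ⟨x, rfl, h.1, (isStable_iff_costable hv).2 h.2⟩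

/-- Codimension is stated additively, which forces `r ≤ v k` and makes the truncated subtraction in
`lower` harmless. -/
theorem toOrbit_mem_quiverStratum_iff {o : I} (hv : v o = 1) {k : I} {r : ℕ}
    {x : Rep Q.double v} : toOrbit x ∈ quiverStratum Q o v k r ↔ complexMomentMap x = 0 ∧
      Costable o x ∧ Module.finrank ℂ (imageAt k x) + r = v k := by
  have hq : ∀ y : Rep Q.double v, Module.finrank ℂ ((Fin (v k) → ℂ) ⧸ imageAt k y) +
      Module.finrank ℂ (imageAt k y) = v k := fun y => by
    rw [Submodule.finrank_quotient_add_finrank, Module.finrank_fin_fun]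
  rw [← and_assoc, ← toOrbit_mem_quiverVariety_iff hv]
  refine and_congr_right fun _ => ⟨?_, fun h => ⟨x, rfl, ?_⟩⟩
  · rintro ⟨y, hyx, hy⟩
    obtain ⟨g, rfl⟩ := toOrbit_eq_iff.1 hyx
    have := hq y
    rw [finrank_imageAt_act]
    omega
  · have := hq x
    omega

theorem nakajimaProj_mem (hloop : ∀ a : E, Q.head a ≠ Q.tail a) {o : I} (hv : v o = 1) {k : I}
    (hk : k ≠ o) {r : ℕ} {x : Rep Q.double v} (hx : toOrbit x ∈ quiverStratum Q o v k r)
    (h : IsAdapted k r x) :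
    toOrbit (restrict (lower_le v k r) x) ∈ quiverStratum Q o (lower v k r) k 0 := by
  obtain ⟨h1, h2, h3⟩ := (toOrbit_mem_quiverStratum_iff hv).1 hx
  rw [toOrbit_mem_quiverStratum_iff (by rw [lower_of_ne v hk.symm, hv])]
  refine ⟨complexMomentMap_restrict (lower_le v k r) h1 (isAdapted_iff.1 h),
    h2.restrict _ (isAdapted_iff.1 h), ?_⟩
  rw [imageAt_restrict_eq_top hloop h h3, finrank_top, Module.finrank_fin_fun, add_zero]

/-! ### Approximate flow lines -/

/-- An approximate flow line exhibits its lower end point as a restriction of its upper one. -/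
theorem exists_isAdapted_of_mem_flowModuli {o : I} (hv : v o = 1) {k : I} (hk : k ≠ o) {r : ℕ}
    {c₀ : Orbits Q.double (lower v k r)} {c : Orbits Q.double v}
    (h : (c₀, c) ∈ flowModuli Q o (lower v k r) v) :
    ∃ x : Rep Q.double v, toOrbit x = c ∧ IsAdapted k r x ∧
      toOrbit (restrict (lower_le v k r) x) = c₀ := by
  obtain ⟨-, -, x₁, x₂, hx₁, hx₂, ⟨-, hcrit, y₁, hy₁, hst⟩, -, δ, ⟨hneg, horth, -⟩, hδ⟩ := h
  have hle := lower_le v k r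
  have ho : lower v k r o = v o := lower_of_ne v hk.symm r
  have hxy : x₁ = y₁ := by
    have := congrArg (restrict hle) hy₁
    rwa [restrict_extend, restrict_extend] at this
  subst hxy
  obtain ⟨c, hc, hd⟩ := ((isStable_iff_costable (ho.trans hv)).1 hst).exists_defectLie_extend_eq hv
    hle ho hcrit
  -- Once `δ` maps `V₂` to `V₁`, the point `extend x₁ + δ` has all its images in `V₁`, and `δ` is
  -- invisible to the restriction.
  have hs := sandwich_eq_self_of_mem_negSpace hle hc hd horth hneg
  refine ⟨extend x₁ + δ, hδ.trans hx₂, ?_, ?_⟩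
  · rw [isAdapted_iff]
    intro a
    rw [← hs, Pi.add_apply, Matrix.mul_add, proj₂_mul_extend hle, sandwich, ← Matrix.mul_assoc,
      ← Matrix.mul_assoc, proj₂_mul_proj₁ hle, Matrix.zero_mul, Matrix.zero_mul, add_zero]
  · refine Eq.trans ?_ hx₁
    rw [restrict_add, restrict_extend, ← hs]
    have : restrict hle (sandwich (proj₁ (lower v k r) v) (proj₂ (lower v k r) v) δ) = 0 := by
      funext a
      rw [restrict_eq, sandwich, Matrix.mul_assoc, Matrix.mul_assoc _ (proj₂ _ _ _),
        proj₂_mul_inc hle, Matrix.mul_zero, Matrix.mul_zero]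
      rfl
    rw [this, add_zero]

/-- Nakajima's projection of a class and the class are connected by an approximate flow line. -/
theorem mem_flowModuli_of_isAdapted {o : I} (hv : v o = 1) {k : I} (hk : k ≠ o) {r : ℕ}
    {x : Rep Q.double v} (hx : toOrbit x ∈ quiverVariety Q o v) (h : IsAdapted k r x) :
    (toOrbit (restrict (lower_le v k r) x), toOrbit x) ∈ flowModuli Q o (lower v k r) v := by
  have hle := lower_le v k r
  have ho : lower v k r o = v o := lower_of_ne v hk.symm r
  obtain ⟨hμ, hst⟩ := (toOrbit_mem_quiverVariety_iff hv).1 hx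
  have hinv := isAdapted_iff.1 h
  have hst₁ : Costable o (restrict hle x) := hst.restrict hle hinv
  have hμ₁ := complexMomentMap_restrict hle hμ hinv
  have hpos : ∀ f : I → ℕ, f o = 1 → 0 < ∑ i, (f i : ℝ) := fun f hf =>
    Finset.sum_pos' (fun i _ => by positivity) ⟨o, Finset.mem_univ o, by rw [hf]; simp⟩
  -- The restriction is moved to a solution for the parameter induced on `V₁` by `α(Q, v)`, namely
  -- `α(Q, v₁)` times the ratio of total dimensions.
  obtain ⟨g₁, hg₁⟩ := hst₁.exists_crossMoment_eq (ho.trans hv)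
    (div_pos (hpos v hv) (hpos _ (ho.trans hv)))
  set x₁ := act g₁ (restrict hle x) with hx₁
  have hcrit := isCritical_extend_of_crossMoment hv hle ho hg₁
  set y := act (extendGauge hle g₁) x with hy
  have hyr : restrict hle y = x₁ := restrict_act_extendGauge hle g₁ x
  obtain ⟨g, δ, hgδ, hsδ, hδ⟩ := exists_gauge_orthogonal hle (proj₂_mul_act_extendGauge hle g₁ hinv)
  rw [← hy, hyr] at hgδ
  rw [← hy, hyr] at hδ
  have hst₁' : Costable o x₁ := hst₁.gauge g₁
  have hμ₁' : complexMomentMap x₁ = 0 := complexMomentMap_act hμ₁ g₁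
  obtain ⟨c, hc, hd⟩ := hst₁'.exists_defectLie_extend_eq hv hle ho hcrit
  -- The upper end point is a zero of the energy in the orbit of `x`; its criticality is the case
  -- `v₁ = v` with scale factor `1`.
  obtain ⟨g₂, hg₂⟩ := hst.exists_crossMoment_eq hv one_pos
  have hcrit₂ : IsCritical (canonicalParam o v) (extend (act g₂ x) : Rep Q.double v) := by
    refine isCritical_extend_of_crossMoment hv le_rfl rfl ?_
    rw [hg₂, div_self (hpos v hv).ne']
  have hx₁o : toOrbit x₁ = toOrbit (restrict hle x) := (toOrbit_eq_iff.2 ⟨g₁, rfl⟩).symm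
  have hx₂o : toOrbit (act g₂ x) = toOrbit x := (toOrbit_eq_iff.2 ⟨g₂, rfl⟩).symm
  have hAo : toOrbit (extend x₁ + δ) = toOrbit x := by
    rw [← hgδ, hy, ← act_mul]
    exact (toOrbit_eq_iff.2 ⟨_, rfl⟩).symm
  refine ⟨?_, hx, x₁, act g₂ x, hx₁o, hx₂o, ⟨complexMomentMap_extend hle hμ₁', hcrit, x₁, rfl,
    (isStable_iff_costable (ho.trans hv)).2 hst₁'⟩, ⟨complexMomentMap_act hμ g₂, ?_, act g₂ x,
    (extend_self _).symm, (isStable_iff_costable hv).2 (hst.gauge g₂)⟩, δ, ⟨?_, hδ, ?_⟩,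
    hAo.trans hx₂o.symm⟩
  · exact (toOrbit_mem_quiverVariety_iff (ho.trans hv)).2 ⟨hμ₁, hst₁⟩
  · rwa [extend_self] at hcrit₂
  · have := sandwich_mem_negSpace hle hc hd hδ
    rwa [hsδ] at this
  · change complexMomentMap (extend x₁ + δ) = 0
    rw [← hgδ]
    exact complexMomentMap_act (complexMomentMap_act hμ _) g

end Projection

/-! ### Continuity of Nakajima's projection -/

section Continuity

variable {I : Type u} {E : Type w} {Q : Quiv I E} {v : I → ℕ}

theorem continuousAt_matrix_mul {X l m n : Type*} [TopologicalSpace X] [Fintype m]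
    {A : X → Matrix l m ℂ} {B : X → Matrix m n ℂ} {x : X} (hA : ContinuousAt A x)
    (hB : ContinuousAt B x) : ContinuousAt (fun y => A y * B y) x :=
  (continuous_fst.matrix_mul continuous_snd).continuousAt.comp (hA.prodMk hB)

theorem continuous_act (g : Gauge v) : Continuous fun x : Rep Q v => act g x := by
  unfold act
  fun_prop

theorem continuous_toOrbit : Continuous (toOrbit : Rep Q v → Orbits Q v) :=
  continuous_quotient_mk'

/-- The saturation of an open set is the union of its translates, as for every group acting by
homeomorphisms. -/
theorem isOpenMap_toOrbit : IsOpenMap (toOrbit : Rep Q v → Orbits Q v) := by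
  intro U hU
  have h : (toOrbit : Rep Q v → Orbits Q v) ⁻¹' (toOrbit '' U) =
      ⋃ g : Gauge v, (fun x => act g x) ⁻¹' U := by
    ext x
    simp only [Set.mem_preimage, Set.mem_image, Set.mem_iUnion]
    constructor
    · rintro ⟨y, hy, hyx⟩
      obtain ⟨g, hg⟩ : ∃ g : Gauge v, act g x = y := Quotient.exact hyx.symm
      exact ⟨g, hg ▸ hy⟩
    · rintro ⟨g, hg⟩
      exact ⟨_, hg, (Quotient.sound ⟨g, rfl⟩ : toOrbit x = toOrbit (act g x)).symm⟩
  have h2 : IsOpen ((toOrbit : Rep Q v → Orbits Q v) ⁻¹' (toOrbit '' U)) := by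
    rw [h]
    exact isOpen_iUnion fun g => hU.preimage (continuous_act g)
  exact isQuotientMap_quotient_mk'.isOpen_preimage.1 h2

theorem continuous_restrict {v₁ : I → ℕ} (h : v₁ ≤ v) :
    Continuous fun x : Rep Q v => restrict h x := by
  unfold restrict
  fun_prop

/-- A vector in `∑_{h(a) = k} im x_a` extends to a continuous family. -/
theorem exists_continuous_mem_imageAt {k : I} {x₀ : Rep Q v} {y : Fin (v k) → ℂ}
    (hy : y ∈ imageAt k x₀) : ∃ f : Rep Q v → Fin (v k) → ℂ,
      Continuous f ∧ (∀ x, f x ∈ imageAt k x) ∧ f x₀ = y := by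
  let U : Submodule ℂ (Fin (v k) → ℂ) :=
    { carrier := {y | ∃ f : Rep Q v → Fin (v k) → ℂ,
        Continuous f ∧ (∀ x, f x ∈ imageAt k x) ∧ f x₀ = y}
      add_mem' := by
        rintro _ _ ⟨f, hf, hfm, rfl⟩ ⟨f', hf', hfm', rfl⟩
        exact ⟨fun x => f x + f' x, hf.add hf', fun x => add_mem (hfm x) (hfm' x), rfl⟩
      zero_mem' := ⟨fun _ => 0, continuous_const, fun x => zero_mem _, rfl⟩
      smul_mem' := by
        rintro c _ ⟨f, hf, hfm, rfl⟩
        exact ⟨fun x => c • f x, hf.const_smul c, fun x => Submodule.smul_mem _ c (hfm x), rfl⟩ }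
  -- The generators `x₀ a *ᵥ w` extend to the families `x a *ᵥ w` with `w` fixed.
  have hU : imageAt k x₀ ≤ U := by
    rw [imageAt_le_iff]
    rintro a rfl w
    exact ⟨fun x => x a *ᵥ w, by fun_prop, fun x => mulVec_mem_imageAt x a w, rfl⟩
  exact hU hy

variable [DecidableEq I]

/-- The columns that span `V_k'` are continued inside the varying images and the others are kept
constant. Only an inclusion results, since the rank may jump off the stratum. -/
theorem exists_continuous_frame {k : I} {r : ℕ} {x₀ : Rep Q.double v} (h : IsAdapted k r x₀)
    (hx₀ : Module.finrank ℂ (imageAt k x₀) + r = v k) :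
    ∃ m : Rep Q.double v → Matrix (Fin (v k)) (Fin (v k)) ℂ, Continuous m ∧ m x₀ = 1 ∧
      ∀ x, (LinearMap.range (inc (lower v k r) v k).mulVecLin).map (m x).mulVecLin ≤
        imageAt k x := by
  have hcol : ∀ j : Fin (v k), ∃ f : Rep Q.double v → Fin (v k) → ℂ, Continuous f ∧
      ((j : ℕ) < lower v k r k → ∀ x, f x ∈ imageAt k x) ∧ f x₀ = Pi.single j 1 := by
    intro j
    by_cases hj : (j : ℕ) < lower v k r k
    · have hmem : Pi.single j 1 ∈ imageAt k x₀ := by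
        rw [h.imageAt_eq hx₀, mem_range_inc_iff]
        intro i hi
        have : i ≠ j := by
          rintro rfl
          exact absurd hj (not_lt.2 hi)
        simp [this]
      obtain ⟨f, hf, hfm, hf0⟩ := exists_continuous_mem_imageAt hmem
      exact ⟨f, hf, fun _ => hfm, hf0⟩
    · exact ⟨fun _ => Pi.single j 1, continuous_const, fun h => absurd h hj, rfl⟩
  choose f hfc hfm hf0 using hcol
  refine ⟨fun x => Matrix.of fun p j => f j x p, ?_, ?_, fun x => ?_⟩
  · exact continuous_pi fun p => continuous_pi fun j => (continuous_apply p).comp (hfc j)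
  · ext p j
    simp [hf0, Pi.single_apply, Matrix.one_apply]
  · rintro _ ⟨z, hz, rfl⟩
    have hz' := (mem_range_inc_iff k z).1 hz
    have hsum : (Matrix.of fun p j => f j x p).mulVecLin z = ∑ j, z j • f j x := by
      funext p
      simp [Matrix.mulVec, dotProduct, mul_comm]
    rw [hsum]
    refine Submodule.sum_mem _ fun j _ => ?_
    by_cases hj : (j : ℕ) < lower v k r k
    · exact Submodule.smul_mem _ _ (hfm j hj x)
    · rw [hz' j (not_lt.1 hj), zero_smul]
      exact zero_mem _

/-- On the stratum the dimensions agree, so the inclusion provided by a frame is an equality. -/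
theorem isAdapted_act_of_frame {k : I} {r : ℕ} {x : Rep Q.double v}
    (hx : Module.finrank ℂ (imageAt k x) + r = v k) {g : Gauge v}
    (hg : (LinearMap.range (inc (lower v k r) v k).mulVecLin).map
      (((g k)⁻¹ : GL (Fin (v k)) ℂ) : Matrix (Fin (v k)) (Fin (v k)) ℂ).mulVecLin ≤
        imageAt k x) : IsAdapted k r (act g x) := by
  have heq := Submodule.eq_of_le_of_finrank_eq hg (by
    refine (Submodule.equivMapOfInjective _ (gauge_mulVec_injective g⁻¹ k) _).finrank_eq.symm.trans ?_
    rw [finrank_range_inc (lower_le v k r), lower_self]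
    omega)
  rw [isAdapted_iff_le, imageAt_act, ← heq]
  rintro _ ⟨_, ⟨z, hz, rfl⟩, rfl⟩
  simpa [Matrix.mulVec_mulVec, ← Units.val_mul] using hz

variable [Fintype I] [Fintype E]

theorem exists_isAdapted {o : I} (hv : v o = 1) {k : I} {r : ℕ} {c : Orbits Q.double v}
    (hc : c ∈ quiverStratum Q o v k r) :
    ∃ x : Rep Q.double v, toOrbit x = c ∧ IsAdapted k r x := by
  obtain ⟨x, rfl⟩ : ∃ x : Rep Q.double v, toOrbit x = c := Quotient.exists_rep c
  obtain ⟨g, hg⟩ := exists_gauge_isAdapted ((toOrbit_mem_quiverStratum_iff hv).1 hc).2.2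
  exact ⟨act g x, (toOrbit_eq_iff.2 ⟨g, rfl⟩).symm, hg⟩

/-- Near a point of the stratum, the inverse of a continuous frame makes representatives adapted in
a continuous way, and `p` becomes the continuous map `restrict`. -/
theorem continuousOn_nakajimaProj {o : I} (hv : v o = 1) (k : I) (r : ℕ) :
    ContinuousOn (nakajimaProj (Q := Q) (v := v) k r) (quiverStratum Q o v k r) := by
  intro c hc
  obtain ⟨x₀, rfl, h₀⟩ := exists_isAdapted hv hc
  have hrank := ((toOrbit_mem_quiverStratum_iff hv).1 hc).2.2
  obtain ⟨m, hm, hm0, hmem⟩ := exists_continuous_frame h₀ hrank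
  let M : Rep Q.double v → GaugeLie v := fun x => Function.update 1 k (m x)
  have hM : Continuous M := continuous_const.update k hm
  have hMi : ∀ i, Continuous fun x => M x i := fun i => (continuous_apply i).comp hM
  have hM0 : M x₀ = 1 := by simp only [M, hm0]; exact Function.update_eq_self k (1 : GaugeLie v)
  have hdet : ∀ i x, (m x).det ≠ 0 → (M x i).det ≠ 0 := by
    intro i x hx
    by_cases hi : i = k
    · subst hi
      simpa [M] using hx
    · simp [M, hi]
  -- This is the action of `(M x)⁻¹`, written with the total matrix inverse; it is a gauge transform
  -- of `x` wherever `m x` is invertible.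
  let R : Rep Q.double v → Rep Q.double v := fun x a =>
    (M x (Q.double.head a))⁻¹ * x a * M x (Q.double.tail a)
  have hR : ContinuousAt R x₀ := by
    refine continuousAt_pi.2 fun a => ?_
    have h1 : ContinuousAt (fun x => (M x (Q.double.head a))⁻¹) x₀ :=
      continuousAt_matrix_inv (hMi _).continuousAt (by simp [hM0])
    exact continuousAt_matrix_mul (continuousAt_matrix_mul h1 (continuous_apply a).continuousAt)
      (hMi _).continuousAt
  have hR0 : R x₀ = x₀ := by
    funext a
    simp [R, hM0]
  have hproj : ∀ x, toOrbit x ∈ quiverStratum Q o v k r → (m x).det ≠ 0 →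
      nakajimaProj k r (toOrbit x) = toOrbit (restrict (lower_le v k r) (R x)) := by
    intro x hx hd
    have hxr := ((toOrbit_mem_quiverStratum_iff hv).1 hx).2.2
    let g : Gauge v := fun i => (Matrix.GeneralLinearGroup.mkOfDetNeZero _ (hdet i x hd))⁻¹
    have hgi : ∀ i, (((g i)⁻¹ : GL (Fin (v i)) ℂ) : Matrix (Fin (v i)) (Fin (v i)) ℂ) = M x i :=
      fun i => by simp only [g, inv_inv]; rfl
    have hg : ∀ i, (g i : Matrix (Fin (v i)) (Fin (v i)) ℂ) = (M x i)⁻¹ := fun i => by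
      rw [← hgi i, ← Matrix.coe_units_inv, inv_inv]
    have hact : act g x = R x := by
      funext a
      simp only [act, hgi, hg, R]
    have had : IsAdapted k r (act g x) := by
      refine isAdapted_act_of_frame hxr ?_
      rw [hgi]
      simpa [M] using hmem x
    have hox : toOrbit x = toOrbit (act g x) := toOrbit_eq_iff.2 ⟨g, rfl⟩
    rw [hox, nakajimaProj_eq had (by rwa [finrank_imageAt_act]), hact]
  have hval : nakajimaProj k r (toOrbit x₀) = toOrbit (restrict (lower_le v k r) (R x₀)) := by
    rw [hR0, nakajimaProj_eq h₀ hrank]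
  have hcont : ContinuousAt (fun x => toOrbit (restrict (lower_le v k r) (R x))) x₀ :=
    (continuous_toOrbit.comp (continuous_restrict _)).continuousAt.comp hR
  intro V hV
  rw [hval] at hV
  have h1 : {x | toOrbit (restrict (lower_le v k r) (R x)) ∈ V ∧ (m x).det ≠ 0} ∈ nhds x₀ := by
    refine Filter.inter_mem (hcont hV) ?_
    exact (hm.matrix_det.continuousAt (x := x₀)).eventually_ne (by simp [hm0])
  -- Openness turns a neighbourhood of the representative into one of its class, so every nearby
  -- class has a representative near `x₀`.
  have h2 := isOpenMap_toOrbit.image_mem_nhds h1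
  rw [Filter.mem_map]
  filter_upwards [mem_nhdsWithin_of_mem_nhds h2, self_mem_nhdsWithin] with c' hc' hcS
  obtain ⟨x, ⟨hx, hd⟩, rfl⟩ := hc'
  change nakajimaProj k r (toOrbit x) ∈ V
  rw [hproj x hcS hd]
  exact hx

end Continuity

end NakajimaFlow

end

open NakajimaFlow in
theorem proposition4p12 {I : Type*} {E : Type*} [Fintype I] [DecidableEq I] [Fintype E]
    (Q : NakajimaFlow.Quiv I E) (hloop : ∀ a : E, Q.head a ≠ Q.tail a)
    (o : I) (v : I → ℕ) (hv : v o = 1) (k : I) (hk : k ≠ o) (r : ℕ) :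
    -- Nakajima's projection `p` is defined on `𝓜_{k;r}(Q, v)`, independently of the
    -- representative, and has values in `𝓜_{k;0}(Q, v - r e_k)`
    (∀ c ∈ NakajimaFlow.quiverStratum Q o v k r,
      (∃ x, NakajimaFlow.toOrbit x = c ∧ NakajimaFlow.IsAdapted k r x) ∧
      (∀ x, NakajimaFlow.toOrbit x = c → NakajimaFlow.IsAdapted k r x →
        NakajimaFlow.nakajimaProj k r c =
          NakajimaFlow.toOrbit (NakajimaFlow.restrict (NakajimaFlow.lower_le v k r) x)) ∧
      NakajimaFlow.nakajimaProj k r c ∈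
        NakajimaFlow.quiverStratum Q o (NakajimaFlow.lower v k r) k 0) ∧
    -- existence and uniqueness of `[x₀]`, and `[x₀] = p([x])`
    (∀ c ∈ NakajimaFlow.quiverStratum Q o v k r,
      (∃! c₀, c₀ ∈ NakajimaFlow.quiverStratum Q o (NakajimaFlow.lower v k r) k 0 ∧
        (c₀, c) ∈ NakajimaFlow.flowModuli Q o (NakajimaFlow.lower v k r) v) ∧
      ∀ c₀ ∈ NakajimaFlow.quiverStratum Q o (NakajimaFlow.lower v k r) k 0,
        (c₀, c) ∈ NakajimaFlow.flowModuli Q o (NakajimaFlow.lower v k r) v →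
          c₀ = NakajimaFlow.nakajimaProj k r c) ∧
    -- the restricted flow space is, through its second projection, homeomorphic to
    -- `𝓜_{k;r}(Q, v)`, and its first projection then becomes `p`
    (∃ e : NakajimaFlow.restrictedFlow Q o v k r ≃ₜ NakajimaFlow.quiverStratum Q o v k r,
      ∀ z : NakajimaFlow.restrictedFlow Q o v k r,
        (e z : NakajimaFlow.Orbits Q.double v) = z.1.2 ∧
        z.1.1 = NakajimaFlow.nakajimaProj k r (e z : NakajimaFlow.Orbits Q.double v)) := by
  have hdef : ∀ c ∈ quiverStratum Q o v k r, ∀ x, toOrbit x = c → IsAdapted k r x →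
      nakajimaProj k r c = toOrbit (restrict (lower_le v k r) x) := by
    rintro _ hc x rfl hx
    exact nakajimaProj_eq hx ((toOrbit_mem_quiverStratum_iff hv).1 hc).2.2
  have hmem : ∀ c ∈ quiverStratum Q o v k r,
      nakajimaProj k r c ∈ quiverStratum Q o (lower v k r) k 0 := by
    intro c hc
    obtain ⟨x, rfl, hx⟩ := exists_isAdapted hv hc
    rw [hdef _ hc x rfl hx]
    exact nakajimaProj_mem hloop hv hk hc hx
  have hflow : ∀ c ∈ quiverStratum Q o v k r,
      (nakajimaProj k r c, c) ∈ flowModuli Q o (lower v k r) v := by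
    intro c hc
    obtain ⟨x, rfl, hx⟩ := exists_isAdapted hv hc
    rw [hdef _ hc x rfl hx]
    exact mem_flowModuli_of_isAdapted hv hk hc.1 hx
  have huniq : ∀ c ∈ quiverStratum Q o v k r, ∀ c₀,
      (c₀, c) ∈ flowModuli Q o (lower v k r) v → c₀ = nakajimaProj k r c := by
    intro c hc c₀ h
    obtain ⟨x, hxc, hx, hx₀⟩ := exists_isAdapted_of_mem_flowModuli hv hk h
    rw [hdef c hc x hxc hx, hx₀]
  refine ⟨fun c hc => ⟨exists_isAdapted hv hc, hdef c hc, hmem c hc⟩,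
    fun c hc => ⟨⟨_, ⟨hmem c hc, hflow c hc⟩, fun c₀ h => huniq c hc c₀ h.2⟩,
      fun c₀ _ h => huniq c hc c₀ h⟩, ?_⟩
  -- The flow space over the stratum is the graph of `p`, so the inverse is `c ↦ (p c, c)` and its
  -- continuity is that of `p`.
  refine ⟨{ toFun := fun z => ⟨z.1.2, z.2.1.2⟩
            invFun := fun c => ⟨(nakajimaProj k r c.1, c.1), ⟨hmem _ c.2, c.2⟩, hflow _ c.2⟩
            left_inv := fun z => Subtype.ext (Prod.ext (huniq _ z.2.1.2 _ z.2.2).symm rfl)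
            right_inv := fun c => rfl
            continuous_toFun := (continuous_snd.comp continuous_subtype_val).subtype_mk _
            continuous_invFun := Continuous.subtype_mk
              ((continuousOn_iff_continuous_domRestrict.1 (continuousOn_nakajimaProj hv k r)).prodMk
                continuous_subtype_val) _ },
    fun z => ⟨rfl, huniq _ z.2.1.2 _ z.2.2⟩⟩
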